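/- Let $p$ be a prime, let $q$ be a power of $p$, let $k\ge 1$, and let $G$ be a split semisimple algebraic group over $\mathbb{F}_q$, with split maximal torus $T$, Borel subgroup $B\supset T$, unipotent radical $U$ of $B$, Weyl group $W$ and set of simple reflections $S\subset W$. For each $s\in S$, with simple root $\alpha_s$, fix an isomorphism of $\mathbb{G}_a$ (over $\mathbb{F}_q$) with the root subgroup $U_s\subset U$ of $\alpha_s$, let $\rho_s:\mathrm{SL}_2\to G$ be the corresponding homomorphism (equal to the given isomorphism on upper unitriangular matrices and to the coroot $\alpha_s^\vee$ on diagonal matrices), and put $$n_s=\rho_s\begin{pmatrix}0&1\\-1&0\end{pmatrix},\qquad h_s(r)=\rho_s\begin{pmatrix}r&0\\0&r^{-1}\end{pmatrix}\quad(r\in\mathbb{F}_{q^k}^\times).$$ The Yokonuma--Hecke algebra is $$\mathrm{Y}_{q,k}=\mathrm{End}_{G(\mathbb{F}_{q^k})}\big(\mathbb{C}[G(\mathbb{F}_{q^k})/U(\mathbb{F}_{q^k})]\big)$$ under composition. For $n\in N_G(T)(\mathbb{F}_{q^k})$ let $R_n\in \mathrm{Y}_{q,k}$ be the standard element attached to the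 double coset $UnU$ (on $\mathbb{F}_{q^k}$-points): it sends the indicator function of a coset $gU$ to the sum of the indicator functions of the cosets contained in $gUnU$. Write $R_s=R_{n_s}$ and $H_s(r)=R_{h_s(r)}$. Fix a nontrivial additive character $\psi:\mathbb{F}_p\to\mathbb{C}^\times$, and denote again by $\psi$ the character $\psi\circ\mathrm{Tr}_{\mathbb{F}_{q^k}/\mathbb{F}_p}$ of $\mathbb{F}_{q^k}$. Put $$E_s=\sum_{r\in\mathbb{F}_{q^k}^\times}H_s(r),\qquad \Psi_s=\sum_{r\in\mathbb{F}_{q^k}^\times}\psi(r)H_s(r),\qquad L_s=q^{-k}\,(E_s+R_s\Psi_s).$$ Then Juyumaya's elements $L_s$ ($s\in S$) satisfy the braid relations of $W$: for all $s,s'\in S$, with $m_{ss'}$ the order of $ss'$ in $W$, $$\underbrace{L_sL_{s'}L_s\cdots}_{m_{ss'}\text{ factors}}=\underbrace{L_{s'}L_sL_{s'}\cdots}_{m_{ss'}\text{ factors}}\quad\text{in }\mathrm{Y}_{q,k}.$$ -/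

import Mathlib

open scoped Nat MatrixGroups

noncomputable section

/-! ## Split semisimple groups

A split semisimple group with a split maximal torus and a system of root subgroups is given by
Chevalley's construction: a semisimple root datum `P` on `X` (the character lattice) and `Y` (the
cocharacter lattice), and a lattice with basis indexed by `m`, on which a Chevalley basis of the
Lie algebra and its divided powers act, and whose weights generate `X`. Every split semisimple
group over a field arises in this way, whatever its isogeny type. -/

namespace SplitGroup

variable {ι X Y : Type*} [Finite ι] [AddCommGroup X] [AddCommGroup Y]

/-- The roots generate a subgroup of `X` of finite index (i.e. span `X ⊗ ℚ`). -/
def IsSemisimple (P : RootDatum ι X Y) : Prop :=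
  ∀ x : X, ∃ n : ℕ, n ≠ 0 ∧ n • x ∈ AddSubgroup.closure (Set.range P.root)

/-- An admissible lattice `ℤ^m` in a faithful representation of the Lie algebra attached to `P`,
in a basis of weight vectors: the weight `wt i` of the `i`-th basis vector, and the integral
matrices `e α` of the root vectors of a Chevalley basis. -/
structure AdmissibleLattice (P : RootDatum ι X Y) (m : Type*) [Fintype m] [DecidableEq m] where
  wt : m → X
  e : ι → Matrix m m ℤ
  /-- `e α` maps the weight space of `μ` to the weight space of `μ + α`. -/
  wt_eq : ∀ α i j, e α i j ≠ 0 → wt i = wt j + P.root α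
  /-- `[e α, e (-α)]` is the coroot of `α`, which acts by `⟨μ, α^∨⟩` on the weight space of `μ`. -/
  bracket_neg : ∀ α, e α * e (P.reflectionPerm α α) - e (P.reflectionPerm α α) * e α =
    Matrix.diagonal fun i => P.toLinearMap (wt i) (P.coroot α)
  /-- `[e α, e β] = ± (r + 1) e (α + β)` if `α + β` is a root, where `r` is the largest natural
  number such that `β - r α` is a root. -/
  bracket_add : ∀ α β γ, P.root α + P.root β = P.root γ → ∃ ε : ℤ, (ε = 1 ∨ ε = -1) ∧
    e α * e β - e β * e α = (ε * ((P.chainBotCoeff α β : ℤ) + 1)) • e γ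
  /-- `[e α, e β] = 0` if `α + β` is neither a root nor zero. -/
  bracket_zero : ∀ α β, P.root α + P.root β ∉ Set.range P.root → P.root α + P.root β ≠ 0 →
    e α * e β = e β * e α
  /-- The divided powers `(e α) ^ n / n !` are integral. -/
  dvd : ∀ α n i j, ((n ! : ℕ) : ℤ) ∣ (e α ^ n) i j
  /-- The weights generate the character lattice. -/
  span_wt : AddSubgroup.closure (Set.range wt) = ⊤

namespace AdmissibleLattice

variable {P : RootDatum ι X Y} {m : Type*} [Fintype m] [DecidableEq m] (V : AdmissibleLattice P m)

/-- The divided power `(e α) ^ n / n !`. -/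
def divPow (α : ι) (n : ℕ) : Matrix m m ℤ := fun i j => (V.e α ^ n) i j / (n ! : ℕ)

lemma factorial_smul_divPow (α : ι) (n : ℕ) : ((n ! : ℕ) : ℤ) • V.divPow α n = V.e α ^ n := by
  ext i j
  simp only [Matrix.smul_apply, divPow, smul_eq_mul]
  exact Int.mul_ediv_cancel' (V.dvd α n i j)

lemma divPow_zero (α : ι) : V.divPow α 0 = 1 := by
  simpa using V.factorial_smul_divPow α 0

lemma divPow_mul (α : ι) (a b : ℕ) :
    V.divPow α a * V.divPow α b = ((a + b).choose a : ℤ) • V.divPow α (a + b) := by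
  have hinj : Function.Injective fun M : Matrix m m ℤ => ((a ! * b ! : ℕ) : ℤ) • M :=
    smul_right_injective _ (by positivity)
  apply hinj
  have h1 : (((a ! * b ! : ℕ) : ℤ) • (V.divPow α a * V.divPow α b)) = V.e α ^ (a + b) := by
    rw [pow_add, ← V.factorial_smul_divPow α a, ← V.factorial_smul_divPow α b]
    rw [smul_mul_smul_comm]
    push_cast
    rfl
  have h2 : ((a ! * b ! : ℕ) : ℤ) * ((a + b).choose a : ℤ) = (((a + b)! : ℕ) : ℤ) := by
    rw [← Nat.choose_mul_factorial_mul_factorial (Nat.le_add_right a b), Nat.add_sub_cancel_left]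
    push_cast
    ring
  simp only [h1, smul_smul, h2, V.factorial_smul_divPow]

lemma pow_apply_ne_zero (α : ι) (n : ℕ) : ∀ i j, (V.e α ^ n) i j ≠ 0 →
    P.toLinearMap (V.wt i) (P.coroot α) = P.toLinearMap (V.wt j) (P.coroot α) + 2 * n := by
  induction n with
  | zero =>
    intro i j h
    have : i = j := by
      by_contra hij
      exact h (by simp [hij])
    simp [this]
  | succ n ih =>
    intro i j h
    rw [pow_succ, Matrix.mul_apply] at h
    obtain ⟨k, -, hk⟩ := Finset.exists_ne_zero_of_sum_ne_zero h
    have h1 := ih i k (left_ne_zero_of_mul hk)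
    have h2 := V.wt_eq α k j (right_ne_zero_of_mul hk)
    rw [h1, h2, map_add, LinearMap.add_apply, P.root_coroot_two]
    push_cast
    ring

lemma isNilpotent_e (α : ι) : IsNilpotent (V.e α) := by
  obtain ⟨B, hB⟩ := (Set.finite_range fun p : m × m => (P.toLinearMap (V.wt p.1) (P.coroot α) -
    P.toLinearMap (V.wt p.2) (P.coroot α)).toNat).bddAbove
  refine ⟨B + 1, ?_⟩
  ext i j
  by_contra h
  have h1 := V.pow_apply_ne_zero α (B + 1) i j h
  have h2 := hB ⟨(i, j), rfl⟩
  simp only [] at h2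
  push_cast at h1
  omega

lemma pow_card (α : ι) (n : ℕ) (hn : Fintype.card m ≤ n) : V.e α ^ n = 0 := by
  have h := (V.isNilpotent_e α).map (Matrix.toLinAlgEquiv' (R := ℤ) (n := m))
  have h2 := h.charpoly_eq_X_pow_finrank
  have h3 := LinearMap.aeval_self_charpoly (Matrix.toLinAlgEquiv' (V.e α))
  rw [h2] at h3
  simp only [map_pow, Polynomial.aeval_X, Module.finrank_fintype_fun_eq_card] at h3
  rw [← map_pow] at h3
  have h4 : V.e α ^ Fintype.card m = 0 := by
    apply (Matrix.toLinAlgEquiv' (R := ℤ) (n := m)).injective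
    rw [h3, map_zero]
  exact pow_eq_zero_of_le hn h4

lemma divPow_eq_zero (α : ι) (n : ℕ) (hn : Fintype.card m ≤ n) : V.divPow α n = 0 := by
  ext i j
  simp [divPow, V.pow_card α n hn]

variable {R S : Type*} [CommRing R] [CommRing S]

/-- The matrix `exp (a e α) = ∑ n, a ^ n (e α) ^ n / n !` over `R`; the terms with
`n ≥ Fintype.card m` vanish. -/
def expMat (α : ι) (a : R) : Matrix m m R :=
  ∑ n ∈ Finset.range (Fintype.card m), a ^ n • (V.divPow α n).map (Int.castRingHom R)

lemma expMat_zero (α : ι) : V.expMat α (0 : R) = 1 := by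
  rcases isEmpty_or_nonempty m with h | h
  · exact Subsingleton.elim _ _
  · rw [expMat, Finset.sum_eq_single 0]
    · simp [V.divPow_zero]
    · intro n _ hn
      simp [hn]
    · intro h0
      simp at h0

lemma expMat_add (α : ι) (a b : R) : V.expMat α (a + b) = V.expMat α a * V.expMat α b := by
  have hz : ∀ n, Fintype.card m ≤ n → (V.divPow α n).map (Int.castRingHom R) = 0 := by
    intro n hn
    rw [V.divPow_eq_zero α n hn]
    ext
    simp
  have hm : ∀ k n, (V.divPow α k).map (Int.castRingHom R) * (V.divPow α n).map (Int.castRingHom R)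
      = ((k + n).choose k : R) • (V.divPow α (k + n)).map (Int.castRingHom R) := by
    intro k n
    rw [← Matrix.map_mul, V.divPow_mul]
    ext
    simp only [Matrix.map_apply, Matrix.smul_apply, smul_eq_mul, map_mul, map_natCast]
  set N := Fintype.card m
  have key := Finset.sum_range_diag_flip N (fun k l =>
    (a ^ k • (V.divPow α k).map (Int.castRingHom R)) *
      (b ^ l • (V.divPow α l).map (Int.castRingHom R)))
  rw [expMat, expMat, expMat, Finset.sum_mul_sum]
  trans ∑ k ∈ Finset.range N, ∑ l ∈ Finset.range (N - k),
    (a ^ k • (V.divPow α k).map (Int.castRingHom R)) *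
      (b ^ l • (V.divPow α l).map (Int.castRingHom R))
  · rw [← key]
    refine Finset.sum_congr rfl fun n _ => ?_
    rw [add_pow, Finset.sum_smul]
    refine Finset.sum_congr rfl fun k hk => ?_
    have hkn : k + (n - k) = n := by
      have := Finset.mem_range.mp hk
      omega
    rw [smul_mul_smul_comm, hm, hkn, smul_smul]
  · refine Finset.sum_congr rfl fun k _ => ?_
    refine Finset.sum_subset (fun l hl => ?_) (fun l _ hl => ?_)
    · simp only [Finset.mem_range] at hl ⊢
      omega
    · simp only [Finset.mem_range, not_lt] at hl
      rw [smul_mul_smul_comm, hm, hz (k + l) (by omega), smul_zero, smul_zero]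

/-- The element `x_α(a) = exp (a e α)` of the root subgroup of `α`. -/
def x (α : ι) (a : R) : GL m R where
  val := V.expMat α a
  inv := V.expMat α (-a)
  val_inv := by rw [← V.expMat_add, add_neg_cancel, V.expMat_zero]
  inv_val := by rw [← V.expMat_add, neg_add_cancel, V.expMat_zero]

lemma map_x (f : R →+* S) (α : ι) (a : R) :
    Matrix.GeneralLinearGroup.map f (V.x α a) = V.x α (f a) := by
  apply Units.ext
  ext i j
  simp [x, expMat, Matrix.sum_apply]

/-- The element of the torus `T(R) = Hom(X, Rˣ)` with value `χ`: it acts on the weight space of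
`μ` by `χ(μ)`. -/
def torusElt (χ : Multiplicative X →* Rˣ) : GL m R :=
  Units.map (Matrix.diagonalRingHom m R).toMonoidHom
    (MulEquiv.piUnits.symm fun i => χ (Multiplicative.ofAdd (V.wt i)))

/-- For an algebraically closed field `K`, the group of `K`-points of the split semisimple group:
the subgroup of `GL_m(K)` generated by the torus and the root subgroups. -/
def geomGroup (K : Type*) [Field K] [IsAlgClosed K] : Subgroup (GL m K) :=
  Subgroup.closure (Set.range (fun χ : Multiplicative X →* Kˣ => V.torusElt χ) ∪
    Set.range fun p : ι × K => V.x p.1 p.2)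

/-- For an algebraically closed field `K`, the group of `K`-points of the unipotent radical `U` of
the Borel subgroup: the subgroup generated by the root subgroups of the positive roots. -/
def geomUnipotent (b : P.Base) (K : Type*) [Field K] [IsAlgClosed K] : Subgroup (GL m K) :=
  Subgroup.closure {g | ∃ α : ι, P.root α ∈ AddSubmonoid.closure (P.root '' b.support) ∧
    ∃ a : K, g = V.x α a}

/-- For a field `F`, the group `G(F)` of `F`-rational points. -/
def G (F : Type*) [Field F] : Subgroup (GL m F) :=
  (V.geomGroup (AlgebraicClosure F)).comap
    (Matrix.GeneralLinearGroup.map (algebraMap F (AlgebraicClosure F)))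

/-- For a field `F`, the group `U(F)` of `F`-rational points of `U`, as a subgroup of `G(F)`. -/
def U (b : P.Base) (F : Type*) [Field F] : Subgroup (V.G F) :=
  ((V.geomUnipotent b (AlgebraicClosure F)).comap
    (Matrix.GeneralLinearGroup.map (algebraMap F (AlgebraicClosure F)))).subgroupOf (V.G F)

variable {F : Type*} [Field F]

/-- `x_α(a)` as an element of `G(F)`. -/
def xG (α : ι) (a : F) : V.G F :=
  ⟨V.x α a, by
    rw [G, Subgroup.mem_comap, V.map_x]
    exact Subgroup.subset_closure (Or.inr ⟨(α, _), rfl⟩)⟩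

/-- For a simple root `α`, the isomorphism `a ↦ x_α(c a)` of the additive group with the root
subgroup of `α` defines a homomorphism `ρ_α : SL₂ → G` with
`ρ_α !![1, a; 0, 1] = x_α(c a)` and `ρ_α !![1, 0; a, 1] = x_{-α}(c⁻¹ a)`. This is
`ρ_α !![0, r; -r⁻¹, 0]`, by the factorization
`!![0, r; -r⁻¹, 0] = !![1, r; 0, 1] * !![1, 0; -r⁻¹, 1] * !![1, r; 0, 1]`. -/
def rhoAnti (α : ι) (c r : Fˣ) : V.G F :=
  V.xG α (c * r : F) * V.xG (P.reflectionPerm α α) (-(c * r : F)⁻¹) * V.xG α (c * r : F)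

/-- `n_α = ρ_α !![0, 1; -1, 0]`. -/
def n (α : ι) (c : Fˣ) : V.G F := V.rhoAnti α c 1

/-- `h_α(r) = ρ_α !![r, 0; 0, r⁻¹]`, by the factorization
`!![r, 0; 0, r⁻¹] = !![0, r; -r⁻¹, 0] * (!![0, 1; -1, 0])⁻¹`. -/
def h (α : ι) (c r : Fˣ) : V.G F := V.rhoAnti α c r * (V.rhoAnti α c 1)⁻¹

end AdmissibleLattice

end SplitGroup

/-! ## The Yokonuma–Hecke algebra -/

namespace YokonumaHecke

section

variable {Γ : Type*} [Group Γ] (U : Subgroup Γ)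

/-- The action of `g` on functions on `Γ ⧸ U`: `(g • f)(x) = f(g⁻¹ x)`. -/
def translation (g : Γ) : Module.End ℂ (Γ ⧸ U → ℂ) :=
  LinearMap.funLeft ℂ ℂ fun x : Γ ⧸ U => g⁻¹ • x

/-- The algebra `End_Γ(ℂ[Γ ⧸ U])`. -/
def Y : Subalgebra ℂ (Module.End ℂ (Γ ⧸ U → ℂ)) :=
  Subalgebra.centralizer ℂ (Set.range (translation U))

/-- The relation on pairs `(gU, g'U)` given by `g⁻¹ g' ∈ U w U`. -/
def InPosition (w : Γ) (y x : Γ ⧸ U) : Prop :=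
  ∃ g g' : Γ, y = (g : Γ ⧸ U) ∧ x = (g' : Γ ⧸ U) ∧ g⁻¹ * g' ∈ DoubleCoset.doubleCoset w U U

lemma inPosition_smul (w g : Γ) (y x : Γ ⧸ U) (hxy : InPosition U w y x) :
    InPosition U w (g • y) (g • x) := by
  obtain ⟨a, a', rfl, rfl, h⟩ := hxy
  refine ⟨g * a, g * a', rfl, rfl, ?_⟩
  rwa [mul_inv_rev, mul_assoc, inv_mul_cancel_left]

variable [Finite Γ]

open scoped Classical in
/-- The standard operator attached to the double coset `U w U`: it sends the indicator function of
`gU` to the sum of the indicator functions of the cosets contained in `g U w U`. -/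
def standardEnd (w : Γ) : Module.End ℂ (Γ ⧸ U → ℂ) :=
  letI := Fintype.ofFinite (Γ ⧸ U)
  { toFun := fun f x => ∑ y : Γ ⧸ U, if InPosition U w y x then f y else 0
    map_add' := by
      intro f f'
      ext x
      rw [Pi.add_apply, ← Finset.sum_add_distrib]
      refine Finset.sum_congr rfl fun y _ => ?_
      split_ifs <;> simp
    map_smul' := by
      intro c f
      ext x
      simp [Finset.mul_sum] }

/-- `standardEnd` as an element of `End_Γ(ℂ[Γ ⧸ U])`. -/
def standard (w : Γ) : Y U :=
  ⟨standardEnd U w, by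
    rw [Y, Subalgebra.mem_centralizer_iff]
    rintro _ ⟨g, rfl⟩
    ext1 f
    funext x
    simp only [Module.End.mul_apply, translation, LinearMap.funLeft_apply, standardEnd,
      LinearMap.coe_mk, AddHom.coe_mk]
    let := Fintype.ofFinite (Γ ⧸ U)
    refine Fintype.sum_equiv (MulAction.toPerm g) _ _ fun y => ?_
    have : InPosition U w y (g⁻¹ • x) ↔ InPosition U w (g • y) x := by
      constructor
      · intro h
        simpa using inPosition_smul U w g _ _ h
      · intro h
        simpa using inPosition_smul U w g⁻¹ _ _ h
    simp only [MulAction.toPerm_apply, inv_smul_smul]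
    classical exact if_congr this rfl rfl⟩

end

/-- The additive character of a finite field of characteristic `p` induced by an additive
character of the prime field through the trace. -/
def inducedChar {p : ℕ} (F : Type*) [Field F] [Algebra (ZMod p) F] (ψ : AddChar (ZMod p) ℂ) :
    F → ℂ := fun r => ψ (Algebra.trace (ZMod p) F r)

/-- The product `a b a b ⋯` with `n` factors. -/
def altProd {M : Type*} [Monoid M] (a b : M) : ℕ → M
  | 0 => 1
  | n + 1 => a * altProd b a n

section

open SplitGroup

variable {ι X Y' : Type*} [Finite ι] [AddCommGroup X] [AddCommGroup Y'] {P : RootDatum ι X Y'}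
  {m : Type*} [Fintype m] [DecidableEq m] (V : AdmissibleLattice P m) (b : P.Base)
  {F : Type*} [Field F] [Finite F]

/-- `H_α(r) = R_t` for `t = h_α(r)`. -/
def H (α : ι) (c r : Fˣ) : Y (V.U b F) := standard (V.U b F) (V.h α c r)

open scoped Classical in
/-- `E_α = ∑ r, H_α(r)`. -/
def E (α : ι) (c : Fˣ) : Y (V.U b F) :=
  letI := Fintype.ofFinite Fˣ
  ∑ r : Fˣ, H V b α c r

/-- `R_α`, the standard operator of `n_α`. -/
def R (α : ι) (c : Fˣ) : Y (V.U b F) := standard (V.U b F) (V.n α c)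

open scoped Classical in
/-- `Ψ_α = ∑ r, ψ(r) H_α(r)`. -/
def Psi (ψ : F → ℂ) (α : ι) (c : Fˣ) : Y (V.U b F) :=
  letI := Fintype.ofFinite Fˣ
  ∑ r : Fˣ, ψ r • H V b α c r

/-- Juyumaya's element `L_α = Q⁻¹ (E_α + R_α Ψ_α)`. -/
def L (Q : ℂ) (ψ : F → ℂ) (α : ι) (c : Fˣ) : Y (V.U b F) :=
  Q⁻¹ • (E V b α c + R V b α c * Psi V b ψ α c)

end

end YokonumaHecke

end

noncomputable section

set_option linter.unusedSectionVars false

namespace SplitGroup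
namespace AdmissibleLattice

variable {ι X Y : Type*} [Finite ι] [AddCommGroup X] [AddCommGroup Y]
  {P : RootDatum ι X Y} {m : Type*} [Fintype m] [DecidableEq m] (V : AdmissibleLattice P m)

/-! ### Exponentials and the adjoint action -/

/-! Write Q = q^k, and for every root γ put Θ_γ = ∑ ψ(r) H_γ(-r⁻¹), where H_γ(t) is the standard
operator of γ^∨(t). The Θ_γ commute, since they are built from the torus. The key identity is L_s
R_s = Θ_{α_s} (`L_mul_R`). It comes from the quadratic relation R_s² = Q H_s(-1) + R_s E_s
(`R_mul_self`): conjugation by R_s inverts the argument of H_s, so L_s R_s = Q⁻¹ (R_s E_s + R_s² Ψ')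
with Ψ' = ∑ ψ(r) H_s(r⁻¹), and E_s Ψ' = (∑ ψ(r)) E_s = -E_s makes the two terms in R_s E_s cancel
(`juyumaya_mul`).

Now R_s is invertible and R_s Θ_γ R_s⁻¹ = Θ_{sγ}. Substituting L_s = Θ_{α_s} R_s⁻¹ in an alternating
word and moving all Θ to the left gives Θ_{γ_1} ⋯ Θ_{γ_m} times the alternating word in the R⁻¹,
where γ_1, …, γ_m are α, s_α β, s_α s_β α, …, the positive roots of the rank two system. The other
word gives the same roots in reverse order. As the Θ_γ commute, the braid relation for the L_s
follows from that for the R_s (`altProd_comm_of_mul_eq`).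

For the R_s (`altProd_R`), an endomorphism is determined by its value on the indicator function of
U, which can be written as an element of the group algebra applied to that function; this reverses
products. R_s corresponds to X_α n_α, with X_α the sum over the root subgroup of α. Moving the n to
the right in an alternating word leaves X_{γ_1} ⋯ X_{γ_m} times the alternating word in the n, so
two facts suffice. (a) The product of the X_γ does not change when its order is reversed
(`prod_rootSum_reverse`). In one order it is invariant on the left under all the root subgroups
involved, in the other order on the right; multiplying the two products gives Q^m times either. This
needs the commutator relations (`commutator_mem`) but no uniqueness of factorization. (b) The n
satisfy the braid relations (`altProd_w`). Over ℤ the two words differ by 1 or α^∨(-1), and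
exchanging α and β rules out a difference except when α and β are orthogonal, where the two elements
commute.

The rest is the theory of Chevalley groups that this needs. Commutators are found over ℤ[a][T] by
comparing two solutions of one linear differential equation; U is split as U_α times a complement
normalized by n_α, over the algebraic closure by weights and then over F by Galois descent. -/

lemma divPow_one (α : ι) : V.divPow α 1 = V.e α := by
  simpa using V.factorial_smul_divPow α 1

lemma e_mul_divPow (α : ι) (n : ℕ) : V.e α * V.divPow α n = ((n + 1 : ℕ) : ℤ) • V.divPow α (n + 1) := by
  rw [← V.divPow_one, V.divPow_mul, add_comm 1 n]
  simp

lemma divPow_wt (α : ι) (n : ℕ) (i j : m) (h : V.divPow α n i j ≠ 0) :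
    V.wt i = V.wt j + n • P.root α := by
  have h1 : (V.e α ^ n) i j ≠ 0 := by
    rw [← V.factorial_smul_divPow]
    simp [h, Nat.factorial_ne_zero]
  clear h
  induction n generalizing i j with
  | zero =>
    have : i = j := by
      by_contra hij
      exact h1 (by simp [hij])
    simp [this]
  | succ n ih =>
    rw [pow_succ, Matrix.mul_apply] at h1
    obtain ⟨k, -, hk⟩ := Finset.exists_ne_zero_of_sum_ne_zero h1
    rw [ih i k (left_ne_zero_of_mul hk), V.wt_eq α k j (right_ne_zero_of_mul hk), succ_nsmul]
    abel

/-- The hypothesis says that `y k` is the divided power ad(e_α)^k / k! applied to `y 0`, so this is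
the Leibniz rule in divided powers. The induction proves it after multiplication by n + 1, which
loses nothing over ℤ. -/
lemma divPow_mul_of_chain (α : ι) (y : ℕ → Matrix m m ℤ)
    (hy : ∀ k, V.e α * y k - y k * V.e α = ((k + 1 : ℕ) : ℤ) • y (k + 1)) (n : ℕ) :
    V.divPow α n * y 0 = ∑ p ∈ Finset.HasAntidiagonal.antidiagonal n, y p.1 * V.divPow α p.2 := by
  induction n with
  | zero => simp [V.divPow_zero]
  | succ n ih =>
    have hinj : Function.Injective fun M : Matrix m m ℤ => ((n + 1 : ℕ) : ℤ) • M :=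
      smul_right_injective _ (by positivity)
    apply hinj
    simp only
    rw [← smul_mul_assoc, ← V.e_mul_divPow, mul_assoc, ih, Finset.mul_sum]
    have h1 : ∀ p ∈ Finset.HasAntidiagonal.antidiagonal n, V.e α * (y p.1 * V.divPow α p.2) =
        ((p.2 + 1 : ℕ) : ℤ) • (y p.1 * V.divPow α (p.2 + 1)) +
          ((p.1 + 1 : ℕ) : ℤ) • (y (p.1 + 1) * V.divPow α p.2) := by
      intro p _
      rw [← mul_assoc, sub_eq_iff_eq_add.mp (hy p.1), add_mul, mul_assoc, V.e_mul_divPow,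
        mul_smul_comm, smul_mul_assoc, add_comm]
    rw [Finset.sum_congr rfl h1, Finset.sum_add_distrib, Finset.smul_sum]
    have h2 : ∀ p ∈ Finset.HasAntidiagonal.antidiagonal (n + 1), ((n + 1 : ℕ) : ℤ) • (y p.1 * V.divPow α p.2) =
        ((p.2 : ℕ) : ℤ) • (y p.1 * V.divPow α p.2) + ((p.1 : ℕ) : ℤ) • (y p.1 * V.divPow α p.2) := by
      intro p hp
      rw [← add_smul, ← Nat.cast_add, add_comm p.2, Finset.HasAntidiagonal.mem_antidiagonal.mp hp]
    rw [Finset.sum_congr rfl h2, Finset.sum_add_distrib, Finset.Nat.sum_antidiagonal_succ',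
      Finset.Nat.sum_antidiagonal_succ (f := fun p => ((p.1 : ℕ) : ℤ) • (y p.1 * V.divPow α p.2))]
    simp

variable {R : Type*} [CommRing R]

/-- The image of an integral matrix in the matrices over `R`. -/
abbrev toR (R : Type*) [CommRing R] (M : Matrix m m ℤ) : Matrix m m R := M.map (Int.castRingHom R)

lemma toR_mul (M N : Matrix m m ℤ) : toR R (M * N) = toR R M * toR R N := Matrix.map_mul

lemma expMat_eq_sum (α : ι) (a : R) (N : ℕ) (hN : Fintype.card m ≤ N) :
    V.expMat α a = ∑ n ∈ Finset.range N, a ^ n • toR R (V.divPow α n) := by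
  rw [expMat]
  refine Finset.sum_subset (by simpa using hN) fun n _ hn => ?_
  rw [V.divPow_eq_zero α n (by simpa using hn)]
  ext
  simp

/-- This is exp(a e) y exp(-a e) = exp(a ad e) y. The integral chain `y` replaces the denominators,
so it holds over every commutative ring. -/
lemma expMat_mul_of_chain (α : ι) (a : R) (y : ℕ → Matrix m m ℤ)
    (hy : ∀ k, V.e α * y k - y k * V.e α = ((k + 1 : ℕ) : ℤ) • y (k + 1)) (K : ℕ)
    (hK : ∀ k, K ≤ k → y k = 0) :
    V.expMat α a * toR R (y 0) =
      (∑ k ∈ Finset.range K, a ^ k • toR R (y k)) * V.expMat α a := by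
  set N := Fintype.card m with hNdef
  set M := N + K
  have key := Finset.sum_range_diag_flip M (fun k l =>
    (a ^ k • toR R (y k)) * (a ^ l • toR R (V.divPow α l)))
  trans ∑ k ∈ Finset.range M, ∑ l ∈ Finset.range (M - k),
    (a ^ k • toR R (y k)) * (a ^ l • toR R (V.divPow α l))
  · rw [← key, V.expMat_eq_sum α a M (by omega), Finset.sum_mul]
    refine Finset.sum_congr rfl fun n _ => ?_
    rw [smul_mul_assoc, ← toR_mul, V.divPow_mul_of_chain α y hy,
      Finset.Nat.sum_antidiagonal_eq_sum_range_succ (fun k l => y k * V.divPow α l)]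
    have : toR R (∑ k ∈ Finset.range n.succ, y k * V.divPow α (n - k)) =
        ∑ k ∈ Finset.range n.succ, toR R (y k) * toR R (V.divPow α (n - k)) := by
      rw [← Finset.sum_congr rfl fun k _ => toR_mul (R := R) (y k) (V.divPow α (n - k))]
      exact map_sum (Int.castRingHom R).mapMatrix _ _
    rw [this, Finset.smul_sum]
    refine Finset.sum_congr rfl fun k hk => ?_
    have hkn : k + (n - k) = n := by
      have := Finset.mem_range.mp hk
      omega
    rw [smul_mul_smul_comm, ← pow_add, hkn]
  · rw [Finset.sum_mul]
    symm
    have h1 : ∀ k ∈ Finset.range K, (a ^ k • toR R (y k)) * V.expMat α a =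
        ∑ l ∈ Finset.range (M - k), (a ^ k • toR R (y k)) * (a ^ l • toR R (V.divPow α l)) := by
      intro k hk
      have := Finset.mem_range.mp hk
      rw [V.expMat_eq_sum α a (M - k) (by omega), Finset.mul_sum]
    rw [Finset.sum_congr rfl h1]
    refine Finset.sum_subset (by simp [M]) fun k _ hk => ?_
    rw [hK k (by simpa using hk)]
    refine Finset.sum_eq_zero fun l _ => ?_
    have : toR R (0 : Matrix m m ℤ) = 0 := map_zero (Int.castRingHom R).mapMatrix
    rw [this]
    simp

lemma x_coe (α : ι) (a : R) : (V.x α a : Matrix m m R) = V.expMat α a := rfl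

lemma x_add (α : ι) (a b : R) : V.x α (a + b) = V.x α a * V.x α b :=
  Units.ext (V.expMat_add α a b)

lemma x_zero (α : ι) : V.x α (0 : R) = 1 := Units.ext (V.expMat_zero α)

lemma x_neg (α : ι) (a : R) : V.x α (-a) = (V.x α a)⁻¹ := by
  rw [eq_inv_iff_mul_eq_one, ← x_add, neg_add_cancel, x_zero]

/-- Two matrices conjugate by an integral matrix: so are the root subgroups. -/
lemma conj_x_of_conj_e (g : GL m ℤ) (α β : ι) (ε : ℤ)
    (h : (g : Matrix m m ℤ) * V.e α = ε • (V.e β * (g : Matrix m m ℤ))) (a : R) :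
    Matrix.GeneralLinearGroup.map (Int.castRingHom R) g * V.x α a =
      V.x β (ε * a) * Matrix.GeneralLinearGroup.map (Int.castRingHom R) g := by
  have h1 : ∀ n, (g : Matrix m m ℤ) * V.e α ^ n = ε ^ n • (V.e β ^ n * (g : Matrix m m ℤ)) := by
    intro n
    induction n with
    | zero => simp
    | succ n ih =>
      rw [pow_succ, ← mul_assoc, ih, smul_mul_assoc, mul_assoc, h, mul_smul_comm, smul_smul,
        ← mul_assoc, ← pow_succ, ← pow_succ]
  have h2 : ∀ n, (g : Matrix m m ℤ) * V.divPow α n = ε ^ n • (V.divPow β n * (g : Matrix m m ℤ)) := by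
    intro n
    have hinj : Function.Injective fun M : Matrix m m ℤ => ((n ! : ℕ) : ℤ) • M :=
      smul_right_injective _ (by positivity)
    apply hinj
    simp only
    rw [← mul_smul_comm, V.factorial_smul_divPow, h1, smul_comm, ← smul_mul_assoc (_ : ℤ) (V.divPow β n),
      V.factorial_smul_divPow]
  apply Units.ext
  rw [Units.val_mul, Units.val_mul, x_coe, x_coe, expMat, expMat, Finset.mul_sum, Finset.sum_mul]
  refine Finset.sum_congr rfl fun n _ => ?_
  have h3 : ((Matrix.GeneralLinearGroup.map (Int.castRingHom R) g : GL m R) : Matrix m m R) =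
    toR R (g : Matrix m m ℤ) := rfl
  rw [h3, mul_smul_comm, smul_mul_assoc, ← toR_mul, ← toR_mul, h2, mul_pow, mul_comm, ← smul_smul]
  congr 1
  ext i j
  simp only [toR, Matrix.map_apply, Matrix.smul_apply, smul_eq_mul, map_mul, map_pow, eq_intCast]

/-! ### Diagonal matrices -/

/-- The diagonal matrix with given invertible entries. -/
def diag (d : m → Rˣ) : GL m R :=
  Units.map (Matrix.diagonalRingHom m R).toMonoidHom (MulEquiv.piUnits.symm d)

lemma diag_coe (d : m → Rˣ) : (diag d : Matrix m m R) = Matrix.diagonal fun i => (d i : R) := rfl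

lemma diag_mul (d d' : m → Rˣ) : diag d * diag d' = diag (d * d') := by
  apply Units.ext
  rw [Units.val_mul, diag_coe, diag_coe, diag_coe, Matrix.diagonal_mul_diagonal]
  rfl

lemma diag_one : diag (1 : m → Rˣ) = 1 := by
  apply Units.ext
  rw [diag_coe]
  simp

/-- Only the behaviour of `d` under a shift of weight by `α` matters; `d` need not come from a
character of the weight lattice. `w_eq` and `exists_diag_conj` use this freedom, with exponents that
are rounded quotients. -/
lemma diag_mul_x (d : m → Rˣ) (α : ι) (u : Rˣ)
    (h : ∀ i j, V.wt i = V.wt j + P.root α → d i = u * d j) (a : R) :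
    diag d * V.x α a = V.x α (u * a) * diag d := by
  have h1 : ∀ (n : ℕ) (i j : m), V.divPow α n i j ≠ 0 → d i = u ^ n * d j := by
    intro n i j hij
    have h1 : (V.e α ^ n) i j ≠ 0 := by
      rw [← V.factorial_smul_divPow]
      simp [hij, Nat.factorial_ne_zero]
    clear hij
    induction n generalizing i j with
    | zero =>
      have : i = j := by
        by_contra hij
        exact h1 (by simp [hij])
      simp [this]
    | succ n ih =>
      rw [pow_succ, Matrix.mul_apply] at h1
      obtain ⟨k, -, hk⟩ := Finset.exists_ne_zero_of_sum_ne_zero h1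
      rw [ih i k (left_ne_zero_of_mul hk), h k j (V.wt_eq α k j (right_ne_zero_of_mul hk)),
        pow_succ, mul_assoc]
  apply Units.ext
  rw [Units.val_mul, Units.val_mul, x_coe, x_coe, expMat, expMat, Finset.mul_sum, Finset.sum_mul]
  refine Finset.sum_congr rfl fun n _ => ?_
  rw [diag_coe]
  ext i j
  rw [Matrix.diagonal_mul, Matrix.mul_diagonal]
  simp only [Matrix.smul_apply, Matrix.map_apply, smul_eq_mul]
  by_cases hij : V.divPow α n i j = 0
  · simp [hij]
  · rw [h1 n i j hij]
    push_cast
    ring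

end AdmissibleLattice
end SplitGroup

namespace SplitGroup
namespace AdmissibleLattice

variable {ι X Y : Type*} [Finite ι] [AddCommGroup X] [AddCommGroup Y]
  {P : RootDatum ι X Y} {m : Type*} [Fintype m] [DecidableEq m] (V : AdmissibleLattice P m)
  {R : Type*} [CommRing R]

/-! ### The elements `w_α(r)` of the normalizer of the torus -/

/-- The pairing of the weight of a basis vector with a coroot. -/
def ht (α : ι) (i : m) : ℤ := P.toLinearMap (V.wt i) (P.coroot α)

/-- The coroot `α^∨` as an integral matrix. -/
def cartan (α : ι) : Matrix m m ℤ := Matrix.diagonal (V.ht α)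

lemma root_neg_idx (α : ι) : P.root (P.reflectionPerm α α) = - P.root α := by
  rw [P.root_reflectionPerm, P.reflection_apply_self]

lemma neg_neg_idx (α : ι) :
    P.reflectionPerm (P.reflectionPerm α α) (P.reflectionPerm α α) = α := by
  apply P.root.injective
  rw [root_neg_idx, root_neg_idx, neg_neg]

lemma ht_neg (α : ι) (i : m) : V.ht (P.reflectionPerm α α) i = - V.ht α i := by
  simp [ht]

lemma cartan_neg (α : ι) : V.cartan (P.reflectionPerm α α) = - V.cartan α := by
  ext i j
  by_cases h : i = j
  · subst h
    simp [cartan, ht_neg]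
  · simp [cartan, h]

lemma ht_of_wt_eq (α β : ι) (i j : m) (h : V.wt i = V.wt j + P.root β) :
    V.ht α i = V.ht α j + P.pairing β α := by
  rw [ht, h, map_add, LinearMap.add_apply, P.root_coroot_eq_pairing, ht]

lemma e_mul_cartan (α β : ι) :
    V.e β * V.cartan α - V.cartan α * V.e β = (- P.pairing β α) • V.e β := by
  ext i j
  simp only [cartan, Matrix.sub_apply, Matrix.mul_diagonal, Matrix.diagonal_mul, Matrix.smul_apply,
    smul_eq_mul]
  by_cases h : V.e β i j = 0
  · simp [h]
  · rw [V.ht_of_wt_eq α β i j (V.wt_eq β i j h)]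
    ring

lemma e_bracket_neg (α : ι) : V.e α * V.e (P.reflectionPerm α α) -
    V.e (P.reflectionPerm α α) * V.e α = V.cartan α := V.bracket_neg α

lemma x_mul_of_chain (α : ι) (t : R) (y₀ y₁ y₂ y₃ : Matrix m m ℤ)
    (h₀ : V.e α * y₀ - y₀ * V.e α = y₁) (h₁ : V.e α * y₁ - y₁ * V.e α = (2 : ℤ) • y₂)
    (h₂ : V.e α * y₂ - y₂ * V.e α = (3 : ℤ) • y₃) (h₃ : V.e α * y₃ - y₃ * V.e α = 0) :
    (V.x α t : Matrix m m R) * toR R y₀ =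
      (toR R y₀ + t • toR R y₁ + (t ^ 2) • toR R y₂ + (t ^ 3) • toR R y₃) *
        (V.x α t : Matrix m m R) := by
  have h := V.expMat_mul_of_chain α t (fun k => match k with
    | 0 => y₀ | 1 => y₁ | 2 => y₂ | 3 => y₃ | _ => 0) (by
    rintro (_ | _ | _ | _ | k)
    · simpa using h₀
    · exact h₁
    · exact h₂
    · simpa using h₃
    · simp) 4 (by
    rintro (_ | _ | _ | _ | k) hk
    · omega
    · omega
    · omega
    · omega
    · rfl)
  rw [x_coe]
  refine h.trans ?_
  simp [Finset.sum_range_succ]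

lemma toR_zero : toR R (0 : Matrix m m ℤ) = 0 := map_zero (Int.castRingHom R).mapMatrix

lemma toR_neg (M : Matrix m m ℤ) : toR R (-M) = - toR R M := map_neg (Int.castRingHom R).mapMatrix _

lemma toR_smul (k : ℤ) (M : Matrix m m ℤ) : toR R (k • M) = (k : R) • toR R M := by
  ext i j
  simp only [toR, Matrix.map_apply, Matrix.smul_apply, smul_eq_mul, map_mul, eq_intCast]

lemma x_mul_cartan (α : ι) (t : R) : (V.x α t : Matrix m m R) * toR R (V.cartan α) =
    (toR R (V.cartan α) - (2 * t) • toR R (V.e α)) * (V.x α t : Matrix m m R) := by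
  rw [V.x_mul_of_chain α t (V.cartan α) ((-2 : ℤ) • V.e α) 0 0]
  · congr 1
    rw [toR_smul, toR_zero]
    match_scalars <;> ring
  · rw [e_mul_cartan, P.pairing_same]
  · rw [mul_smul_comm, smul_mul_assoc]
    simp
  · simp
  · simp

lemma x_mul_neg (α : ι) (t : R) :
    (V.x α t : Matrix m m R) * toR R (V.e (P.reflectionPerm α α)) =
    (toR R (V.e (P.reflectionPerm α α)) + t • toR R (V.cartan α) - (t * t) • toR R (V.e α)) *
      (V.x α t : Matrix m m R) := by
  rw [V.x_mul_of_chain α t _ (V.cartan α) (- V.e α) 0 (V.e_bracket_neg α)]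
  · congr 1
    rw [toR_neg, toR_zero]
    match_scalars <;> ring
  · rw [e_mul_cartan, P.pairing_same, smul_neg, neg_smul]
  · simp
  · simp

lemma x_mul_e (α : ι) (t : R) : (V.x α t : Matrix m m R) * toR R (V.e α) =
    toR R (V.e α) * (V.x α t : Matrix m m R) := by
  rw [V.x_mul_of_chain α t (V.e α) 0 0 0 (by simp) (by simp) (by simp) (by simp)]
  simp

lemma x_neg_mul_cartan (α : ι) (t : R) :
    (V.x (P.reflectionPerm α α) t : Matrix m m R) * toR R (V.cartan α) =
    (toR R (V.cartan α) + (2 * t) • toR R (V.e (P.reflectionPerm α α))) *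
      (V.x (P.reflectionPerm α α) t : Matrix m m R) := by
  have h := V.x_mul_cartan (P.reflectionPerm α α) t
  rw [cartan_neg] at h
  have h2 : toR R (-V.cartan α) = - toR R (V.cartan α) := toR_neg _
  rw [h2, mul_neg, neg_eq_iff_eq_neg] at h
  rw [h, ← neg_mul]
  congr 1
  abel

lemma x_neg_mul_e (α : ι) (t : R) :
    (V.x (P.reflectionPerm α α) t : Matrix m m R) * toR R (V.e α) =
    (toR R (V.e α) - t • toR R (V.cartan α) - (t * t) • toR R (V.e (P.reflectionPerm α α))) *
      (V.x (P.reflectionPerm α α) t : Matrix m m R) := by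
  have h := V.x_mul_neg (P.reflectionPerm α α) t
  rw [cartan_neg, neg_neg_idx] at h
  have h2 : toR R (-V.cartan α) = - toR R (V.cartan α) := toR_neg _
  rw [h, h2]
  congr 1
  rw [smul_neg]
  abel

/-- `w_α(r) = x_α(r) x_{-α}(-r⁻¹) x_α(r)`. -/
def w (α : ι) (r : Rˣ) : GL m R :=
  V.x α (r : R) * V.x (P.reflectionPerm α α) (-(r⁻¹ : Rˣ) : R) * V.x α (r : R)

/-- With the next two lemmas this describes the adjoint action of `w` on the sl₂-triple of `α`, by
composing the actions of its three exponential factors. Over ℤ it also shows that `w` joins basis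
vectors of opposite height only. -/
lemma w_mul_cartan (α : ι) (r : Rˣ) : (V.w α r : Matrix m m R) * toR R (V.cartan α) =
    - (toR R (V.cartan α) * (V.w α r : Matrix m m R)) := by
  have hr : (r : R) * ((r⁻¹ : Rˣ) : R) = 1 := by simp
  simp only [w, Units.val_mul]
  rw [mul_assoc, V.x_mul_cartan, ← mul_assoc, mul_assoc (V.x α (r : R) : Matrix m m R), mul_sub,
    mul_smul_comm, x_neg_mul_cartan, x_neg_mul_e]
  trans ((V.x α (r : R) : Matrix m m R) * (- toR R (V.cartan α) - (2 * r : R) • toR R (V.e α)) *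
    (V.x (P.reflectionPerm α α) (-(r⁻¹ : Rˣ) : R) : Matrix m m R) * (V.x α (r : R) : Matrix m m R))
  · congr 1
    rw [mul_assoc (V.x α (r : R) : Matrix m m R)]
    congr 1
    rw [← smul_mul_assoc, ← sub_mul]
    congr 1
    match_scalars
    · linear_combination (-2) * hr
    · linear_combination (2 * ((r⁻¹ : Rˣ) : R)) * hr
    · ring
  · rw [mul_sub, mul_smul_comm, x_mul_e, mul_neg, x_mul_cartan, ← neg_mul, ← smul_mul_assoc,
      ← sub_mul]
    simp only [mul_assoc]
    rw [← neg_mul]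
    congr 1
    match_scalars <;> ring

lemma w_mul_e (α : ι) (r : Rˣ) : (V.w α r : Matrix m m R) * toR R (V.e α) =
    - ((r⁻¹ * r⁻¹ : Rˣ) : R) • (toR R (V.e (P.reflectionPerm α α)) * (V.w α r : Matrix m m R)) := by
  have hr : (r : R) * ((r⁻¹ : Rˣ) : R) = 1 := by simp
  simp only [w, Units.val_mul]
  rw [mul_assoc, V.x_mul_e, ← mul_assoc, mul_assoc (V.x α (r : R) : Matrix m m R), x_neg_mul_e,
    ← mul_assoc, mul_sub, mul_sub, mul_smul_comm, mul_smul_comm, x_mul_e, x_mul_cartan, x_mul_neg,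
    ← smul_mul_assoc, ← smul_mul_assoc, ← sub_mul, ← sub_mul]
  simp only [mul_assoc]
  rw [← smul_mul_assoc]
  congr 1
  match_scalars
  · linear_combination (-1 + (r : R) * ((r⁻¹ : Rˣ) : R)) * hr
  · linear_combination (-((r⁻¹ : Rˣ) : R)) * hr
  · ring

lemma w_mul_neg (α : ι) (r : Rˣ) :
    (V.w α r : Matrix m m R) * toR R (V.e (P.reflectionPerm α α)) =
    - ((r * r : Rˣ) : R) • (toR R (V.e α) * (V.w α r : Matrix m m R)) := by
  have hr : (r : R) * ((r⁻¹ : Rˣ) : R) = 1 := by simp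
  simp only [w, Units.val_mul]
  have hn : (V.x (P.reflectionPerm α α) (-(r⁻¹ : Rˣ) : R) : Matrix m m R) *
      toR R (V.e (P.reflectionPerm α α)) = toR R (V.e (P.reflectionPerm α α)) *
      (V.x (P.reflectionPerm α α) (-(r⁻¹ : Rˣ) : R) : Matrix m m R) := V.x_mul_e _ _
  rw [mul_assoc, V.x_mul_neg, ← mul_assoc, mul_assoc (V.x α (r : R) : Matrix m m R), mul_sub,
    mul_add, mul_smul_comm, mul_smul_comm, x_neg_mul_e, hn, x_neg_mul_cartan]
  trans ((V.x α (r : R) : Matrix m m R) * (- (r * r : R) • toR R (V.e α)) *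
    (V.x (P.reflectionPerm α α) (-(r⁻¹ : Rˣ) : R) : Matrix m m R) * (V.x α (r : R) : Matrix m m R))
  · congr 1
    rw [mul_assoc (V.x α (r : R) : Matrix m m R)]
    congr 1
    rw [← smul_mul_assoc, ← smul_mul_assoc, ← add_mul, ← sub_mul]
    congr 1
    match_scalars
    · linear_combination (-1 + (r : R) * ((r⁻¹ : Rˣ) : R)) * hr
    · linear_combination (-(r : R)) * hr
    · ring
  · rw [mul_smul_comm, x_mul_e]
    simp only [mul_assoc, smul_mul_assoc]

lemma ht_eq_neg_of_w_ne_zero (α : ι) (i j : m) (h : (V.w α (1 : ℤˣ) : Matrix m m ℤ) i j ≠ 0) :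
    V.ht α i = - V.ht α j := by
  have h1 := congrFun (congrFun (V.w_mul_cartan α (1 : ℤˣ)) i) j
  have h2 : toR ℤ (V.cartan α) = V.cartan α := by
    ext
    simp [toR]
  rw [h2] at h1
  simp only [cartan, Matrix.neg_apply, Matrix.mul_diagonal, Matrix.diagonal_mul] at h1
  have h3 : (V.w α (1 : ℤˣ) : Matrix m m ℤ) i j * (V.ht α i + V.ht α j) = 0 := by linarith
  rcases mul_eq_zero.mp h3 with h4 | h4
  · exact absurd h4 h
  · omega

/-- The element `w_α(1)`, with integral entries. -/
def wR (R : Type*) [CommRing R] (α : ι) : GL m R :=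
  Matrix.GeneralLinearGroup.map (Int.castRingHom R) (V.w α (1 : ℤˣ))

lemma wR_eq (α : ι) : V.wR R α = V.w α 1 := by
  simp [wR, w, map_mul, map_x]

/-- The value `α^∨(r)` of a coroot. -/
def coch (α : ι) (r : Rˣ) : GL m R := diag fun i => r ^ V.ht α i

lemma coch_mul (α : ι) (r s : Rˣ) : V.coch α (r * s) = V.coch α r * V.coch α s := by
  rw [coch, coch, coch, diag_mul]
  congr 1
  funext i
  simp [mul_zpow]

lemma w_eq (α : ι) (r : Rˣ) : V.w α r = V.coch α r * V.wR R α := by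
  -- This plays the role of α^∨(√r): a shift by `α` raises the height by 2, so conjugation by `diag
  -- d` rescales x_α by r. Rounding down is harmless: `w` joins heights h and -h, and ⌊h/2⌋ - ⌊-h/2⌋
  -- = h for both parities.
  let d : m → Rˣ := fun i => r ^ (V.ht α i / 2)
  have h1 : ∀ i j, V.wt i = V.wt j + P.root α → d i = r * d j := by
    intro i j h
    have := V.ht_of_wt_eq α α i j h
    rw [P.pairing_same] at this
    simp only [d]
    rw [this, Int.add_ediv_of_dvd_right (dvd_refl 2), Int.ediv_self (by norm_num), zpow_add,
      zpow_one, mul_comm]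
  have h2 : ∀ i j, V.wt i = V.wt j + P.root (P.reflectionPerm α α) → d i = r⁻¹ * d j := by
    intro i j h
    have := h1 j i (by rw [h]; simp)
    rw [this, inv_mul_cancel_left]
  have h3 : diag d * V.wR R α = V.w α r * diag d := by
    rw [wR_eq, w, w, ← mul_assoc, ← mul_assoc, V.diag_mul_x d α r h1, mul_assoc (V.x α _),
      V.diag_mul_x d _ r⁻¹ h2, mul_assoc, mul_assoc,
      V.diag_mul_x d α r h1]
    simp [mul_assoc]
  have h4 : diag d * V.wR R α = V.coch α r * V.wR R α * diag d := by
    apply Units.ext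
    ext i j
    simp only [Units.val_mul, diag_coe, coch, Matrix.mul_diagonal, Matrix.diagonal_mul]
    by_cases h : (V.w α (1 : ℤˣ) : Matrix m m ℤ) i j = 0
    · have : (V.wR R α : Matrix m m R) i j = 0 := by
        simp [wR, h]
      simp [this]
    · have h5 := V.ht_eq_neg_of_w_ne_zero α i j h
      have h6 : d i = r ^ V.ht α i * d j := by
        simp only [d]
        rw [← zpow_add]
        congr 1
        omega
      rw [h6]
      push_cast
      ring
  exact mul_right_cancel (h3.symm.trans h4)

end AdmissibleLattice
end SplitGroup

namespace SplitGroup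

/-! ### Elementary facts on root data -/

section RootDatum

variable {ι X Y : Type*} [Finite ι] [AddCommGroup X] [AddCommGroup Y] (P : RootDatum ι X Y)

include P in
lemma isAddTorsionFree : IsAddTorsionFree X :=
  have : Module.IsReflexive ℤ X := .of_isPerfPair P.toLinearMap
  .of_isTorsionFree ℤ X

lemma zsmul_root_injective (α : ι) : Function.Injective fun k : ℤ => k • P.root α :=
  have := isAddTorsionFree P
  smul_left_injective ℤ (P.ne_zero α)

lemma linearIndependent_of_ne [P.IsReduced] (α β : ι) (h₁ : β ≠ α)
    (h₂ : β ≠ P.reflectionPerm α α) : LinearIndependent ℤ ![P.root α, P.root β] := by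
  refine RootPairing.IsReduced.linearIndependent P h₁.symm fun h => h₂ ?_
  apply P.root.injective
  rw [AdmissibleLattice.root_neg_idx, h, neg_neg]

lemma reflectionPerm_comm_neg (α β : ι) : P.reflectionPerm α (P.reflectionPerm β β) =
    P.reflectionPerm (P.reflectionPerm α β) (P.reflectionPerm α β) := by
  apply P.root.injective
  rw [AdmissibleLattice.root_neg_idx, P.root_reflectionPerm, AdmissibleLattice.root_neg_idx, map_neg,
    P.root_reflectionPerm]

end RootDatum

namespace AdmissibleLattice

variable {ι X Y : Type*} [Finite ι] [AddCommGroup X] [AddCommGroup Y]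
  {P : RootDatum ι X Y} {m : Type*} [Fintype m] [DecidableEq m] (V : AdmissibleLattice P m)
  {R : Type*} [CommRing R]

/-! ### Root vectors indexed by the character lattice -/

open scoped Classical in
/-- The root vector of `x` if `x` is a root, and `0` otherwise. -/
def eX (x : X) : Matrix m m ℤ := if h : ∃ γ, P.root γ = x then V.e h.choose else 0

lemma eX_root (γ : ι) : V.eX (P.root γ) = V.e γ := by
  have h : ∃ γ', P.root γ' = P.root γ := ⟨γ, rfl⟩
  rw [eX, dif_pos h, P.root.injective h.choose_spec]

lemma eX_of_notMem (x : X) (h : x ∉ Set.range P.root) : V.eX x = 0 := dif_neg h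

lemma eX_wt (x : X) (i j : m) (h : V.eX x i j ≠ 0) : V.wt i = V.wt j + x := by
  by_cases hx : x ∈ Set.range P.root
  · obtain ⟨γ, rfl⟩ := hx
    rw [eX_root] at h
    exact V.wt_eq γ i j h
  · simp [V.eX_of_notMem x hx] at h

lemma eX_bracket (x y : X) (h : x + y ≠ 0) :
    ∃ N : ℤ, V.eX x * V.eX y - V.eX y * V.eX x = N • V.eX (x + y) := by
  by_cases hx : x ∈ Set.range P.root
  swap
  · exact ⟨0, by simp [V.eX_of_notMem x hx]⟩
  by_cases hy : y ∈ Set.range P.root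
  swap
  · exact ⟨0, by simp [V.eX_of_notMem y hy]⟩
  obtain ⟨α, rfl⟩ := hx
  obtain ⟨β, rfl⟩ := hy
  by_cases hxy : P.root α + P.root β ∈ Set.range P.root
  · obtain ⟨γ, hγ⟩ := hxy
    obtain ⟨ε, -, hε⟩ := V.bracket_add α β γ hγ.symm
    exact ⟨_, by rw [← hγ, eX_root, eX_root, eX_root]; exact hε⟩
  · exact ⟨0, by rw [eX_root, eX_root, V.bracket_zero α β hxy h]; simp⟩

/-- Otherwise the coroot of `β` would vanish on all weights, which generate X, although it takes the
value 2 on `β` itself. -/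
lemma e_ne_zero (β : ι) : V.e β ≠ 0 := by
  intro h
  have h1 := V.bracket_neg β
  rw [h, zero_mul, mul_zero, sub_zero] at h1
  have h2 : ∀ i, P.toLinearMap (V.wt i) (P.coroot β) = 0 := by
    intro i
    have := congrFun (congrFun h1 i) i
    simpa using this.symm
  have h3 : ∀ x ∈ AddSubgroup.closure (Set.range V.wt), P.toLinearMap x (P.coroot β) = 0 := by
    intro x hx
    induction hx using AddSubgroup.closure_induction with
    | mem x hx =>
      obtain ⟨i, rfl⟩ := hx
      exact h2 i
    | zero => simp
    | add x y _ _ hx hy => simp [hx, hy]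
    | neg x _ hx => simp [hx]
  have h4 := h3 (P.root β) (by rw [V.span_wt]; trivial)
  rw [P.root_coroot_two] at h4
  norm_num at h4

/-! ### Root strings -/

/-- The bottom coefficient grows by one at each step up the α-string, which gives the structure
constant. Past the top both sides vanish because `eX` is zero off the roots, so no bound on `k` is
needed. -/
lemma bracket_string_step (α β : ι) (h : LinearIndependent ℤ ![P.root α, P.root β]) (k : ℕ) :
    ∃ ε : ℤ, (ε = 1 ∨ ε = -1) ∧
      V.e α * V.eX (P.root β + k • P.root α) - V.eX (P.root β + k • P.root α) * V.e α =
        (ε * ((P.chainBotCoeff α β + k + 1 : ℕ) : ℤ)) • V.eX (P.root β + (k + 1) • P.root α) := by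
  by_cases h1 : k + 1 ≤ P.chainTopCoeff α β
  · obtain ⟨γ, hγ⟩ := (P.root_add_nsmul_mem_range_iff_le_chainTopCoeff h).mpr
      (show k ≤ P.chainTopCoeff α β by omega)
    obtain ⟨δ, hδ⟩ := (P.root_add_nsmul_mem_range_iff_le_chainTopCoeff h).mpr h1
    have h2 : P.root α + P.root γ = P.root δ := by
      rw [hγ, hδ, succ_nsmul]
      abel
    obtain ⟨ε, hε, hb⟩ := V.bracket_add α γ δ h2
    refine ⟨ε, hε, ?_⟩
    rw [← hγ, ← hδ, eX_root, eX_root, hb]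
    congr 2
    have h3 : ∀ k γ, P.root γ = P.root β + k • P.root α →
        P.chainBotCoeff α γ = P.chainBotCoeff α β + k := by
      intro k
      induction k with
      | zero =>
        intro γ hγ
        rw [P.root.injective (hγ.trans (by rw [zero_smul, add_zero] : _ = P.root β)), add_zero]
      | succ k ih =>
        intro γ hγ
        have hk : k + 1 ≤ P.chainTopCoeff α β :=
          (P.root_add_nsmul_mem_range_iff_le_chainTopCoeff h).mp ⟨γ, hγ⟩
        obtain ⟨γ', hγ'⟩ := (P.root_add_nsmul_mem_range_iff_le_chainTopCoeff h).mpr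
          (show k ≤ P.chainTopCoeff α β by omega)
        have h4 : LinearIndependent ℤ ![P.root α, P.root γ'] := by
          rw [hγ', LinearIndependent.pair_iff]
          intro s t hst
          have := LinearIndependent.pair_iff.mp h (s + t * k) t (by
            rw [← hst]
            module)
          obtain ⟨h5, rfl⟩ := this
          simpa using h5
        rw [RootPairing.chainBotCoeff_of_add h4 (by rw [hγ, hγ', succ_nsmul]; abel), ih γ' hγ']
        omega
    rw [h3 k γ hγ]
    push_cast
    ring
  · refine ⟨1, Or.inl rfl, ?_⟩
    have h2 : P.root β + (k + 1) • P.root α ∉ Set.range P.root := fun h' =>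
      h1 ((P.root_add_nsmul_mem_range_iff_le_chainTopCoeff h).mp h')
    have h3 : P.root α + (P.root β + k • P.root α) ≠ 0 := by
      intro h0
      have := LinearIndependent.pair_iff.mp h (k + 1) 1 (by rw [← h0]; module)
      omega
    obtain ⟨N, hN⟩ := V.eX_bracket (P.root α) (P.root β + k • P.root α) h3
    have h4 : P.root α + (P.root β + k • P.root α) = P.root β + (k + 1) • P.root α := by
      rw [succ_nsmul]
      abel
    rw [h4, V.eX_of_notMem _ h2, eX_root, smul_zero] at hN
    rw [hN, V.eX_of_notMem _ h2, smul_zero]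

/-- With r the bottom coefficient, iterating the bracket k times and dividing by k! gives
±(r+1)⋯(r+k)/k!, that is, ± a binomial coefficient. Hence the chain of divided powers is integral.
-/
lemma exists_string (α β : ι) (h : LinearIndependent ℤ ![P.root α, P.root β]) :
    ∃ M : ℕ → ℤ, M 0 = 1 ∧
      (M 1 = P.chainBotCoeff α β + 1 ∨ M 1 = - (P.chainBotCoeff α β + 1 : ℤ)) ∧
      ∀ k : ℕ, V.e α * (M k • V.eX (P.root β + k • P.root α)) -
        (M k • V.eX (P.root β + k • P.root α)) * V.e α =
        ((k + 1 : ℕ) : ℤ) • (M (k + 1) • V.eX (P.root β + (k + 1) • P.root α)) := by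
  choose ε hε hb using V.bracket_string_step α β h
  refine ⟨fun k => (∏ i ∈ Finset.range k, ε i) * (P.chainBotCoeff α β + k).choose k, by simp, ?_, ?_⟩
  · rcases hε 0 with h0 | h0
    · left
      simp [h0]
    · right
      simp [h0]
  · intro k
    rw [mul_smul_comm, smul_mul_assoc, ← smul_sub, hb, smul_smul, smul_smul]
    simp only [Finset.prod_range_succ]
    congr 1
    have h2 := Nat.add_one_mul_choose_eq (P.chainBotCoeff α β + k) k
    have h3 : ((P.chainBotCoeff α β + k + 1 : ℕ) : ℤ) * ((P.chainBotCoeff α β + k).choose k : ℤ) =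
      ((P.chainBotCoeff α β + (k + 1)).choose (k + 1) : ℤ) * ((k + 1 : ℕ) : ℤ) := by
      exact_mod_cast h2
    linear_combination (∏ i ∈ Finset.range k, ε i) * ε k * h3

lemma eX_string_eq_zero [P.IsReduced] (α β : ι) (h : LinearIndependent ℤ ![P.root α, P.root β])
    (k : ℕ) (hk : 4 ≤ k) : V.eX (P.root β + k • P.root α) = 0 := by
  apply V.eX_of_notMem
  rw [P.root_add_nsmul_mem_range_iff_le_chainTopCoeff h]
  have := P.chainBotCoeff_add_chainTopCoeff_le_three (i := α) (j := β)
  omega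

/-- The adjoint action of a root subgroup on a root vector. -/
lemma exists_x_mul_e [P.IsReduced] (α β : ι) (h : LinearIndependent ℤ ![P.root α, P.root β]) :
    ∃ M : ℕ → ℤ, M 0 = 1 ∧
      (M 1 = P.chainBotCoeff α β + 1 ∨ M 1 = - (P.chainBotCoeff α β + 1 : ℤ)) ∧
      (∀ k : ℕ, V.e α * (M k • V.eX (P.root β + k • P.root α)) -
        (M k • V.eX (P.root β + k • P.root α)) * V.e α =
        ((k + 1 : ℕ) : ℤ) • (M (k + 1) • V.eX (P.root β + (k + 1) • P.root α))) ∧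
      ∀ (R : Type _) [CommRing R] (t : R), (V.x α t : Matrix m m R) * toR R (V.e β) =
        (∑ k ∈ Finset.range 4, (t ^ k * M k) • toR R (V.eX (P.root β + k • P.root α))) *
        (V.x α t : Matrix m m R) := by
  obtain ⟨M, hM0, hM1, hM⟩ := V.exists_string α β h
  refine ⟨M, hM0, hM1, hM, fun R _ t => ?_⟩
  have := V.expMat_mul_of_chain α t (fun k => M k • V.eX (P.root β + k • P.root α)) hM 4
    (fun k hk => by rw [V.eX_string_eq_zero α β h k hk, smul_zero])
  simp only [hM0, zero_smul, add_zero, one_smul, eX_root, toR_smul, smul_smul] at this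
  exact this

/-! ### The action of the Weyl group -/

lemma x_wt (α : ι) (a : R) (i j : m) (h : (V.x α a : Matrix m m R) i j ≠ 0) :
    ∃ k : ℕ, V.wt i = V.wt j + k • P.root α := by
  rw [x_coe, expMat, Matrix.sum_apply] at h
  obtain ⟨n, -, hn⟩ := Finset.exists_ne_zero_of_sum_ne_zero h
  refine ⟨n, V.divPow_wt α n i j fun h0 => hn ?_⟩
  simp [h0]

/-- Each of the three factors of `w` shifts weights by a multiple of α, and the change of sign of
the height determines the total multiple. -/
lemma w_wt (α : ι) (i j : m) (h : (V.w α (1 : ℤˣ) : Matrix m m ℤ) i j ≠ 0) :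
    V.wt i = P.reflection α (V.wt j) := by
  have h0 := V.ht_eq_neg_of_w_ne_zero α i j h
  rw [w, Units.val_mul, Units.val_mul, Matrix.mul_apply] at h
  obtain ⟨k, -, hk⟩ := Finset.exists_ne_zero_of_sum_ne_zero h
  have h1 := left_ne_zero_of_mul hk
  rw [Matrix.mul_apply] at h1
  obtain ⟨l, -, hl⟩ := Finset.exists_ne_zero_of_sum_ne_zero h1
  obtain ⟨a, ha⟩ := V.x_wt _ _ _ _ (right_ne_zero_of_mul hk)
  obtain ⟨b, hb⟩ := V.x_wt _ _ _ _ (left_ne_zero_of_mul hl)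
  obtain ⟨c, hc⟩ := V.x_wt _ _ _ _ (right_ne_zero_of_mul hl)
  have h2 : V.wt i = V.wt j + ((a : ℤ) + b - c) • P.root α := by
    rw [hb, hc, ha, root_neg_idx]
    module
  have h3 : V.ht α i = V.ht α j + ((a : ℤ) + b - c) * 2 := by
    rw [ht, h2, map_add, LinearMap.add_apply, map_smul, LinearMap.smul_apply, P.root_coroot_two,
      smul_eq_mul]
    rfl
  have h4 : ((a : ℤ) + b - c) = - V.ht α j := by omega
  rw [h2, h4, P.reflection_apply, neg_smul, ← sub_eq_add_neg]
  rfl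

lemma w_wt' (α : ι) (r : ℤˣ) (i j : m) (h : (V.w α r : Matrix m m ℤ) i j ≠ 0) :
    V.wt i = P.reflection α (V.wt j) := by
  apply V.w_wt α
  intro h0
  apply h
  rw [w_eq, wR_eq, Units.val_mul, coch, diag_coe, Matrix.diagonal_mul, h0, mul_zero]

lemma w_inv (α : ι) (r : Rˣ) : (V.w α r)⁻¹ = V.w α (-r) := by
  rw [w, w, mul_inv_rev, mul_inv_rev, ← x_neg, ← x_neg, ← mul_assoc]
  simp

/-- The span of the root vectors of a root string. -/
def stringSpan (α β : ι) : AddSubgroup (Matrix m m ℤ) :=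
  AddSubgroup.closure {M | ∃ k : ℤ, M = V.eX (P.root β + k • P.root α)}

lemma toR_int (M : Matrix m m ℤ) : toR ℤ M = M := by
  ext
  simp [toR]

lemma x_conj_stringSpan [P.IsReduced] (α β : ι) (h : LinearIndependent ℤ ![P.root α, P.root β])
    (δ : ι) (hδ : P.root δ = P.root α ∨ P.root δ = - P.root α) (t : ℤ) (M : Matrix m m ℤ)
    (hM : M ∈ V.stringSpan α β) :
    (V.x δ t : Matrix m m ℤ) * M * ((V.x δ t)⁻¹ : GL m ℤ) ∈ V.stringSpan α β := by
  rw [stringSpan] at hM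
  induction hM using AddSubgroup.closure_induction with
  | mem M hM =>
    obtain ⟨k, rfl⟩ := hM
    by_cases hk : P.root β + k • P.root α ∈ Set.range P.root
    · obtain ⟨γ, hγ⟩ := hk
      have h1 : LinearIndependent ℤ ![P.root δ, P.root γ] := by
        rw [hγ, LinearIndependent.pair_iff]
        intro s u hsu
        rcases hδ with hδ | hδ <;> rw [hδ] at hsu
        · have := LinearIndependent.pair_iff.mp h (s + u * k) u (by rw [← hsu]; module)
          obtain ⟨h5, rfl⟩ := this
          simpa using h5
        · have := LinearIndependent.pair_iff.mp h (-s + u * k) u (by rw [← hsu]; module)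
          obtain ⟨h5, rfl⟩ := this
          simpa using h5
      obtain ⟨M, -, -, -, h2⟩ := V.exists_x_mul_e δ γ h1
      have h3 := h2 ℤ t
      rw [← hγ, eX_root, ← toR_int (V.e γ), h3, mul_assoc, ← Units.val_mul, mul_inv_cancel,
        Units.val_one, mul_one]
      refine sum_mem fun l _ => ?_
      rw [toR_int]
      refine AddSubgroup.zsmul_mem _ ?_ _
      apply AddSubgroup.subset_closure
      rw [hγ]
      rcases hδ with hδ | hδ
      · exact ⟨k + l, by rw [hδ]; congr 1; module⟩
      · exact ⟨k - l, by rw [hδ]; congr 1; module⟩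
    · rw [V.eX_of_notMem _ hk]
      simp
  | zero => simp
  | add M N _ _ hM hN =>
    rw [mul_add, add_mul]
    exact add_mem hM hN
  | neg M _ hM =>
    rw [mul_neg, neg_mul]
    exact neg_mem hM

open scoped Classical in
/-- The part of a matrix that shifts the weight by `x`. -/
def wtPart (x : X) : Matrix m m ℤ →+ Matrix m m ℤ where
  toFun M := Matrix.of fun i j => if V.wt i = V.wt j + x then M i j else 0
  map_zero' := by
    ext
    simp
  map_add' M N := by
    ext i j
    simp only [Matrix.add_apply, Matrix.of_apply]
    split_ifs <;> simp

open scoped Classical in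
lemma wtPart_apply (x : X) (M : Matrix m m ℤ) (i j : m) :
    V.wtPart x M i j = if V.wt i = V.wt j + x then M i j else 0 := rfl

lemma wtPart_eq_self (x : X) (M : Matrix m m ℤ) (h : ∀ i j, M i j ≠ 0 → V.wt i = V.wt j + x) :
    V.wtPart x M = M := by
  ext i j
  have := h i j
  rw [wtPart_apply]
  split_ifs <;> tauto

lemma wtPart_eq_zero (x y : X) (hxy : x ≠ y) (M : Matrix m m ℤ)
    (h : ∀ i j, M i j ≠ 0 → V.wt i = V.wt j + y) : V.wtPart x M = 0 := by
  ext i j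
  rw [wtPart_apply, Matrix.zero_apply]
  split_ifs with h1
  · by_contra h2
    exact hxy (add_left_cancel (h1.symm.trans (h i j h2)))
  · rfl

lemma exists_wtPart_stringSpan (α β : ι) (x : X) (M : Matrix m m ℤ) (hM : M ∈ V.stringSpan α β) :
    ∃ c : ℤ, V.wtPart x M = c • V.eX x := by
  rw [stringSpan] at hM
  induction hM using AddSubgroup.closure_induction with
  | mem M hM =>
    obtain ⟨k, rfl⟩ := hM
    by_cases hk : x = P.root β + k • P.root α
    · exact ⟨1, by rw [← hk, one_smul]; exact V.wtPart_eq_self x _ (V.eX_wt x)⟩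
    · exact ⟨0, by rw [zero_smul]; exact V.wtPart_eq_zero x _ hk _ (V.eX_wt _)⟩
  | zero => exact ⟨0, by simp⟩
  | add M N _ _ hM hN =>
    obtain ⟨c, hc⟩ := hM
    obtain ⟨d, hd⟩ := hN
    exact ⟨c + d, by rw [map_add, hc, hd, add_smul]⟩
  | neg M _ hM =>
    obtain ⟨c, hc⟩ := hM
    exact ⟨-c, by rw [map_neg, hc, neg_smul]⟩

/-- The conjugate stays in the span of the α-string through β and shifts all weights by s_α β; only
the multiples of one root vector in that span do so. -/
lemma w_conj_e_of_linearIndependent [P.IsReduced] (α β : ι)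
    (h : LinearIndependent ℤ ![P.root α, P.root β]) (r : ℤˣ) :
    ∃ c : ℤ, (V.w α r : Matrix m m ℤ) * V.e β =
      c • (V.e (P.reflectionPerm α β) * (V.w α r : Matrix m m ℤ)) := by
  set g := V.w α r with hg
  set M := (g : Matrix m m ℤ) * V.e β * ((g⁻¹ : GL m ℤ) : Matrix m m ℤ) with hM
  have h1 : M ∈ V.stringSpan α β := by
    have h0 : V.e β ∈ V.stringSpan α β := AddSubgroup.subset_closure ⟨0, by simp [eX_root]⟩
    have := V.x_conj_stringSpan α β h α (Or.inl rfl) r _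
      (V.x_conj_stringSpan α β h (P.reflectionPerm α α) (Or.inr (root_neg_idx α)) (-(r⁻¹ : ℤˣ)) _
      (V.x_conj_stringSpan α β h α (Or.inl rfl) r _ h0))
    rw [hM, hg, w, mul_inv_rev, mul_inv_rev]
    simpa only [Units.val_mul, mul_assoc] using this
  have h2 : ∀ i j, M i j ≠ 0 → V.wt i = V.wt j + P.root (P.reflectionPerm α β) := by
    intro i j hij
    rw [hM, Matrix.mul_apply] at hij
    obtain ⟨k, -, hk⟩ := Finset.exists_ne_zero_of_sum_ne_zero hij
    have h3 := left_ne_zero_of_mul hk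
    rw [Matrix.mul_apply] at h3
    obtain ⟨l, -, hl⟩ := Finset.exists_ne_zero_of_sum_ne_zero h3
    have h4 := right_ne_zero_of_mul hk
    rw [hg, w_inv] at h4
    have h5 := V.w_wt' α _ _ _ h4
    have h6 := V.w_wt' α _ _ _ (left_ne_zero_of_mul hl)
    have h7 := V.wt_eq β _ _ (right_ne_zero_of_mul hl)
    rw [h6, h7, h5, map_add, P.reflection_same, P.root_reflectionPerm]
  obtain ⟨c, hc⟩ := V.exists_wtPart_stringSpan α β (P.root (P.reflectionPerm α β)) M h1
  rw [V.wtPart_eq_self _ M h2, eX_root] at hc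
  refine ⟨c, ?_⟩
  rw [← smul_mul_assoc, ← hc, hM, mul_assoc, ← Units.val_mul, inv_mul_cancel, Units.val_one, mul_one]

/-- Conjugating by `w` and then by its inverse `w α (-1)` multiplies the nonzero matrix `e β` by an
integer c d. So c d = 1, and c is a sign. -/
lemma w_conj_e [P.IsReduced] (α β : ι) : ∃ ε : ℤ, (ε = 1 ∨ ε = -1) ∧
    (V.w α (1 : ℤˣ) : Matrix m m ℤ) * V.e β =
      ε • (V.e (P.reflectionPerm α β) * (V.w α (1 : ℤˣ) : Matrix m m ℤ)) := by
  by_cases h₁ : β = α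
  · subst h₁
    refine ⟨-1, Or.inr rfl, ?_⟩
    have := V.w_mul_e β (1 : ℤˣ)
    rw [toR_int, toR_int] at this
    simpa using this
  by_cases h₂ : β = P.reflectionPerm α α
  · refine ⟨-1, Or.inr rfl, ?_⟩
    have := V.w_mul_neg α (1 : ℤˣ)
    rw [toR_int, toR_int, ← h₂] at this
    rw [this, h₂, P.reflectionPerm_self]
    simp
  have h := linearIndependent_of_ne P α β h₁ h₂
  have h' : LinearIndependent ℤ ![P.root α, P.root (P.reflectionPerm α β)] := by
    refine linearIndependent_of_ne P α _ ?_ ?_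
    · intro h0
      apply h₂
      have := P.reflectionPerm_self α β
      rw [h0] at this
      exact this.symm
    · intro h0
      exact h₁ ((P.reflectionPerm α).injective h0)
  obtain ⟨c, hc⟩ := V.w_conj_e_of_linearIndependent α β h 1
  obtain ⟨d, hd⟩ := V.w_conj_e_of_linearIndependent α _ h' (-1)
  refine ⟨c, ?_, hc⟩
  have h3 : (V.w α (-1 : ℤˣ) : Matrix m m ℤ) * (V.w α (1 : ℤˣ) : Matrix m m ℤ) = 1 := by
    rw [← Units.val_mul, ← w_inv, inv_mul_cancel, Units.val_one]
  have h4 : V.e β = (c * d) • V.e β := by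
    calc V.e β = (V.w α (-1 : ℤˣ) : Matrix m m ℤ) * ((V.w α (1 : ℤˣ) : Matrix m m ℤ) * V.e β) := by
          rw [← mul_assoc, h3, one_mul]
      _ = c • ((V.w α (-1 : ℤˣ) : Matrix m m ℤ) * V.e (P.reflectionPerm α β) *
            (V.w α (1 : ℤˣ) : Matrix m m ℤ)) := by
          rw [hc, mul_smul_comm, mul_assoc]
      _ = (c * d) • V.e β := by
          rw [hd, P.reflectionPerm_self, smul_mul_assoc, mul_assoc, h3, mul_one, smul_smul]
  have h5 : (c * d - 1) • V.e β = 0 := by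
    rw [sub_smul, ← h4, one_smul, sub_self]
  have h6 : c * d = 1 := by
    rcases smul_eq_zero.mp h5 with h6 | h6
    · omega
    · exact absurd h6 (V.e_ne_zero β)
  exact Int.eq_one_or_neg_one_of_mul_eq_one h6

end AdmissibleLattice
end SplitGroup

namespace SplitGroup

section RootDatum

variable {ι X Y : Type*} [Finite ι] [AddCommGroup X] [AddCommGroup Y] (P : RootDatum ι X Y)

/-! ### Rank two -/

/-- The linear combination `i α + j β` of two roots. -/
def comb (α β : ι) (i j : ℤ) : X := i • P.root α + j • P.root β

lemma comb_add (α β : ι) (i j i' j' : ℤ) :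
    comb P α β i j + comb P α β i' j' = comb P α β (i + i') (j + j') := by
  simp only [comb]
  module

lemma comb_swap (α β : ι) (i j : ℤ) : comb P α β i j = comb P β α j i := add_comm _ _

lemma comb_ne_zero (α β : ι) (h : LinearIndependent ℤ ![P.root α, P.root β]) (i j : ℤ)
    (hij : i ≠ 0 ∨ j ≠ 0) : comb P α β i j ≠ 0 := by
  intro h0
  have := LinearIndependent.pair_iff.mp h i j h0
  omega

lemma comb_reflection_left (α β : ι) (i j : ℤ) :
    P.reflection α (comb P α β i j) = comb P α β (-i - j * P.pairing β α) j := by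
  simp only [comb, map_add, map_smul, P.reflection_apply_self, P.reflection_apply_root]
  module

lemma comb_reflection_right (α β : ι) (i j : ℤ) :
    P.reflection β (comb P α β i j) = comb P α β i (-j - i * P.pairing α β) := by
  rw [comb_swap, comb_reflection_left, comb_swap]

lemma reflection_mem_range_iff (α : ι) (x : X) :
    P.reflection α x ∈ Set.range P.root ↔ x ∈ Set.range P.root := by
  constructor
  · rintro ⟨γ, hγ⟩
    exact ⟨P.reflectionPerm α γ, by rw [P.root_reflectionPerm, hγ, P.reflection_same]⟩
  · rintro ⟨γ, rfl⟩
    exact ⟨P.reflectionPerm α γ, P.root_reflectionPerm α γ⟩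

lemma pairing_comb_left (α β γ : ι) (i j : ℤ) (h : P.root γ = comb P α β i j) :
    P.pairing γ α = 2 * i + j * P.pairing β α := by
  rw [← P.root_coroot_eq_pairing, h, comb, map_add, LinearMap.add_apply, map_smul, map_smul,
    LinearMap.smul_apply, LinearMap.smul_apply, P.root_coroot_two, P.root_coroot_eq_pairing]
  simp only [smul_eq_mul]
  ring

lemma pairing_abs_le_three [P.IsReduced] (α γ : ι) : -3 ≤ P.pairing γ α ∧ P.pairing γ α ≤ 3 := by
  have h := P.pairingIn_pairingIn_mem_set_of_isCrystal_of_isRed γ α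
  have h2 : P.pairingIn ℤ γ α = P.pairing γ α := P.algebraMap_pairingIn ℤ γ α
  simp only [Set.mem_insert_iff, Set.mem_singleton_iff, Prod.mk.injEq, h2] at h
  omega

/-- The constraints on the roots in the span of two linearly independent roots that are used to
determine the commutators of root subgroups. -/
lemma rankTwo_facts [P.IsReduced] (α β : ι) (h : LinearIndependent ℤ ![P.root α, P.root β]) :
    (∀ k : ℤ, comb P α β k 1 ∈ Set.range P.root ↔
      -(P.chainBotCoeff α β : ℤ) ≤ k ∧ k ≤ P.chainTopCoeff α β) ∧
    ((P.chainBotCoeff α β : ℤ) - P.chainTopCoeff α β = P.pairing β α) ∧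
    (P.chainBotCoeff α β + P.chainTopCoeff α β ≤ 3) ∧
    (∀ i j : ℤ, comb P α β i j ∈ Set.range P.root → comb P α β (-i - j * P.pairing β α) j ∈
      Set.range P.root) ∧
    (∀ i j : ℤ, comb P α β i j ∈ Set.range P.root → -3 ≤ 2 * i + j * P.pairing β α ∧
      2 * i + j * P.pairing β α ≤ 3) ∧
    (∀ i j : ℤ, comb P α β i j ∈ Set.range P.root → comb P α β (-i) (-j) ∈ Set.range P.root) := by
  refine ⟨fun k => ?_, ?_, P.chainBotCoeff_add_chainTopCoeff_le_three, fun i j hij => ?_,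
    fun i j hij => ?_, fun i j hij => ?_⟩
  · have := P.root_add_zsmul_mem_range_iff h (z := k)
    rw [Set.mem_Icc] at this
    rw [← this, comb, one_smul, add_comm]
  · have h2 : P.pairingIn ℤ β α = P.pairing β α := P.algebraMap_pairingIn ℤ β α
    rw [← h2]
    exact P.chainBotCoeff_sub_chainTopCoeff h
  · rw [← comb_reflection_left, reflection_mem_range_iff]
    exact hij
  · obtain ⟨γ, hγ⟩ := hij
    rw [← pairing_comb_left P α β γ i j hγ]
    exact pairing_abs_le_three P α γ
  · obtain ⟨γ, hγ⟩ := hij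
    refine ⟨P.reflectionPerm γ γ, ?_⟩
    rw [AdmissibleLattice.root_neg_idx, hγ, comb, comb]
    module

lemma nsmul_comb_notMem [P.IsReduced] (α β : ι) (k i j : ℤ) (hk : 2 ≤ k)
    (h : comb P α β i j ∈ Set.range P.root) : comb P α β (k * i) (k * j) ∉ Set.range P.root := by
  obtain ⟨γ, hγ⟩ := h
  have := isAddTorsionFree P
  rintro ⟨δ, hδ⟩
  have h1 : P.root δ = k • P.root γ := by
    rw [hδ, hγ, comb, comb]
    module
  have h2 : ¬ LinearIndependent ℤ ![P.root δ, P.root γ] := by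
    rw [LinearIndependent.pair_iff]
    intro h
    have := h 1 (-k) (by rw [h1]; module)
    omega
  have h3 : P.pairing δ γ = k * 2 := by
    rw [← P.root_coroot_eq_pairing, h1, map_smul, LinearMap.smul_apply, P.root_coroot_two,
      smul_eq_mul]
  have := pairing_abs_le_three P γ δ
  omega

lemma pairing_pair_mem [P.IsReduced] (α β : ι) (h : LinearIndependent ℤ ![P.root α, P.root β]) :
    (P.pairing α β = 0 ∧ P.pairing β α = 0) ∨
    (P.pairing α β = 1 ∧ 1 ≤ P.pairing β α) ∨
    (P.pairing β α = 1 ∧ 1 ≤ P.pairing α β) ∨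
    (P.pairing α β = -1 ∧ P.pairing β α ≤ -1) ∨
    (P.pairing β α = -1 ∧ P.pairing α β ≤ -1) := by
  have h1 : P.root α ≠ P.root β := fun h1 => by
    have := LinearIndependent.pair_iff.mp h 1 (-1) (by rw [h1]; module)
    omega
  have h2 : P.root α ≠ - P.root β := fun h1 => by
    have := LinearIndependent.pair_iff.mp h 1 1 (by rw [h1]; module)
    omega
  have h3 := P.pairingIn_pairingIn_mem_set_of_isCrystal_of_isRed' α β h1 h2
  have h4 : P.pairingIn ℤ α β = P.pairing α β := P.algebraMap_pairingIn ℤ α β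
  have h5 : P.pairingIn ℤ β α = P.pairing β α := P.algebraMap_pairingIn ℤ β α
  simp only [Set.mem_insert_iff, Set.mem_singleton_iff, Prod.mk.injEq, h4, h5] at h3
  omega

end RootDatum

namespace AdmissibleLattice

variable {ι X Y : Type*} [Finite ι] [AddCommGroup X] [AddCommGroup Y]
  {P : RootDatum ι X Y} {m : Type*} [Fintype m] [DecidableEq m] (V : AdmissibleLattice P m)
  {R : Type*} [CommRing R]

/-! ### One-parameter families -/

open Polynomial

variable {S : Type*} [CommRing S]

/-- The entrywise derivative of a matrix of polynomials. -/
def der (M : Matrix m m S[X]) : Matrix m m S[X] := M.map derivative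

lemma der_mul (M N : Matrix m m S[X]) : der (M * N) = der M * N + M * der N := by
  ext1 i j
  simp only [der, Matrix.map_apply, Matrix.mul_apply, Matrix.add_apply, derivative_sum,
    derivative_mul, Finset.sum_add_distrib]

lemma der_x (γ : ι) (p : S[X]) : der (V.x γ p : Matrix m m S[X]) =
    derivative p • (toR S[X] (V.e γ) * (V.x γ p : Matrix m m S[X])) := by
  have h0 : ∀ (n : ℕ) (M : Matrix m m ℤ), der (p ^ n • toR S[X] M) =
      derivative (p ^ n) • toR S[X] M := by
    intro n M
    ext1 i j
    simp [der]
  have hsum : ∀ (s : Finset ℕ) (f : ℕ → Matrix m m S[X]), der (∑ n ∈ s, f n) = ∑ n ∈ s, der (f n) := by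
    intro s f
    ext1 i j
    simp [der, Matrix.sum_apply]
  rw [x_coe, V.expMat_eq_sum γ p (Fintype.card m + 1) (by omega), hsum, Finset.sum_range_succ']
  rw [← V.expMat_eq_sum γ p (Fintype.card m + 1) (by omega), expMat, Finset.mul_sum, Finset.smul_sum]
  simp only [h0]
  rw [pow_zero, derivative_one, zero_smul, add_zero]
  refine Finset.sum_congr rfl fun n _ => ?_
  rw [mul_smul_comm, ← toR_mul, e_mul_divPow, toR_smul, smul_smul, smul_smul, derivative_pow]
  congr 1
  simp only [Nat.add_sub_cancel, map_natCast]
  push_cast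
  ring

/-- Uniqueness for a linear differential equation: f⁻¹ g has derivative zero, hence is constant
because `S` has no torsion, and its value at 0 is 1. -/
lemma eq_of_der_eq [IsAddTorsionFree S] (f g : GL m S[X]) (W : Matrix m m S[X])
    (hf : der (f : Matrix m m S[X]) = W * (f : Matrix m m S[X]))
    (hg : der (g : Matrix m m S[X]) = W * (g : Matrix m m S[X]))
    (h0 : Matrix.GeneralLinearGroup.map (evalRingHom (0 : S)) f =
      Matrix.GeneralLinearGroup.map (evalRingHom (0 : S)) g) : f = g := by
  set h := f⁻¹ * g with hh
  have h1 : g = f * h := by rw [hh, mul_inv_cancel_left]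
  have h2 : der (h : Matrix m m S[X]) = 0 := by
    have h3 := hg
    rw [h1, Units.val_mul, der_mul, hf, mul_assoc, add_eq_left] at h3
    calc der (h : Matrix m m S[X]) =
        ((f⁻¹ * f : GL m S[X]) : Matrix m m S[X]) * der (h : Matrix m m S[X]) := by simp
      _ = 0 := by rw [Units.val_mul, mul_assoc, h3, mul_zero]
  have h3 : Matrix.GeneralLinearGroup.map (evalRingHom (0 : S)) h = 1 := by
    rw [hh, map_mul, map_inv, h0, inv_mul_cancel]
  have h4 : h = 1 := by
    apply Units.ext
    ext1 i j
    have h5 : derivative ((h : Matrix m m S[X]) i j) = 0 := congrFun (congrFun h2 i) j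
    have h6 : eval 0 ((h : Matrix m m S[X]) i j) = (1 : Matrix m m S) i j :=
      by
      have := congrArg (fun g : GL m S => (g : Matrix m m S) i j) h3
      exact this
    have h7 := eq_C_of_natDegree_eq_zero (derivative_eq_zero.mp h5)
    rw [h7, eval_C] at h6
    rw [h7, h6, Units.val_one, Matrix.one_apply, Matrix.one_apply]
    split_ifs <;> simp
  rw [h1, h4, mul_one]

open scoped Classical in
/-- The element `x_γ(a)` if `x = γ` is a root, and `1` otherwise. -/
def xX (x : X) (a : R) : GL m R := if h : ∃ γ, P.root γ = x then V.x h.choose a else 1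

lemma xX_root (γ : ι) (a : R) : V.xX (P.root γ) a = V.x γ a := by
  have h : ∃ γ', P.root γ' = P.root γ := ⟨γ, rfl⟩
  rw [xX, dif_pos h, P.root.injective h.choose_spec]

lemma xX_of_notMem (x : X) (h : x ∉ Set.range P.root) (a : R) : V.xX x a = 1 := dif_neg h

lemma map_xX {S : Type*} [CommRing S] (f : R →+* S) (x : X) (a : R) :
    Matrix.GeneralLinearGroup.map f (V.xX x a) = V.xX x (f a) := by
  by_cases h : x ∈ Set.range P.root
  · obtain ⟨γ, rfl⟩ := h
    rw [xX_root, xX_root, map_x]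
  · rw [V.xX_of_notMem x h, V.xX_of_notMem x h, map_one]

lemma xX_zero (x : X) : V.xX x (0 : R) = 1 := by
  by_cases h : x ∈ Set.range P.root
  · obtain ⟨γ, rfl⟩ := h
    rw [xX_root, x_zero]
  · rw [V.xX_of_notMem x h]

lemma der_xX (x : X) (p : S[X]) : der (V.xX x p : Matrix m m S[X]) =
    derivative p • (toR S[X] (V.eX x) * (V.xX x p : Matrix m m S[X])) := by
  by_cases h : x ∈ Set.range P.root
  · obtain ⟨γ, rfl⟩ := h
    rw [xX_root, eX_root, der_x]
  · rw [V.xX_of_notMem x h, V.eX_of_notMem x h, toR_zero, zero_mul, smul_zero]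
    ext1 i j
    simp only [der, Units.val_one, Matrix.map_apply, Matrix.one_apply]
    split_ifs <;> simp

lemma xX_mul (x : X) (t : R) (M N : Matrix m m ℤ) (h : V.eX x * M - M * V.eX x = N)
    (h' : V.eX x * N = N * V.eX x) : (V.xX x t : Matrix m m R) * toR R M =
      (toR R M + t • toR R N) * (V.xX x t : Matrix m m R) := by
  by_cases hx : x ∈ Set.range P.root
  · obtain ⟨γ, rfl⟩ := hx
    rw [eX_root] at h h'
    rw [xX_root, V.x_mul_of_chain γ t M N 0 0 h (by simp [h']) (by simp) (by simp)]
    simp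
  · rw [V.eX_of_notMem x hx] at h
    rw [V.xX_of_notMem x hx, ← h]
    simp

lemma xX_mul_of_comm (x : X) (t : R) (M : Matrix m m ℤ) (h : V.eX x * M = M * V.eX x) :
    (V.xX x t : Matrix m m R) * toR R M = toR R M * (V.xX x t : Matrix m m R) := by
  rw [V.xX_mul x t M 0 (by rw [h, sub_self]) (by simp)]
  simp

/-- The logarithmic derivative of a product in a two-step nilpotent group. -/
lemma der_prod (y₀ y₁ y₂ y₃ δ : X) (N₀₁ N₀₃ N₁₂ : ℤ) (c₀ c₁ c₂ c₃ d : S)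
    (h₀₁ : V.eX y₀ * V.eX y₁ - V.eX y₁ * V.eX y₀ = N₀₁ • V.eX δ)
    (h₀₂ : V.eX y₀ * V.eX y₂ = V.eX y₂ * V.eX y₀)
    (h₀₃ : V.eX y₀ * V.eX y₃ - V.eX y₃ * V.eX y₀ = N₀₃ • V.eX δ)
    (h₁₂ : V.eX y₁ * V.eX y₂ - V.eX y₂ * V.eX y₁ = N₁₂ • V.eX δ)
    (h₁₃ : V.eX y₁ * V.eX y₃ = V.eX y₃ * V.eX y₁)
    (h₂₃ : V.eX y₂ * V.eX y₃ = V.eX y₃ * V.eX y₂)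
    (h₀ : V.eX y₀ * V.eX δ = V.eX δ * V.eX y₀) (h₁ : V.eX y₁ * V.eX δ = V.eX δ * V.eX y₁)
    (h₂ : V.eX y₂ * V.eX δ = V.eX δ * V.eX y₂) (h₃ : V.eX y₃ * V.eX δ = V.eX δ * V.eX y₃)
    (hd : 2 * d + c₀ * c₁ * N₀₁ + c₀ * c₃ * N₀₃ + c₁ * c₂ * N₁₂ = 0) :
    der ((V.xX y₀ (C c₀ * Polynomial.X) * V.xX y₁ (C c₁ * Polynomial.X) * V.xX y₂ (C c₂ * Polynomial.X) * V.xX y₃ (C c₃ * Polynomial.X) *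
        V.xX δ (C d * Polynomial.X ^ 2) : GL m S[X]) : Matrix m m S[X]) =
      (C c₀ • toR S[X] (V.eX y₀) + C c₁ • toR S[X] (V.eX y₁) + C c₂ • toR S[X] (V.eX y₂) +
        C c₃ • toR S[X] (V.eX y₃)) *
      ((V.xX y₀ (C c₀ * Polynomial.X) * V.xX y₁ (C c₁ * Polynomial.X) * V.xX y₂ (C c₂ * Polynomial.X) * V.xX y₃ (C c₃ * Polynomial.X) *
        V.xX δ (C d * Polynomial.X ^ 2) : GL m S[X]) : Matrix m m S[X]) := by
  have hz : ∀ (N : ℤ) (M E : Matrix m m ℤ), M * E = E * M → M * (N • E) = (N • E) * M := by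
    intro N M E h
    rw [mul_smul_comm, smul_mul_assoc, h]
  have k₀₁ := V.xX_mul y₀ (C c₀ * Polynomial.X : S[X]) _ _ h₀₁ (hz _ _ _ h₀)
  have k₀₂ := V.xX_mul_of_comm y₀ (C c₀ * Polynomial.X : S[X]) _ h₀₂
  have k₀₃ := V.xX_mul y₀ (C c₀ * Polynomial.X : S[X]) _ _ h₀₃ (hz _ _ _ h₀)
  have k₁₂ := V.xX_mul y₁ (C c₁ * Polynomial.X : S[X]) _ _ h₁₂ (hz _ _ _ h₁)
  have k₁₃ := V.xX_mul_of_comm y₁ (C c₁ * Polynomial.X : S[X]) _ h₁₃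
  have k₂₃ := V.xX_mul_of_comm y₂ (C c₂ * Polynomial.X : S[X]) _ h₂₃
  have l₀ := V.xX_mul_of_comm y₀ (C c₀ * Polynomial.X : S[X]) _ h₀
  have l₁ := V.xX_mul_of_comm y₁ (C c₁ * Polynomial.X : S[X]) _ h₁
  have l₂ := V.xX_mul_of_comm y₂ (C c₂ * Polynomial.X : S[X]) _ h₂
  have l₃ := V.xX_mul_of_comm y₃ (C c₃ * Polynomial.X : S[X]) _ h₃
  have e₀ := V.der_xX y₀ (C c₀ * Polynomial.X : S[X])
  have e₁ := V.der_xX y₁ (C c₁ * Polynomial.X : S[X])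
  have e₂ := V.der_xX y₂ (C c₂ * Polynomial.X : S[X])
  have e₃ := V.der_xX y₃ (C c₃ * Polynomial.X : S[X])
  have eδ := V.der_xX δ (C d * Polynomial.X ^ 2 : S[X])
  have p : ∀ c : S, derivative (C c * Polynomial.X) = C c := by
    intro c
    simp
  have pδ : derivative (C d * Polynomial.X ^ 2) = 2 * C d * Polynomial.X := by
    rw [derivative_C_mul_X_sq]
    simp only [map_mul, map_ofNat]
    ring
  rw [p] at e₀ e₁ e₂ e₃
  rw [pδ] at eδ
  rw [toR_smul] at k₀₁ k₀₃ k₁₂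
  simp only [Units.val_mul]
  generalize (V.xX y₀ (C c₀ * Polynomial.X : S[X]) : Matrix m m S[X]) = x₀ at *
  generalize (V.xX y₁ (C c₁ * Polynomial.X : S[X]) : Matrix m m S[X]) = x₁ at *
  generalize (V.xX y₂ (C c₂ * Polynomial.X : S[X]) : Matrix m m S[X]) = x₂ at *
  generalize (V.xX y₃ (C c₃ * Polynomial.X : S[X]) : Matrix m m S[X]) = x₃ at *
  generalize (V.xX δ (C d * Polynomial.X ^ 2 : S[X]) : Matrix m m S[X]) = xδ at *
  generalize toR S[X] (V.eX y₀) = E₀ at *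
  generalize toR S[X] (V.eX y₁) = E₁ at *
  generalize toR S[X] (V.eX y₂) = E₂ at *
  generalize toR S[X] (V.eX y₃) = E₃ at *
  generalize toR S[X] (V.eX δ) = Eδ at *
  have hd' : 2 * C d + C c₀ * C c₁ * (N₀₁ : S[X]) + C c₀ * C c₃ * (N₀₃ : S[X]) +
      C c₁ * C c₂ * (N₁₂ : S[X]) = 0 := by
    have := congrArg (C : S → S[X]) hd
    have h2 : (C (2 : S) : S[X]) = 2 := map_ofNat C 2
    simpa [h2] using this
  simp only [der_mul, e₀, e₁, e₂, e₃, eδ]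
  have t₁ : x₀ * (E₁ * x₁) = (E₁ + (C c₀ * Polynomial.X * (N₀₁ : S[X])) • Eδ) * (x₀ * x₁) := by
    rw [← mul_assoc, k₀₁, smul_smul, mul_assoc]
  have t₂ : x₀ * x₁ * (E₂ * x₂) = (E₂ + (C c₁ * Polynomial.X * (N₁₂ : S[X])) • Eδ) * (x₀ * x₁ * x₂) := by
    have : x₀ * x₁ * E₂ = (E₂ + (C c₁ * Polynomial.X * (N₁₂ : S[X])) • Eδ) * (x₀ * x₁) := by
      rw [mul_assoc, k₁₂, ← mul_assoc, mul_add, mul_smul_comm, mul_smul_comm, k₀₂, l₀, smul_smul]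
      simp only [add_mul, smul_mul_assoc, mul_assoc]
    rw [← mul_assoc, this, mul_assoc]
  have t₃ : x₀ * x₁ * x₂ * (E₃ * x₃) =
      (E₃ + (C c₀ * Polynomial.X * (N₀₃ : S[X])) • Eδ) * (x₀ * x₁ * x₂ * x₃) := by
    have : x₀ * x₁ * x₂ * E₃ = (E₃ + (C c₀ * Polynomial.X * (N₀₃ : S[X])) • Eδ) * (x₀ * x₁ * x₂) := by
      rw [mul_assoc, k₂₃, ← mul_assoc, mul_assoc x₀, k₁₃, ← mul_assoc x₀, k₀₃, smul_smul]
      simp only [mul_assoc]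
    rw [← mul_assoc, this, mul_assoc]
  have t₄ : x₀ * x₁ * x₂ * x₃ * (Eδ * xδ) = Eδ * (x₀ * x₁ * x₂ * x₃ * xδ) := by
    have : x₀ * x₁ * x₂ * x₃ * Eδ = Eδ * (x₀ * x₁ * x₂ * x₃) := by
      rw [mul_assoc, l₃, ← mul_assoc, mul_assoc (x₀ * x₁), l₂, ← mul_assoc, mul_assoc x₀, l₁,
        ← mul_assoc, l₀]
      simp only [mul_assoc]
    rw [← mul_assoc, this, mul_assoc]
  simp only [mul_smul_comm, t₁, t₂, t₃, t₄]
  -- Moving each logarithmic derivative to the left past the preceding factors produces multiples of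
  -- the central vector `Eδ`. The hypothesis `hd` says that these cancel against the derivative of
  -- the quadratic last factor.
  have hfin : (C c₀ • E₀ + C c₁ • (E₁ + (C c₀ * Polynomial.X * (N₀₁ : S[X])) • Eδ) +
      C c₂ • (E₂ + (C c₁ * Polynomial.X * (N₁₂ : S[X])) • Eδ) + C c₃ • (E₃ + (C c₀ * Polynomial.X * (N₀₃ : S[X])) • Eδ) +
      (2 * C d * Polynomial.X : S[X]) • Eδ) = C c₀ • E₀ + C c₁ • E₁ + C c₂ • E₂ + C c₃ • E₃ := by
    match_scalars
    · ring
    · ring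
    · linear_combination Polynomial.X * hd'
    · ring
    · ring
  rw [← hfin]
  simp only [add_mul, smul_mul_assoc, mul_assoc]

end AdmissibleLattice
end SplitGroup

namespace SplitGroup
namespace AdmissibleLattice

variable {ι X Y : Type*} [Finite ι] [AddCommGroup X] [AddCommGroup Y]
  {P : RootDatum ι X Y} {m : Type*} [Fintype m] [DecidableEq m] (V : AdmissibleLattice P m)

/-! ### Commutators of root subgroups -/

lemma eX_comb_bracket (α β : ι) (h : LinearIndependent ℤ ![P.root α, P.root β]) (i j i' j' : ℤ)
    (hne : i + i' ≠ 0 ∨ j + j' ≠ 0) :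
    ∃ N : ℤ, V.eX (comb P α β i j) * V.eX (comb P α β i' j') -
      V.eX (comb P α β i' j') * V.eX (comb P α β i j) = N • V.eX (comb P α β (i + i') (j + j')) := by
  have := V.eX_bracket (comb P α β i j) (comb P α β i' j') (by
    rw [comb_add]
    exact comb_ne_zero P α β h _ _ hne)
  rwa [comb_add] at this

lemma eX_comb_comm (α β : ι) (h : LinearIndependent ℤ ![P.root α, P.root β]) (i j i' j' : ℤ)
    (hne : i + i' ≠ 0 ∨ j + j' ≠ 0) (hn : comb P α β i j ∈ Set.range P.root →
      comb P α β i' j' ∈ Set.range P.root →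
      comb P α β (i + i') (j + j') ∉ Set.range P.root) :
    V.eX (comb P α β i j) * V.eX (comb P α β i' j') =
      V.eX (comb P α β i' j') * V.eX (comb P α β i j) := by
  by_cases h1 : comb P α β i j ∈ Set.range P.root
  swap
  · simp [V.eX_of_notMem _ h1]
  by_cases h2 : comb P α β i' j' ∈ Set.range P.root
  swap
  · simp [V.eX_of_notMem _ h2]
  obtain ⟨N, hN⟩ := V.eX_comb_bracket α β h i j i' j' hne
  rwa [V.eX_of_notMem _ (hn h1 h2), smul_zero, sub_eq_zero] at hN

open Polynomial

/-- The commutators of the root vectors `e (β + k α)`. -/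
lemma exists_string_brackets [P.IsReduced] (α β : ι)
    (h : LinearIndependent ℤ ![P.root α, P.root β])
    (hle : P.chainTopCoeff β α ≤ P.chainTopCoeff α β) (M : ℕ → ℤ)
    (hM1 : M 1 = P.chainBotCoeff α β + 1 ∨ M 1 = - (P.chainBotCoeff α β + 1 : ℤ))
    (hM : ∀ k : ℕ, V.e α * (M k • V.eX (comb P α β k 1)) -
        (M k • V.eX (comb P α β k 1)) * V.e α =
        ((k + 1 : ℕ) : ℤ) • (M (k + 1) • V.eX (comb P α β (k + 1 : ℕ) 1))) (hM0 : M 0 = 1) :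
    ∃ (l : ℤ) (N₀₁ N₀₃ N₁₂ : ℤ) (d : ℤ[X]), 1 ≤ l ∧
      (V.eX (comb P α β 0 1) * V.eX (comb P α β 1 1) - V.eX (comb P α β 1 1) *
        V.eX (comb P α β 0 1) = N₀₁ • V.eX (comb P α β l 2)) ∧
      (V.eX (comb P α β 0 1) * V.eX (comb P α β 2 1) = V.eX (comb P α β 2 1) *
        V.eX (comb P α β 0 1)) ∧
      (V.eX (comb P α β 0 1) * V.eX (comb P α β 3 1) - V.eX (comb P α β 3 1) *
        V.eX (comb P α β 0 1) = N₀₃ • V.eX (comb P α β l 2)) ∧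
      (V.eX (comb P α β 1 1) * V.eX (comb P α β 2 1) - V.eX (comb P α β 2 1) *
        V.eX (comb P α β 1 1) = N₁₂ • V.eX (comb P α β l 2)) ∧
      (V.eX (comb P α β 1 1) * V.eX (comb P α β 3 1) = V.eX (comb P α β 3 1) *
        V.eX (comb P α β 1 1)) ∧
      (V.eX (comb P α β 2 1) * V.eX (comb P α β 3 1) = V.eX (comb P α β 3 1) *
        V.eX (comb P α β 2 1)) ∧
      (∀ k : ℤ, 0 ≤ k → k ≤ 3 → V.eX (comb P α β k 1) * V.eX (comb P α β l 2) =
        V.eX (comb P α β l 2) * V.eX (comb P α β k 1)) ∧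
      2 * d + 1 * (Polynomial.X * C (M 1)) * (N₀₁ : ℤ[X]) +
        1 * (Polynomial.X ^ 3 * C (M 3)) * (N₀₃ : ℤ[X]) +
        (Polynomial.X * C (M 1)) * (Polynomial.X ^ 2 * C (M 2)) * (N₁₂ : ℤ[X]) = 0 := by
  have h' : LinearIndependent ℤ ![P.root β, P.root α] := LinearIndependent.pair_symm_iff.mp h
  obtain ⟨fa, fp, f3, fr, fb, fn⟩ := rankTwo_facts P α β h
  obtain ⟨ga, gp, g3, gr, gb, gn⟩ := rankTwo_facts P β α h'
  simp only [comb_swap P β α] at ga gr gb gn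
  have hpp := pairing_pair_mem P α β h
  have hns := nsmul_comb_notMem P α β
  have f10 := fa 1
  have g10 := ga 1
  have fm10 := fa (-1)
  have gm10 := ga (-1)
  have gm10' : comb P α β (-1) 1 ∈ Set.range P.root ↔ comb P α β 1 (-1) ∈ Set.range P.root :=
    ⟨fun hx => fn _ _ hx, fun hx => by simpa using fn _ _ hx⟩
  generalize hr : P.chainBotCoeff α β = r at *
  generalize hn : P.chainTopCoeff α β = n at *
  generalize hr' : P.chainBotCoeff β α = r' at *
  generalize hn' : P.chainTopCoeff β α = n' at *
  generalize hp : P.pairing β α = p at *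
  generalize hp' : P.pairing α β = p' at *
  have hrr : 1 ≤ r ↔ 1 ≤ r' := by
    constructor
    · intro hx
      have := gm10.mp (gm10'.mp (fm10.mpr (by omega)))
      omega
    · intro hx
      have := fm10.mp (gm10'.mpr (gm10.mpr (by omega)))
      omega
  have hnn : 1 ≤ n ↔ 1 ≤ n' := by
    constructor
    · intro hx
      have := g10.mp (f10.mpr (by omega))
      omega
    · intro hx
      have := f10.mp (g10.mpr (by omega))
      omega
  -- For n = 3 (type G₂) the only further root that matters is δ = 3α + 2β. Otherwise it is δ = α +
  -- 2β, if that is a root at all.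
  by_cases hn3 : n = 3
  · obtain ⟨rfl, rfl⟩ : r = 0 ∧ r' = 0 := by omega
    have hp3 : p = -3 := by omega
    obtain ⟨rfl, rfl⟩ : p' = -1 ∧ n' = 1 := by omega
    subst hp3 hn3
    have n12 : comb P α β 1 2 ∉ Set.range P.root := fun hx => by
      have := (ga 2).mp hx
      omega
    have n43 : comb P α β 4 3 ∉ Set.range P.root := fun hx => by
      have := gr _ _ hx
      have := (fa 4).mp (by simpa using this)
      omega
    have n53 : comb P α β 5 3 ∉ Set.range P.root := fun hx => n43 (by simpa using fr _ _ hx)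
    have c01 := V.eX_comb_comm α β h 0 1 1 1 (by omega) (fun _ _ => n12)
    have c02 := V.eX_comb_comm α β h 0 1 2 1 (by omega)
      (fun _ _ => by simpa using hns 2 1 1 (by omega) ((fa 1).mpr (by omega)))
    have c13 := V.eX_comb_comm α β h 1 1 3 1 (by omega)
      (fun _ _ => by simpa using hns 2 2 1 (by omega) ((fa 2).mpr (by omega)))
    have c23 := V.eX_comb_comm α β h 2 1 3 1 (by omega) (fun _ _ hx => by
      have := fb _ _ hx
      omega)
    obtain ⟨N₀₃, (h03 : _ = N₀₃ • V.eX (comb P α β 3 2))⟩ :=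
      V.eX_comb_bracket α β h 0 1 3 1 (by omega)
    obtain ⟨N₁₂, (h12 : _ = N₁₂ • V.eX (comb P α β 3 2))⟩ :=
      V.eX_comb_bracket α β h 1 1 2 1 (by omega)
    have hδ : ∀ k : ℤ, 0 ≤ k → k ≤ 3 → V.eX (comb P α β k 1) * V.eX (comb P α β 3 2) =
        V.eX (comb P α β 3 2) * V.eX (comb P α β k 1) := by
      intro k hk0 hk3
      apply V.eX_comb_comm α β h k 1 3 2 (by omega)
      intro _ _
      obtain rfl | rfl | rfl | rfl : k = 0 ∨ k = 1 ∨ k = 2 ∨ k = 3 := by omega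
      · simpa using hns 3 1 1 (by omega) ((fa 1).mpr (by omega))
      · exact n43
      · exact n53
      · simpa using hns 3 2 1 (by omega) ((fa 2).mpr (by omega))
    -- Jacobi identity: apply ad(e_α) to [e_β, e_{2α+β}], which is 0 because 2(α + β) is not a root.
    have key : (M 1 * M 2 * N₁₂ + 3 * M 3 * N₀₃) • V.eX (comb P α β 3 2) = 0 := by
      have k0 : V.e α * V.eX (comb P α β 0 1) - V.eX (comb P α β 0 1) * V.e α =
          M 1 • V.eX (comb P α β 1 1) := by
        simpa [hM0] using hM 0
      have k2 : V.e α * (M 2 • V.eX (comb P α β 2 1)) - (M 2 • V.eX (comb P α β 2 1)) * V.e α =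
          (3 : ℤ) • (M 3 • V.eX (comb P α β 3 1)) := hM 2
      have e1 : V.e α * (V.eX (comb P α β 0 1) * (M 2 • V.eX (comb P α β 2 1)) -
          (M 2 • V.eX (comb P α β 2 1)) * V.eX (comb P α β 0 1)) -
          (V.eX (comb P α β 0 1) * (M 2 • V.eX (comb P α β 2 1)) -
          (M 2 • V.eX (comb P α β 2 1)) * V.eX (comb P α β 0 1)) * V.e α = 0 := by
        rw [mul_smul_comm, smul_mul_assoc, c02]
        simp
      have e2 : ∀ e a b : Matrix m m ℤ, e * (a * b - b * a) - (a * b - b * a) * e =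
          ((e * a - a * e) * b - b * (e * a - a * e)) +
          (a * (e * b - b * e) - (e * b - b * e) * a) := by
        intro e a b
        noncomm_ring
      rw [e2, k0, k2] at e1
      have e3 : (M 1 * M 2) • (V.eX (comb P α β 1 1) * V.eX (comb P α β 2 1) -
          V.eX (comb P α β 2 1) * V.eX (comb P α β 1 1)) + (3 * M 3) •
          (V.eX (comb P α β 0 1) * V.eX (comb P α β 3 1) -
          V.eX (comb P α β 3 1) * V.eX (comb P α β 0 1)) = 0 := by
        rw [← e1]
        simp only [mul_smul_comm, smul_mul_assoc]
        module
      rw [h12, h03] at e3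
      rw [← e3]
      module
    by_cases h0 : V.eX (comb P α β 3 2) = 0
    · refine ⟨3, 0, 0, 0, 0, by omega, ?_, c02, ?_, ?_, c13, c23, hδ, by simp⟩
      · rw [c01, sub_self, zero_smul]
      · rw [h03, h0, smul_zero, smul_zero]
      · rw [h12, h0, smul_zero, smul_zero]
    · have key2 := (smul_eq_zero.mp key).resolve_right h0
      -- By `key2`, the required 2d = -(M₁M₂N₁₂ + M₃N₀₃)a³ equals 2M₃N₀₃a³, so that halving it is
      -- legitimate over ℤ.
      refine ⟨3, 0, N₀₃, N₁₂, Polynomial.X ^ 3 * C (M 3 * N₀₃), by omega, ?_, c02, h03, h12, c13, c23, hδ, ?_⟩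
      · rw [c01, sub_self, zero_smul]
      · have := congrArg (C : ℤ → ℤ[X]) key2
        simp only [map_add, map_mul, map_zero] at this
        have h3 : (C (3 : ℤ) : ℤ[X]) = 3 := rfl
        rw [h3] at this
        have hc : ∀ N : ℤ, (N : ℤ[X]) = C N := fun N => rfl
        rw [hc, hc, hc, map_mul]
        simp only [map_zero]
        linear_combination Polynomial.X ^ 3 * this
  · have hn2 : n ≤ 2 := by omega
    have e3 : comb P α β 3 1 ∉ Set.range P.root := fun hx => by
      have := (fa 3).mp hx
      omega
    have n32 : 2 ≤ n → comb P α β 3 2 ∉ Set.range P.root := fun hx h32 => by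
      have hb := fb _ _ h32
      have : p = -2 := by omega
      subst this
      have := (ga 2).mp (by simpa using fr _ _ h32)
      omega
    have hz3 := V.eX_of_notMem _ e3
    have c02 := V.eX_comb_comm α β h 0 1 2 1 (by omega)
      (fun _ h2 => by
        have := (fa 2).mp h2
        simpa using hns 2 1 1 (by omega) ((fa 1).mpr (by omega)))
    have c12 := V.eX_comb_comm α β h 1 1 2 1 (by omega) (fun _ h2 => by
      have := (fa 2).mp h2
      exact n32 (by omega))
    obtain ⟨N₀₁, (h01 : _ = N₀₁ • V.eX (comb P α β 1 2))⟩ :=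
      V.eX_comb_bracket α β h 0 1 1 1 (by omega)
    have hδ : ∀ k : ℤ, 0 ≤ k → k ≤ 3 → V.eX (comb P α β k 1) * V.eX (comb P α β 1 2) =
        V.eX (comb P α β 1 2) * V.eX (comb P α β k 1) := by
      intro k hk0 hk3
      apply V.eX_comb_comm α β h k 1 1 2 (by omega)
      intro hk1 hd
      have hd' := (ga 2).mp hd
      obtain rfl | rfl | rfl | rfl : k = 0 ∨ k = 1 ∨ k = 2 ∨ k = 3 := by omega
      · intro hx
        have := (ga 3).mp (by simpa using hx)
        omega
      · intro hx
        have := fb _ _ hx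
        have := gb _ _ hx
        omega
      · simpa using hns 3 1 1 (by omega) ((fa 1).mpr (by omega))
      · exact absurd hk1 e3
    by_cases h0 : V.eX (comb P α β 1 2) = 0
    · refine ⟨1, 0, 0, 0, 0, by omega, ?_, c02, ?_, ?_, ?_, ?_, hδ, by simp⟩
      · rw [h01, h0, smul_zero, smul_zero]
      · simp [hz3]
      · rw [c12, sub_self, zero_smul]
      · simp [hz3]
      · simp [hz3]
    · have hmem : comb P α β 1 2 ∈ Set.range P.root := by
        by_contra hx
        exact h0 (V.eX_of_notMem _ hx)
      have hn2' := (ga 2).mp hmem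
      -- If α + 2β is a root then n = n' = 2, and r = 0 would make both pairings -2. Hence M₁ = ±(r
      -- + 1) is even, and d = -M₁N₀₁a/2 is integral.
      have hr1 : r = 1 := by omega
      obtain ⟨M', hM'⟩ : ∃ M', M 1 = 2 * M' := by
        rcases hM1 with hM1 | hM1
        · exact ⟨1, by omega⟩
        · exact ⟨-1, by omega⟩
      refine ⟨1, N₀₁, 0, 0, - (Polynomial.X * C (M' * N₀₁)), by omega, h01, c02, ?_, ?_, ?_, ?_, hδ, ?_⟩
      · simp [hz3]
      · rw [c12, sub_self, zero_smul]
      · simp [hz3]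
      · simp [hz3]
      · have hc : ∀ N : ℤ, (N : ℤ[X]) = C N := fun N => rfl
        rw [hM', map_mul, map_mul, hc, hc]
        have h3 : (C (2 : ℤ) : ℤ[X]) = 2 := rfl
        rw [h3]
        simp only [map_zero]
        ring

/-- `x_α(a) x_β(T) x_α(a)⁻¹` over the universal ring `ℤ[a][T]`. -/
lemma exists_conj_eq_prod [P.IsReduced] (α β : ι)
    (h : LinearIndependent ℤ ![P.root α, P.root β])
    (hle : P.chainTopCoeff β α ≤ P.chainTopCoeff α β) :
    ∃ (l : ℤ) (c₁ c₂ c₃ d : ℤ[X]), 1 ≤ l ∧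
      V.x α (C Polynomial.X : ℤ[X][X]) * V.x β (Polynomial.X : ℤ[X][X]) *
        (V.x α (C Polynomial.X : ℤ[X][X]))⁻¹ =
      V.xX (comb P α β 0 1) (C 1 * Polynomial.X) * V.xX (comb P α β 1 1) (C c₁ * Polynomial.X) *
        V.xX (comb P α β 2 1) (C c₂ * Polynomial.X) * V.xX (comb P α β 3 1) (C c₃ * Polynomial.X) *
        V.xX (comb P α β l 2) (C d * Polynomial.X ^ 2) := by
  have hcomb : ∀ k : ℕ, P.root β + k • P.root α = comb P α β k 1 := by
    intro k
    simp only [comb]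
    module
  obtain ⟨M, hM0, hM1, hM, hx⟩ := V.exists_x_mul_e α β h
  simp only [hcomb] at hM hx
  obtain ⟨l, N₀₁, N₀₃, N₁₂, d, hl, h01, h02, h03, h12, h13, h23, hδ, hd⟩ :=
    V.exists_string_brackets α β h hle M hM1 hM hM0
  refine ⟨l, Polynomial.X * C (M 1), Polynomial.X ^ 2 * C (M 2), Polynomial.X ^ 3 * C (M 3), d, hl,
    ?_⟩
  -- As functions of T, both sides equal 1 at T = 0 and have the logarithmic derivative Ad(x_α(a))
  -- e_β = ∑ a^k M_k e_{β+kα}.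
  refine eq_of_der_eq _ _ _ ?_ (V.der_prod _ _ _ _ _ N₀₁ N₀₃ N₁₂ 1 (Polynomial.X * C (M 1))
    (Polynomial.X ^ 2 * C (M 2)) (Polynomial.X ^ 3 * C (M 3)) d h01 h02 h03 h12 h13 h23
    (hδ 0 (by omega) (by omega)) (hδ 1 (by omega) (by omega)) (hδ 2 (by omega) (by omega))
    (hδ 3 (by omega) (by omega)) hd) ?_
  · have hx' := hx ℤ[X][X] (C Polynomial.X)
    simp only [Units.val_mul, der_mul, ← x_neg, der_x, derivative_C, derivative_X, derivative_neg,
      neg_zero, zero_smul, zero_mul, mul_zero, zero_add, add_zero, one_smul]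
    rw [← mul_assoc, hx']
    simp only [mul_assoc]
    congr 1
    simp only [Finset.sum_range_succ, Finset.sum_range_zero, hM0]
    have hc : ∀ N : ℤ, (N : ℤ[X][X]) = C (C N) := fun N => by simp
    simp only [hc, map_mul, map_pow, zero_add, pow_zero, pow_one, map_one, mul_one, Nat.cast_zero,
      Nat.cast_one, Nat.cast_ofNat]
  · simp only [map_mul, map_inv, map_x, map_xX, coe_evalRingHom, eval_C, eval_X, x_zero, mul_one,
      mul_inv_cancel, mul_zero, xX_zero, eval_pow]
    norm_num
    simp only [xX_zero]

variable (R : Type*) [CommRing R]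

/-- The subgroup generated by the root subgroups of the roots `i α + j β` with `i, j ≥ 1`. -/
def commSubgroup (α β : ι) : Subgroup (GL m R) :=
  Subgroup.closure {g | ∃ (γ : ι) (i j : ℤ) (a : R), 1 ≤ i ∧ 1 ≤ j ∧
    P.root γ = comb P α β i j ∧ g = V.x γ a}

lemma commSubgroup_symm (α β : ι) : V.commSubgroup R α β = V.commSubgroup R β α := by
  have : ∀ α β, V.commSubgroup R α β ≤ V.commSubgroup R β α := by
    intro α β
    refine Subgroup.closure_mono ?_
    rintro _ ⟨γ, i, j, a, hi, hj, hγ, rfl⟩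
    exact ⟨γ, j, i, a, hj, hi, by rw [hγ, comb_swap], rfl⟩
  exact le_antisymm (this α β) (this β α)

variable {R}

lemma xX_mem_commSubgroup (α β : ι) (i j : ℤ) (hi : 1 ≤ i) (hj : 1 ≤ j) (a : R) :
    V.xX (comb P α β i j) a ∈ V.commSubgroup R α β := by
  by_cases h : comb P α β i j ∈ Set.range P.root
  · obtain ⟨γ, hγ⟩ := h
    rw [← hγ, xX_root]
    exact Subgroup.subset_closure ⟨γ, i, j, a, hi, hj, hγ, rfl⟩
  · rw [V.xX_of_notMem _ h]
    exact one_mem _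

/-- The commutator of two root subgroups lies in the group generated by the root subgroups of the
roots `i α + j β` with `i, j ≥ 1`. -/
theorem commutator_mem [P.IsReduced] (α β : ι) (h : LinearIndependent ℤ ![P.root α, P.root β])
    (a b : R) :
    V.x α a * V.x β b * (V.x α a)⁻¹ * (V.x β b)⁻¹ ∈ V.commSubgroup R α β := by
  -- The universal identity needs the string in the conjugating direction to reach at least as far
  -- up as the other one. So the commutator is read off from conjugation by x_α or by x_β, whichever
  -- qualifies, after specializing ℤ[a][T] to `R`.
  have key : ∀ (α β : ι), LinearIndependent ℤ ![P.root α, P.root β] →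
      P.chainTopCoeff β α ≤ P.chainTopCoeff α β → ∀ a b : R,
      (V.x β b)⁻¹ * (V.x α a * V.x β b * (V.x α a)⁻¹) ∈ V.commSubgroup R α β := by
    intro α β h hle a b
    obtain ⟨l, c₁, c₂, c₃, d, hl, hc⟩ := V.exists_conj_eq_prod α β h hle
    have := congrArg (Matrix.GeneralLinearGroup.map
      (eval₂RingHom (eval₂RingHom (Int.castRingHom R) a) b)) hc
    simp only [map_mul, map_inv, map_x, map_xX, coe_eval₂RingHom, eval₂_C, eval₂_X] at this
    have h0 : comb P α β 0 1 = P.root β := by simp [comb]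
    rw [this, h0, xX_root, eval₂_one, one_mul]
    simp only [mul_assoc, inv_mul_cancel_left]
    refine mul_mem ?_ (mul_mem ?_ (mul_mem ?_ ?_))
    · exact V.xX_mem_commSubgroup α β 1 1 (by omega) (by omega) _
    · exact V.xX_mem_commSubgroup α β 2 1 (by omega) (by omega) _
    · exact V.xX_mem_commSubgroup α β 3 1 (by omega) (by omega) _
    · exact V.xX_mem_commSubgroup α β l 2 hl (by omega) _
  rcases le_total (P.chainTopCoeff β α) (P.chainTopCoeff α β) with hle | hle
  · have := key α β h hle a (-b)
    rw [x_neg, inv_inv] at this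
    have := inv_mem this
    simpa only [mul_inv_rev, inv_inv, mul_assoc] using this
  · have := key β α (LinearIndependent.pair_symm_iff.mp h) hle b (-a)
    rw [x_neg, inv_inv, commSubgroup_symm] at this
    simpa only [mul_inv_rev, inv_inv, mul_assoc] using this

end AdmissibleLattice
end SplitGroup

namespace SplitGroup

/-! ### Alternating words -/

section AltWords

open YokonumaHecke

/-- The `n`-th letter of the word `a b a b ⋯`. -/
def altLetter {α : Type*} (a b : α) : ℕ → α
  | 0 => a
  | n + 1 => altLetter b a n

lemma altProd_succ_right {M : Type*} [Monoid M] (a b : M) (n : ℕ) :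
    altProd a b (n + 1) = altProd a b n * altLetter a b n := by
  induction n generalizing a b with
  | zero => simp [altProd, altLetter]
  | succ n ih =>
    rw [altProd, ih b a, ← mul_assoc]
    rfl

lemma altLetter_map {α β : Type*} (f : α → β) (a b : α) (n : ℕ) :
    altLetter (f a) (f b) n = f (altLetter a b n) := by
  induction n generalizing a b with
  | zero => rfl
  | succ n ih => exact ih b a

lemma map_altProd {M N : Type*} [Monoid M] [Monoid N] (f : M →* N) (a b : M) (n : ℕ) :
    f (altProd a b n) = altProd (f a) (f b) n := by
  induction n generalizing a b with
  | zero => simp [altProd]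
  | succ n ih => rw [altProd, altProd, map_mul, ih]

end AltWords

/-! ### Roots attached to alternating words, and powers of a product of two reflections -/

section RootDatum

variable {ι X Y : Type*} [Finite ι] [AddCommGroup X] [AddCommGroup Y] (P : RootDatum ι X Y)

open YokonumaHecke

/-- The roots `α, s_α β, s_α s_β α, …`. -/
def altRoots (α β : ι) : ℕ → List ι
  | 0 => []
  | n + 1 => α :: (altRoots β α n).map (P.reflectionPerm α)

lemma altRoots_succ_right (α β : ι) (n : ℕ) : altRoots P α β (n + 1) = altRoots P α β n ++
    [altProd (P.reflectionPerm α) (P.reflectionPerm β) n (altLetter α β n)] := by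
  induction n generalizing α β with
  | zero => rfl
  | succ n ih =>
    rw [altRoots, ih β α, List.map_append, ← List.cons_append]
    rfl

/-- The coordinates of `altRoots`, where `p = ⟨β, α^∨⟩` and `p' = ⟨α, β^∨⟩`. -/
def altCoords (p p' : ℤ) : ℕ → List (ℤ × ℤ)
  | 0 => []
  | n + 1 => (1, 0) :: (altCoords p' p n).map fun c => (-c.2 - c.1 * p, c.1)

lemma map_root_altRoots (α β : ι) (n : ℕ) : (altRoots P α β n).map P.root =
    (altCoords (P.pairing β α) (P.pairing α β) n).map fun c => comb P α β c.1 c.2 := by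
  induction n generalizing α β with
  | zero => rfl
  | succ n ih =>
    rw [altRoots, altCoords, List.map_cons, List.map_cons, List.map_map, List.map_map]
    congr 1
    · simp [comb]
    · have h1 : (P.root ∘ P.reflectionPerm α : ι → X) = P.reflection α ∘ P.root := by
        funext γ
        simp [P.root_reflectionPerm]
      rw [h1, ← List.map_map, ih, List.map_map]
      congr 1
      funext c
      simp only [Function.comp_apply]
      rw [comb_swap, comb_reflection_left]

/-- One step of the action of `s_α s_β` on `x + i α + j β`, where `u = ⟨x, α^∨⟩`,
`v = ⟨x, β^∨⟩`. -/
def coxStep (p p' u v : ℤ) (c : ℤ × ℤ) : ℤ × ℤ :=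
  (-c.1 - u - (-c.2 - v - c.1 * p') * p, -c.2 - v - c.1 * p')

/-- The displacement of `x` stays in the plane of the two roots and depends only on the two pairings
of `x`. The order of the product of reflections thus becomes integer arithmetic with `coxStep`. -/
lemma coxeter_pow_apply (α β : ι) (x : X) (n : ℕ) :
    ((P.reflection α * P.reflection β) ^ n) x =
      x + comb P α β ((coxStep (P.pairing β α) (P.pairing α β) (P.toLinearMap x (P.coroot α))
        (P.toLinearMap x (P.coroot β)))^[n] (0, 0)).1
        ((coxStep (P.pairing β α) (P.pairing α β) (P.toLinearMap x (P.coroot α))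
        (P.toLinearMap x (P.coroot β)))^[n] (0, 0)).2 := by
  induction n with
  | zero => simp [comb]
  | succ n ih =>
    rw [pow_succ', Function.iterate_succ_apply']
    rw [LinearEquiv.mul_apply, ih]
    generalize (coxStep (P.pairing β α) (P.pairing α β) (P.toLinearMap x (P.coroot α))
        (P.toLinearMap x (P.coroot β)))^[n] (0, 0) = c
    rw [LinearEquiv.mul_apply, map_add, comb_reflection_right, map_add,
      comb_reflection_left, P.reflection_apply β, map_sub, P.reflection_apply α]
    have h1 : ∀ (γ : ι) (y : X), P.coroot' γ y = P.toLinearMap y (P.coroot γ) := fun γ y => rfl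
    rw [h1, h1, map_smul, P.reflection_apply_root]
    simp only [coxStep, comb]
    module

lemma weylGroup_ofIdx_mul_pow_eq_one_iff (α β : ι) (n : ℕ) :
    (RootPairing.weylGroup.ofIdx P α * RootPairing.weylGroup.ofIdx P β) ^ n = 1 ↔
      (P.reflection α * P.reflection β) ^ n = 1 := by
  have h1 : ∀ γ, RootPairing.Equiv.weightHom P (RootPairing.Equiv.reflection P γ) =
      P.reflection γ := by
    intro γ
    rw [RootPairing.Equiv.weightHom_apply, RootPairing.Equiv.reflection_weightEquiv]
  rw [← h1, ← h1, ← map_mul, ← map_pow, ← map_one (RootPairing.Equiv.weightHom P),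
    (RootPairing.Equiv.weightHom_injective P).eq_iff, ← Subtype.coe_inj]
  rfl

end RootDatum
end SplitGroup

namespace SplitGroup

/-! ### Rank two Cartan data and the positive roots in the plane of two simple roots -/

section RankTwo

open YokonumaHecke

/-- The pairs of off-diagonal entries of Cartan matrices of rank two, with the order of the
Coxeter element. -/
def IsCartanPair (p p' : ℤ) (m : ℕ) : Prop :=
  (p = 0 ∧ p' = 0 ∧ m = 2) ∨ (p = -1 ∧ p' = -1 ∧ m = 3) ∨ (p = -2 ∧ p' = -1 ∧ m = 4) ∨
    (p = -1 ∧ p' = -2 ∧ m = 4) ∨ (p = -3 ∧ p' = -1 ∧ m = 6) ∨ (p = -1 ∧ p' = -3 ∧ m = 6)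

lemma IsCartanPair.symm {p p' : ℤ} {m : ℕ} (h : IsCartanPair p p' m) : IsCartanPair p' p m := by
  rcases h with h | h | h | h | h | h <;> obtain ⟨rfl, rfl, rfl⟩ := h <;> simp [IsCartanPair]

/-- The two reduced words of the longest element meet the positive roots in opposite orders. -/
lemma IsCartanPair.altCoords_swap {p p' : ℤ} {m : ℕ} (h : IsCartanPair p p' m) :
    (altCoords p' p m).map Prod.swap = (altCoords p p' m).reverse := by
  rcases h with ⟨rfl, rfl, rfl⟩ | ⟨rfl, rfl, rfl⟩ | ⟨rfl, rfl, rfl⟩ | ⟨rfl, rfl, rfl⟩ |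
    ⟨rfl, rfl, rfl⟩ | ⟨rfl, rfl, rfl⟩ <;> decide

lemma IsCartanPair.altCoords_nonneg {p p' : ℤ} {m : ℕ} (h : IsCartanPair p p' m) :
    ∀ c ∈ altCoords p p' m, 0 ≤ c.1 ∧ 0 ≤ c.2 := by
  rcases h with ⟨rfl, rfl, rfl⟩ | ⟨rfl, rfl, rfl⟩ | ⟨rfl, rfl, rfl⟩ | ⟨rfl, rfl, rfl⟩ |
    ⟨rfl, rfl, rfl⟩ | ⟨rfl, rfl, rfl⟩ <;> decide

/-- Positive determinants mean that the roots are listed by increasing angle; this is what locates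
sums of listed roots in `mem_of_append`. -/
lemma IsCartanPair.altCoords_pairwise {p p' : ℤ} {m : ℕ} (h : IsCartanPair p p' m) :
    (altCoords p p' m).Pairwise fun c d => 0 < c.1 * d.2 - c.2 * d.1 := by
  rcases h with ⟨rfl, rfl, rfl⟩ | ⟨rfl, rfl, rfl⟩ | ⟨rfl, rfl, rfl⟩ | ⟨rfl, rfl, rfl⟩ |
    ⟨rfl, rfl, rfl⟩ | ⟨rfl, rfl, rfl⟩ <;> decide

lemma IsCartanPair.coxStep_iterate {p p' : ℤ} {m : ℕ} (h : IsCartanPair p p' m) (u v : ℤ) :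
    (coxStep p p' u v)^[m] (0, 0) = (0, 0) := by
  rcases h with ⟨rfl, rfl, rfl⟩ | ⟨rfl, rfl, rfl⟩ | ⟨rfl, rfl, rfl⟩ | ⟨rfl, rfl, rfl⟩ |
    ⟨rfl, rfl, rfl⟩ | ⟨rfl, rfl, rfl⟩ <;>
  · simp only [Function.iterate_succ_apply', Function.iterate_zero_apply, coxStep, Prod.mk.injEq]
    constructor <;> ring

lemma IsCartanPair.coxStep_iterate_ne {p p' : ℤ} {m : ℕ} (h : IsCartanPair p p' m) :
    ∀ k < m, 0 < k → (coxStep p p' 2 p')^[k] (0, 0) ≠ (0, 0) := by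
  rcases h with ⟨rfl, rfl, rfl⟩ | ⟨rfl, rfl, rfl⟩ | ⟨rfl, rfl, rfl⟩ | ⟨rfl, rfl, rfl⟩ |
    ⟨rfl, rfl, rfl⟩ | ⟨rfl, rfl, rfl⟩ <;> decide

lemma IsCartanPair.two_le {p p' : ℤ} {m : ℕ} (h : IsCartanPair p p' m) : 2 ≤ m := by
  unfold IsCartanPair at h
  omega

variable {ι X Y : Type*} [Finite ι] [AddCommGroup X] [AddCommGroup Y] {P : RootDatum ι X Y}

lemma IsCartanPair.orderOf_eq {α β : ι} (hl : LinearIndependent ℤ ![P.root α, P.root β]) {m : ℕ}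
    (h : IsCartanPair (P.pairing β α) (P.pairing α β) m) :
    orderOf (RootPairing.weylGroup.ofIdx P α * RootPairing.weylGroup.ofIdx P β) = m := by
  have h2 := h.two_le
  rw [orderOf_eq_iff (by omega)]
  constructor
  · rw [weylGroup_ofIdx_mul_pow_eq_one_iff]
    ext x
    rw [coxeter_pow_apply, h.coxStep_iterate]
    simp [comb]
  · intro k hk hk0 h1
    rw [weylGroup_ofIdx_mul_pow_eq_one_iff] at h1
    have h3 := coxeter_pow_apply P α β (P.root α) k
    rw [h1, P.root_coroot_two, P.root_coroot_eq_pairing] at h3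
    have h4 := left_eq_add.mp h3
    refine h.coxStep_iterate_ne k hk hk0 ?_
    by_contra h5
    refine comb_ne_zero P α β hl _ _ ?_ h4
    rw [Prod.ext_iff] at h5
    tauto

variable [P.IsReduced] (b : P.Base)

lemma linearIndependent_of_mem_support {α β : ι} (hα : α ∈ b.support) (hβ : β ∈ b.support)
    (h : α ≠ β) : LinearIndependent ℤ ![P.root α, P.root β] :=
  b.linearIndependent_pair_of_ne (i := ⟨α, hα⟩) (j := ⟨β, hβ⟩) (by simpa using h)

lemma isCartanPair_of_mem_support {α β : ι} (hα : α ∈ b.support) (hβ : β ∈ b.support)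
    (h : α ≠ β) : IsCartanPair (P.pairing β α) (P.pairing α β)
      (orderOf (RootPairing.weylGroup.ofIdx P α * RootPairing.weylGroup.ofIdx P β)) := by
  have hl := linearIndependent_of_mem_support b hα hβ h
  suffices ∃ m, IsCartanPair (P.pairing β α) (P.pairing α β) m by
    obtain ⟨m, hm⟩ := this
    rwa [hm.orderOf_eq hl]
  have h2 : P.pairingIn ℤ β α = P.pairing β α := P.algebraMap_pairingIn ℤ β α
  have h3 : P.pairingIn ℤ α β = P.pairing α β := P.algebraMap_pairingIn ℤ α β
  have h4 := b.pairingIn_le_zero_of_ne h.symm hβ hα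
  have h5 := b.pairingIn_le_zero_of_ne h hα hβ
  rw [h2] at h4
  rw [h3] at h5
  have h6 := pairing_abs_le_three P α β
  have h7 := pairing_abs_le_three P β α
  have h8 := pairing_pair_mem P α β hl
  generalize P.pairing β α = p at *
  generalize P.pairing α β = p' at *
  have key : (p = 0 ∧ p' = 0) ∨ (p = -1 ∧ p' = -1) ∨ (p = -2 ∧ p' = -1) ∨ (p = -1 ∧ p' = -2) ∨
      (p = -3 ∧ p' = -1) ∨ (p = -1 ∧ p' = -3) := by
    omega
  rcases key with h | h | h | h | h | h <;> obtain ⟨rfl, rfl⟩ := h <;> simp [IsCartanPair]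

lemma comb_sign {α β : ι} (hα : α ∈ b.support) (hβ : β ∈ b.support) (h : α ≠ β) (i j : ℤ)
    (hr : comb P α β i j ∈ Set.range P.root) : (0 ≤ i ∧ 0 ≤ j) ∨ (i ≤ 0 ∧ j ≤ 0) := by
  classical
  have h1 := b.pos_or_neg_of_sum_smul_root_mem (Pi.single α i + Pi.single β j) ?_ ?_
  · rcases h1 with h1 | h1
    · left
      have h2 := h1.le α
      have h3 := h1.le β
      simpa [h, h.symm] using And.intro h2 h3
    · right
      have h2 := h1.le α
      have h3 := h1.le β
      simpa [h, h.symm] using And.intro h2 h3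
  · simpa [add_smul, Finset.sum_add_distrib, Pi.single_apply, ite_smul, hα, hβ, comb] using hr
  · intro γ hγ
    by_contra h2
    apply hγ
    rw [Pi.add_apply, Pi.single_eq_of_ne, Pi.single_eq_of_ne, add_zero]
    · rintro rfl
      exact h2 hβ
    · rintro rfl
      exact h2 hα

lemma root_reflectionPerm_comb {α β : ι} {γ : ι} {i j : ℤ} (h : P.root γ = comb P α β i j) :
    P.root (P.reflectionPerm α γ) = comb P α β (-i - j * P.pairing β α) j := by
  rw [P.root_reflectionPerm, h, comb_reflection_left]

/-- Two simple roots, with the order of the product of their reflections. -/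
structure IsSimplePair (α β : ι) (m : ℕ) : Prop where
  linearIndependent : LinearIndependent ℤ ![P.root α, P.root β]
  isCartanPair : IsCartanPair (P.pairing β α) (P.pairing α β) m
  sign : ∀ i j, comb P α β i j ∈ Set.range P.root → (0 ≤ i ∧ 0 ≤ j) ∨ (i ≤ 0 ∧ j ≤ 0)

lemma isSimplePair_of_mem_support {α β : ι} (hα : α ∈ b.support) (hβ : β ∈ b.support)
    (h : α ≠ β) : IsSimplePair (P := P) α β
      (orderOf (RootPairing.weylGroup.ofIdx P α * RootPairing.weylGroup.ofIdx P β)) :=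
  ⟨linearIndependent_of_mem_support b hα hβ h, isCartanPair_of_mem_support b hα hβ h,
    comb_sign b hα hβ h⟩

namespace IsSimplePair

variable {α β : ι} {m : ℕ} (h : IsSimplePair (P := P) α β m)

include h

lemma symm : IsSimplePair (P := P) β α m :=
  ⟨LinearIndependent.pair_symm_iff.mp h.linearIndependent, h.isCartanPair.symm, fun i j hr => by
    rw [comb_swap] at hr
    have := h.sign j i hr
    tauto⟩

lemma altRoots_reverse : altRoots P β α m = (altRoots P α β m).reverse := by
  have : Function.Injective (List.map P.root) := List.map_injective_iff.mpr P.root.injective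
  apply this
  rw [List.map_reverse, map_root_altRoots, map_root_altRoots, ← List.map_reverse,
    ← h.isCartanPair.altCoords_swap, List.map_map]
  congr 1
  funext c
  rw [Function.comp_apply, comb_swap]
  rfl

lemma mem_altRoots_reflection {γ : ι} (hγ : γ ∈ altRoots P α β m) (hne : γ ≠ α) :
    P.reflectionPerm α γ ∈ altRoots P α β m := by
  obtain ⟨n, rfl⟩ : ∃ n, m = n + 1 := ⟨m - 1, by have := h.isCartanPair.two_le; omega⟩
  have h1 : γ ∈ (altRoots P β α n).map (P.reflectionPerm α) := by
    rw [altRoots, List.mem_cons] at hγ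
    tauto
  obtain ⟨δ, hδ, rfl⟩ := List.mem_map.mp h1
  have h2 : δ ∈ altRoots P β α (n + 1) := by
    rw [altRoots_succ_right]
    exact List.mem_append_left _ hδ
  rw [h.altRoots_reverse, List.mem_reverse] at h2
  rwa [P.reflectionPerm_self]

lemma eq_of_comb_zero {γ : ι} {i : ℤ} (hi : 0 ≤ i) (hr : P.root γ = comb P α β i 0) : γ = α := by
  by_contra hne
  by_cases h1 : γ = P.reflectionPerm α α
  · rw [h1, AdmissibleLattice.root_neg_idx] at hr
    refine comb_ne_zero P α β h.linearIndependent (i + 1) 0 (by omega) ?_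
    rw [comb, add_smul, one_smul, add_right_comm]
    rw [comb] at hr
    rw [← hr, neg_add_cancel]
  · have h2 := linearIndependent_of_ne P α γ hne h1
    have := LinearIndependent.pair_iff.mp h2 i (-1) (by rw [hr, comb]; module)
    omega

/-- Descent on the height i + j: a positive root pairs positively with α^∨ or β^∨, the corresponding
reflection lowers it, and the list is stable under this reflection except at the simple root itself.
-/
lemma mem_altRoots_of_comb {γ : ι} {i j : ℤ} (hi : 0 ≤ i) (hj : 0 ≤ j)
    (hr : P.root γ = comb P α β i j) : γ ∈ altRoots P α β m := by
  obtain ⟨N, hN⟩ : ∃ N : ℕ, i + j ≤ N := ⟨(i + j).toNat, Int.self_le_toNat _⟩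
  induction N generalizing γ i j α β with
  | zero =>
    obtain rfl : i = 0 := by omega
    obtain rfl : j = 0 := by omega
    exact absurd (by rw [hr]; simp [comb]) (P.ne_zero γ)
  | succ N ih =>
    -- If neither pairing were positive, each of the six Cartan matrices would force i = j = 0.
    -- Exchanging α and β only reverses the list.
    wlog hp : 0 < 2 * i + j * P.pairing β α generalizing γ i j α β
    · have h1 := this h.symm hj hi (by rw [hr, comb_swap]) (by omega) ?_
      · rwa [h.altRoots_reverse, List.mem_reverse] at h1
      · by_contra h2
        have h3 : i ≠ 0 ∨ j ≠ 0 := by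
          by_contra! h3
          apply P.ne_zero γ
          rw [hr, h3.1, h3.2]
          simp [comb]
        rcases h.isCartanPair with h | h | h | h | h | h <;>
        · rw [h.1] at hp
          rw [h.2.1] at h2
          omega
    by_cases hj0 : j = 0
    · obtain rfl : γ = α := h.eq_of_comb_zero hi (by rw [hr, hj0])
      obtain ⟨n, rfl⟩ : ∃ n, m = n + 1 := ⟨m - 1, by have := h.isCartanPair.two_le; omega⟩
      exact List.mem_cons_self
    have h1 := root_reflectionPerm_comb hr
    have h2 := h.sign _ _ ⟨_, h1⟩
    have h3 := ih h (by omega) hj h1 (by omega)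
    rw [← P.reflectionPerm_self α γ]
    refine h.mem_altRoots_reflection h3 ?_
    intro h4
    rw [h4] at h1
    refine comb_ne_zero P α β h.linearIndependent (-i - j * P.pairing β α - 1) j (by omega) ?_
    have h5 : comb P α β (-i - j * P.pairing β α - 1) j =
      comb P α β (-i - j * P.pairing β α) j - P.root α := by
      simp only [comb]
      module
    rw [h5, ← h1, sub_self]

/-- By the angular order, a combination of γ and a later γ' with positive coefficient at γ' lies
strictly after γ. Thus the root subgroup of each entry normalizes the group of the entries after it.
-/
lemma mem_of_append {γ γ' δ : ι} {l₁ l₂ : List ι} (hl : altRoots P α β m = l₁ ++ γ :: l₂)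
    (hγ' : γ' ∈ l₂) {k l : ℤ} (hk : 0 ≤ k) (hl1 : 1 ≤ l) (hδ : P.root δ = comb P γ γ' k l) :
    δ ∈ l₂ := by
  have hlist := map_root_altRoots P α β m
  rw [hl, List.map_append, List.map_cons] at hlist
  obtain ⟨c₁, c', hc, hc₁, hc'⟩ := List.map_eq_append_iff.mp hlist.symm
  obtain ⟨c, c₂, rfl, hcγ, hc₂⟩ := List.map_eq_cons_iff.mp hc'
  have hpw := h.isCartanPair.altCoords_pairwise
  have hnn := h.isCartanPair.altCoords_nonneg
  rw [hc, List.pairwise_append, List.pairwise_cons] at hpw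
  rw [hc] at hnn
  have h1 := List.mem_map_of_mem (f := P.root) hγ'
  rw [← hc₂] at h1
  obtain ⟨d, hd, hdγ'⟩ := List.mem_map.mp h1
  have hc0 := hnn c (by simp)
  have hd0 := hnn d (by simp [hd])
  have hcd := hpw.2.1.1 d hd
  have hδ' : P.root δ = comb P α β (k * c.1 + l * d.1) (k * c.2 + l * d.2) := by
    rw [hδ, comb, ← hcγ, ← hdγ']
    simp only [comb]
    module
  have hmem : δ ∈ altRoots P α β m := by
    refine h.mem_altRoots_of_comb ?_ ?_ hδ'
    · nlinarith [mul_nonneg hk hc0.1, mul_nonneg (by omega : 0 ≤ l) hd0.1]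
    · nlinarith [mul_nonneg hk hc0.2, mul_nonneg (by omega : 0 ≤ l) hd0.2]
  have huniq : ∀ e : ℤ × ℤ, P.root δ = comb P α β e.1 e.2 →
      e.1 = k * c.1 + l * d.1 ∧ e.2 = k * c.2 + l * d.2 := by
    intro e he
    by_contra hne
    refine comb_ne_zero P α β h.linearIndependent (e.1 - (k * c.1 + l * d.1))
      (e.2 - (k * c.2 + l * d.2)) (by omega) ?_
    have : comb P α β (e.1 - (k * c.1 + l * d.1)) (e.2 - (k * c.2 + l * d.2)) =
      comb P α β e.1 e.2 - comb P α β (k * c.1 + l * d.1) (k * c.2 + l * d.2) := by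
      simp only [comb]
      module
    rw [this, ← he, ← hδ', sub_self]
  rw [hl, List.mem_append, List.mem_cons] at hmem
  rcases hmem with hm | rfl | hm
  · exfalso
    have h2 := List.mem_map_of_mem (f := P.root) hm
    rw [← hc₁] at h2
    obtain ⟨e, he, heδ⟩ := List.mem_map.mp h2
    obtain ⟨h3, h4⟩ := huniq e heδ.symm
    have h5 := hpw.2.2 e he c (by simp)
    rw [h3, h4] at h5
    nlinarith
  · exfalso
    obtain ⟨h3, h4⟩ := huniq c hcγ.symm
    have : l * (c.1 * d.2 - c.2 * d.1) = 0 := by linear_combination c.2 * h3 - c.1 * h4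
    have : 0 < l * (c.1 * d.2 - c.2 * d.1) := by positivity
    omega
  · exact hm

lemma linearIndependent_of_append {γ γ' : ι} {l₁ l₂ : List ι}
    (hl : altRoots P α β m = l₁ ++ γ :: l₂) (hγ' : γ' ∈ l₂) :
    LinearIndependent ℤ ![P.root γ, P.root γ'] := by
  have hlist := map_root_altRoots P α β m
  rw [hl, List.map_append, List.map_cons] at hlist
  obtain ⟨c₁, c', hc, hc₁, hc'⟩ := List.map_eq_append_iff.mp hlist.symm
  obtain ⟨c, c₂, rfl, hcγ, hc₂⟩ := List.map_eq_cons_iff.mp hc'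
  have hpw := h.isCartanPair.altCoords_pairwise
  rw [hc, List.pairwise_append, List.pairwise_cons] at hpw
  have h1 := List.mem_map_of_mem (f := P.root) hγ'
  rw [← hc₂] at h1
  obtain ⟨d, hd, hdγ'⟩ := List.mem_map.mp h1
  have hcd := hpw.2.1.1 d hd
  rw [LinearIndependent.pair_iff]
  intro s t hst
  have h2 := LinearIndependent.pair_iff.mp h.linearIndependent (s * c.1 + t * d.1)
    (s * c.2 + t * d.2) (by
      rw [← hst, ← hcγ, ← hdγ']
      simp only [comb]
      module)
  have h3 : s * (c.1 * d.2 - c.2 * d.1) = 0 := by linear_combination d.2 * h2.1 - d.1 * h2.2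
  have h4 : t * (c.1 * d.2 - c.2 * d.1) = 0 := by linear_combination c.1 * h2.2 - c.2 * h2.1
  exact ⟨(mul_eq_zero.mp h3).resolve_right hcd.ne', (mul_eq_zero.mp h4).resolve_right hcd.ne'⟩

/-- The last of the roots `α, s_α β, …` is `β`. -/
lemma altProd_reflectionPerm_altLetter {n : ℕ} (hm : m = n + 1) :
    altProd (P.reflectionPerm α) (P.reflectionPerm β) n (altLetter α β n) = β := by
  subst hm
  have h1 := h.altRoots_reverse
  rw [altRoots_succ_right P α β, List.reverse_append, altRoots] at h1
  simp only [List.reverse_cons, List.reverse_nil, List.nil_append, List.cons_append] at h1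
  exact (List.cons.inj h1).1.symm

end IsSimplePair

end RankTwo
end SplitGroup

namespace SplitGroup
namespace AdmissibleLattice

variable {ι X Y : Type*} [Finite ι] [AddCommGroup X] [AddCommGroup Y]
  {P : RootDatum ι X Y} {m : Type*} [Fintype m] [DecidableEq m] (V : AdmissibleLattice P m)
  {R : Type*} [CommRing R]

/-! ### The braid relations for representatives of simple reflections -/

open YokonumaHecke

lemma cartan_ne_zero (α : ι) : V.cartan α ≠ 0 := by
  intro h
  have h0 : ∀ i, V.ht α i = 0 := fun i => by
    have := congrFun (congrFun h i) i
    simpa [cartan] using this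
  apply V.e_ne_zero α
  ext i j
  by_contra h1
  have h2 := V.ht_of_wt_eq α α i j (V.wt_eq α i j h1)
  rw [h0, h0, P.pairing_same] at h2
  omega

/-- The element `g` permutes the root vectors, up to signs, and the coroots as `σ` does. -/
structure Acts (g : GL m ℤ) (σ : Equiv.Perm ι) : Prop where
  conj_e : ∀ γ, ∃ ε : ℤ, (ε = 1 ∨ ε = -1) ∧
    (g : Matrix m m ℤ) * V.e γ = ε • (V.e (σ γ) * (g : Matrix m m ℤ))
  conj_cartan : ∀ γ, (g : Matrix m m ℤ) * V.cartan γ = V.cartan (σ γ) * (g : Matrix m m ℤ)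
  map_neg : ∀ γ, σ (P.reflectionPerm γ γ) = P.reflectionPerm (σ γ) (σ γ)

lemma acts_one : V.Acts 1 1 := ⟨fun γ => ⟨1, by simp⟩, fun γ => by simp, fun γ => rfl⟩

lemma Acts.mul {V : AdmissibleLattice P m} {g g' : GL m ℤ} {σ σ' : Equiv.Perm ι}
    (h : V.Acts g σ) (h' : V.Acts g' σ') : V.Acts (g * g') (σ * σ') := by
  refine ⟨fun γ => ?_, fun γ => ?_, fun γ => ?_⟩
  · obtain ⟨ε', hε', h1⟩ := h'.conj_e γ
    obtain ⟨ε, hε, h2⟩ := h.conj_e (σ' γ)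
    refine ⟨ε' * ε, ?_, ?_⟩
    · rcases hε with rfl | rfl <;> rcases hε' with rfl | rfl <;> simp
    · rw [Units.val_mul, mul_assoc, h1, Matrix.mul_smul, ← mul_assoc, h2, Matrix.smul_mul, smul_smul,
        mul_assoc]
      rfl
  · rw [Units.val_mul, mul_assoc, h'.conj_cartan, ← mul_assoc, h.conj_cartan, mul_assoc]
    rfl
  · rw [Equiv.Perm.mul_apply, h'.map_neg, h.map_neg, Equiv.Perm.mul_apply]

lemma acts_w [P.IsReduced] (α : ι) : V.Acts (V.w α (1 : ℤˣ)) (P.reflectionPerm α) := by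
  refine ⟨V.w_conj_e α, fun γ => ?_, reflectionPerm_comm_neg P α⟩
  ext i j
  rw [cartan, cartan, Matrix.mul_diagonal, Matrix.diagonal_mul]
  by_cases h : (V.w α (1 : ℤˣ) : Matrix m m ℤ) i j = 0
  · rw [h, zero_mul, mul_zero]
  · have h1 : V.ht (P.reflectionPerm α γ) i = V.ht γ j := by
      have := LinearMap.congr_fun (P.coroot'_reflectionPerm (i := α) (j := γ))
        (P.reflection α (V.wt j))
      rw [LinearMap.comp_apply, LinearEquiv.coe_coe, P.reflection_same] at this
      rw [ht, V.w_wt α i j h]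
      exact this
    rw [h1, mul_comm]

lemma acts_altProd [P.IsReduced] (α β : ι) (n : ℕ) :
    V.Acts (altProd (V.w α (1 : ℤˣ)) (V.w β 1) n)
      (altProd (P.reflectionPerm α) (P.reflectionPerm β) n) := by
  induction n generalizing α β with
  | zero => exact V.acts_one
  | succ n ih => exact (V.acts_w α).mul (ih β α)

/-- The signs at γ and -γ agree because `g` carries [e_γ, e_{-γ}], the coroot, to a nonzero coroot
without a sign. So the three factors of `w` are rescaled consistently. -/
lemma Acts.mul_w {V : AdmissibleLattice P m} {g : GL m ℤ} {σ : Equiv.Perm ι} (h : V.Acts g σ)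
    (γ : ι) : ∃ ε : ℤˣ, g * V.w γ 1 = V.w (σ γ) ε * g := by
  obtain ⟨ε, hε, h1⟩ := h.conj_e γ
  obtain ⟨ε', hε', h2⟩ := h.conj_e (P.reflectionPerm γ γ)
  rw [h.map_neg] at h2
  have h3 : ε' = ε := by
    have h4 : (g : Matrix m m ℤ) * V.cartan γ =
        (ε * ε') • (V.cartan (σ γ) * (g : Matrix m m ℤ)) := by
      rw [← e_bracket_neg, ← e_bracket_neg, mul_sub, sub_mul, ← mul_assoc, ← mul_assoc, h1, h2,
        Matrix.smul_mul, Matrix.smul_mul, mul_assoc _ _ (V.e γ), mul_assoc _ _ (V.e (P.reflectionPerm γ γ)),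
        h1, h2, Matrix.mul_smul, Matrix.mul_smul, smul_smul, smul_smul, smul_sub, mul_assoc, mul_assoc, mul_comm ε' ε]
    rw [h.conj_cartan] at h4
    have h5 : V.cartan (σ γ) = (ε * ε') • V.cartan (σ γ) := by
      have h6 := congrArg (· * (((g⁻¹ : GL m ℤ)) : Matrix m m ℤ)) h4
      simpa only [Matrix.smul_mul, mul_assoc, ← Units.val_mul, mul_inv_cancel, Units.val_one,
        mul_one] using h6
    by_contra hne
    apply V.cartan_ne_zero (σ γ)
    have h7 : ε * ε' = -1 := by
      rcases hε with rfl | rfl <;> rcases hε' with rfl | rfl <;> simp at hne ⊢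
    rw [h7] at h5
    ext i j
    have := congrFun (congrFun h5 i) j
    simp only [Matrix.smul_apply, smul_eq_mul] at this
    simp only [Matrix.zero_apply]
    omega
  subst h3
  have hid : ∀ g : GL m ℤ, Matrix.GeneralLinearGroup.map (Int.castRingHom ℤ) g = g := by
    intro g
    ext i j
    simp
  have h5 := V.conj_x_of_conj_e (R := ℤ) g γ (σ γ) ε' h1
  have h6 := V.conj_x_of_conj_e (R := ℤ) g _ _ ε' h2
  simp only [hid, Int.cast_id] at h5 h6
  have h7 : ∃ u : ℤˣ, (u : ℤ) = ε' ∧ u⁻¹ = u := by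
    rcases hε with rfl | rfl
    · exact ⟨1, rfl, rfl⟩
    · exact ⟨-1, rfl, rfl⟩
  obtain ⟨u, rfl, hu⟩ := h7
  refine ⟨u, ?_⟩
  rw [w, w, ← mul_assoc, ← mul_assoc, h5, mul_assoc _ g, h6, ← mul_assoc, mul_assoc _ g, h5, hu]
  simp [mul_assoc]

/-- An elementwise criterion for two root subgroups to commute. -/
lemma x_commute [P.IsReduced] (α β : ι) (h : LinearIndependent ℤ ![P.root α, P.root β])
    (hn : ∀ i j : ℤ, 1 ≤ i → 1 ≤ j → comb P α β i j ∉ Set.range P.root) (a b : R) :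
    Commute (V.x α a) (V.x β b) := by
  have h1 := V.commutator_mem α β h a b
  have h2 : V.commSubgroup R α β = ⊥ := by
    rw [commSubgroup, Subgroup.closure_eq_bot_iff]
    rintro g ⟨γ, i, j, a, hi, hj, hγ, -⟩
    exact absurd ⟨γ, hγ⟩ (hn i j hi hj)
  rw [h2, Subgroup.mem_bot, mul_inv_eq_one, mul_inv_eq_iff_eq_mul] at h1
  exact h1

/-- For orthogonal simple roots, reflecting a root iα + jβ with i, j ≠ 0 flips only the sign of i,
against the sign condition. Hence there are no such roots and all root subgroups involved commute.
-/
lemma w_commute [P.IsReduced] {α β : ι} {n : ℕ} (h : IsSimplePair (P := P) α β n)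
    (hp : P.pairing β α = 0) (r s : Rˣ) : Commute (V.w α r) (V.w β s) := by
  have hn : ∀ i j : ℤ, i ≠ 0 → j ≠ 0 → comb P α β i j ∉ Set.range P.root := by
    rintro i j hi hj ⟨γ, hγ⟩
    have h1 := h.sign _ _ ⟨γ, hγ⟩
    have h2 := h.sign _ _ ⟨_, root_reflectionPerm_comb hγ⟩
    rw [hp] at h2
    omega
  have hli := h.linearIndependent
  have key : ∀ s t : ℤ, (s = 1 ∨ s = -1) → (t = 1 ∨ t = -1) → ∀ γ δ : ι,
      P.root γ = s • P.root α → P.root δ = t • P.root β → ∀ a b : R,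
      Commute (V.x γ a) (V.x δ b) := by
    intro s t hs ht γ δ hγ hδ a b
    apply V.x_commute
    · rw [LinearIndependent.pair_iff]
      intro u v huv
      rw [hγ, hδ, smul_smul, smul_smul] at huv
      have := LinearIndependent.pair_iff.mp hli _ _ huv
      rcases hs with rfl | rfl <;> rcases ht with rfl | rfl <;> omega
    · intro i j hi hj
      have h1 : comb P γ δ i j = comb P α β (i * s) (j * t) := by
        rw [comb, hγ, hδ, smul_smul, smul_smul, comb]
      rw [h1]
      apply hn
      · rcases hs with rfl | rfl <;> omega
      · rcases ht with rfl | rfl <;> omega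
  have h1 : P.root α = (1 : ℤ) • P.root α := (one_smul _ _).symm
  have h2 : P.root (P.reflectionPerm α α) = (-1 : ℤ) • P.root α := by rw [root_neg_idx, neg_one_smul]
  have h3 : P.root β = (1 : ℤ) • P.root β := (one_smul _ _).symm
  have h4 : P.root (P.reflectionPerm β β) = (-1 : ℤ) • P.root β := by rw [root_neg_idx, neg_one_smul]
  have k1 := key 1 1 (by simp) (by simp) α β h1 h3
  have k2 := key 1 (-1) (by simp) (by simp) α _ h1 h4
  have k3 := key (-1) 1 (by simp) (by simp) _ β h2 h3
  have k4 := key (-1) (-1) (by simp) (by simp) _ _ h2 h4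
  unfold w
  exact ((k1 _ _ |>.mul_right (k2 _ _) |>.mul_right (k1 _ _)).mul_left
    (k3 _ _ |>.mul_right (k4 _ _) |>.mul_right (k3 _ _))).mul_left
    (k1 _ _ |>.mul_right (k2 _ _) |>.mul_right (k1 _ _))

/-- The first n - 1 letters of the word β α ⋯ carry the simple root of the last letter to α. Moving
the last letter to the front therefore turns it into w_α(±1), and w_α(-1) = α^∨(-1) w_α(1). -/
lemma exists_altProd_w_eq [P.IsReduced] {α β : ι} {n : ℕ} (h : IsSimplePair (P := P) α β n) :
    altProd (V.w β (1 : ℤˣ)) (V.w α 1) n = altProd (V.w α (1 : ℤˣ)) (V.w β 1) n ∨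
    altProd (V.w β (1 : ℤˣ)) (V.w α 1) n =
      V.coch α (-1) * altProd (V.w α (1 : ℤˣ)) (V.w β 1) n := by
  obtain ⟨k, rfl⟩ : ∃ k, n = k + 1 := ⟨n - 1, by have := h.isCartanPair.two_le; omega⟩
  obtain ⟨ε, hε⟩ := (V.acts_altProd β α k).mul_w (altLetter β α k)
  rw [h.symm.altProd_reflectionPerm_altLetter rfl] at hε
  have h1 : altProd (V.w β (1 : ℤˣ)) (V.w α 1) (k + 1) =
      V.w α ε * altProd (V.w β 1) (V.w α (1 : ℤˣ)) k := by
    rw [altProd_succ_right, ← hε, altLetter_map (fun γ => V.w γ (1 : ℤˣ))]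
  rw [h1, altProd]
  rcases Int.units_eq_one_or ε with rfl | rfl
  · left
    rfl
  · right
    rw [V.w_eq α (-1), wR_eq, mul_assoc]

/-- If the words differed, the previous lemma in both directions would give α^∨(-1) β^∨(-1) = 1, so
α^∨ + β^∨ would be even on X. Evaluating at α and β makes both off-diagonal pairings even, hence
zero; but then the letters commute. -/
lemma altProd_w_int [P.IsReduced] {α β : ι} {n : ℕ} (h : IsSimplePair (P := P) α β n) :
    altProd (V.w α (1 : ℤˣ)) (V.w β 1) n = altProd (V.w β (1 : ℤˣ)) (V.w α 1) n := by
  by_contra hne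
  have h1 := (V.exists_altProd_w_eq h).resolve_left (fun h => hne h.symm)
  have h2 := (V.exists_altProd_w_eq h.symm).resolve_left hne
  rw [h1, ← mul_assoc] at h2
  have h3 := right_eq_mul.mp h2
  have h4 : ∀ i, Even (V.ht β i + V.ht α i) := by
    intro i
    have h5 := congrArg (fun g : GL m ℤ => (g : Matrix m m ℤ) i i) h3
    simp only [coch, diag_mul, diag_coe, Matrix.diagonal_apply_eq] at h5
    have h6 : ((-1 : ℤˣ)) ^ (V.ht β i + V.ht α i) = 1 := by
      rw [zpow_add]
      exact Units.ext (by simpa using h5)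
    by_contra h7
    rw [Int.not_even_iff_odd] at h7
    rw [h7.neg_one_zpow] at h6
    exact absurd h6 (by decide)
  have h5 : ∀ x : X, Even (P.toLinearMap x (P.coroot β) + P.toLinearMap x (P.coroot α)) := by
    intro x
    have hx : x ∈ AddSubgroup.closure (Set.range V.wt) := by rw [V.span_wt]; trivial
    induction hx using AddSubgroup.closure_induction with
    | mem x hx =>
      obtain ⟨i, rfl⟩ := hx
      exact h4 i
    | zero => simp
    | add x y _ _ hx hy =>
      rw [map_add, LinearMap.add_apply, LinearMap.add_apply, add_add_add_comm]
      exact hx.add hy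
    | neg x _ hx =>
      rw [map_neg, LinearMap.neg_apply, LinearMap.neg_apply, ← neg_add]
      exact hx.neg
  have h6 := h5 (P.root α)
  have h7 := h5 (P.root β)
  rw [P.root_coroot_two, P.root_coroot_eq_pairing] at h6 h7
  have h8 : P.pairing β α = 0 ∧ n = 2 := by
    rw [Int.even_iff] at h6 h7
    rcases h.isCartanPair with h | h | h | h | h | h <;> omega
  obtain ⟨h9, rfl⟩ := h8
  have := V.w_commute h h9 (1 : ℤˣ) 1
  apply hne
  simpa [altProd] using this.eq

lemma map_w (f : ℤ →+* R) (α : ι) : Matrix.GeneralLinearGroup.map f (V.w α 1) = V.w α 1 := by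
  simp [w, map_x]

/-- The element of the torus that rescales the root vectors of two simple roots. -/
lemma exists_diag_conj [P.IsReduced] {α β : ι} {n : ℕ} (h : IsSimplePair (P := P) α β n) (c : Rˣ) :
    ∃ D : GL m R, ∀ r s : Rˣ, D * V.w α r = V.w α (c * r) * D ∧ D * V.w β s = V.w β s * D := by
  obtain ⟨A, hα, hβ⟩ : ∃ A : m → ℤ, (∀ i j, V.wt i = V.wt j + P.root α → A i = A j + 1) ∧
      (∀ i j, V.wt i = V.wt j + P.root β → A i = A j) := by
    set p := P.pairing β α
    set p' := P.pairing α β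
    -- This is the fundamental coweight of α in the rank two system, from inverting the Cartan
    -- matrix. The numerator grows by exactly 4 - p p' under α and by 0 under β, so rounding the
    -- quotient is harmless.
    refine ⟨fun i => (2 * V.ht α i - p * V.ht β i) / (4 - p * p'), fun i j hij => ?_,
      fun i j hij => ?_⟩
    · have h1 := V.ht_of_wt_eq α α i j hij
      have h2 := V.ht_of_wt_eq β α i j hij
      rw [P.pairing_same] at h1
      have h3 : 4 - p * p' ≠ 0 := by
        rcases h.isCartanPair with h | h | h | h | h | h <;>
          simp only [p, p', h.1, h.2.1] <;> norm_num
      have h4 : 2 * V.ht α i - p * V.ht β i =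
          2 * V.ht α j - p * V.ht β j + 1 * (4 - p * p') := by
        rw [h1, h2]
        ring
      simp only [h4]
      rw [Int.add_mul_ediv_right _ _ h3]
    · have h1 := V.ht_of_wt_eq α β i j hij
      have h2 := V.ht_of_wt_eq β β i j hij
      rw [P.pairing_same] at h2
      simp only [h1, h2]
      congr 1
      ring
  have hα' : ∀ i j, V.wt i = V.wt j + P.root (P.reflectionPerm α α) → A i = A j - 1 := by
    intro i j hij
    rw [root_neg_idx] at hij
    have := hα j i (by rw [hij]; abel)
    omega
  have hβ' : ∀ i j, V.wt i = V.wt j + P.root (P.reflectionPerm β β) → A i = A j := by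
    intro i j hij
    rw [root_neg_idx] at hij
    exact (hβ j i (by rw [hij]; abel)).symm
  have k1 := V.diag_mul_x (fun i => c ^ A i) α c (fun i j hij => by
    rw [hα i j hij, zpow_add_one, mul_comm])
  have k2 := V.diag_mul_x (fun i => c ^ A i) _ c⁻¹ (fun i j hij => by
    rw [hα' i j hij, zpow_sub_one, mul_comm])
  have k3 := V.diag_mul_x (fun i => c ^ A i) β 1 (fun i j hij => by
    rw [hβ i j hij, one_mul])
  have k4 := V.diag_mul_x (fun i => c ^ A i) _ 1 (fun i j hij => by
    rw [hβ' i j hij, one_mul])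
  simp only [Units.val_one, one_mul] at k3 k4
  refine ⟨diag fun i => c ^ A i, fun r s => ⟨?_, ?_⟩⟩
  · rw [w, w, ← mul_assoc, ← mul_assoc, k1, mul_assoc _ (diag _), k2, ← mul_assoc,
      mul_assoc _ (diag _), k1, ← mul_assoc, mul_inv]
    simp
  · rw [w, ← mul_assoc, ← mul_assoc, k3, mul_assoc _ (diag _), k4, ← mul_assoc,
      mul_assoc _ (diag _), k3, ← mul_assoc]

lemma altProd_conj {G : Type*} [Group G] (D a b a' b' : G) (ha : D * a = a' * D)
    (hb : D * b = b' * D) (n : ℕ) : D * altProd a b n = altProd a' b' n * D := by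
  induction n generalizing a b a' b' with
  | zero => simp [altProd]
  | succ n ih => rw [altProd, altProd, ← mul_assoc, ha, mul_assoc, ih b a b' a' hb ha, mul_assoc]

theorem altProd_w [P.IsReduced] {α β : ι} {n : ℕ} (h : IsSimplePair (P := P) α β n) (r s : Rˣ) :
    altProd (V.w α r) (V.w β s) n = altProd (V.w β s) (V.w α r) n := by
  have h0 : altProd (V.w α (1 : Rˣ)) (V.w β 1) n = altProd (V.w β (1 : Rˣ)) (V.w α 1) n := by
    have := congrArg (Matrix.GeneralLinearGroup.map (Int.castRingHom R)) (V.altProd_w_int h)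
    rwa [map_altProd, map_altProd, map_w, map_w] at this
  -- Conjugation by `D` changes the first parameter from 1 to r, and then conjugation by `D'`
  -- changes the second from 1 to s.
  obtain ⟨D, hD⟩ := V.exists_diag_conj h r
  obtain ⟨D', hD'⟩ := V.exists_diag_conj h.symm s
  obtain ⟨h1, -⟩ := hD 1 1
  obtain ⟨-, h2⟩ := hD 1 1
  obtain ⟨h3, -⟩ := hD' 1 1
  obtain ⟨-, h4⟩ := hD' 1 r
  rw [mul_one] at h1 h3
  have e1 := altProd_conj D _ _ _ _ h1 h2 n
  have e2 := altProd_conj D _ _ _ _ h2 h1 n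
  rw [h0, e2] at e1
  have e3 := mul_right_cancel e1
  have e4 := altProd_conj D' _ _ _ _ h4 h3 n
  have e5 := altProd_conj D' _ _ _ _ h3 h4 n
  rw [e3, e4] at e5
  exact mul_right_cancel e5

end AdmissibleLattice
end SplitGroup

namespace SplitGroup
namespace AdmissibleLattice

variable {ι X Y : Type*} [Finite ι] [AddCommGroup X] [AddCommGroup Y]
  {P : RootDatum ι X Y} {m : Type*} [Fintype m] [DecidableEq m] (V : AdmissibleLattice P m)
  {R : Type*} [CommRing R]

/-! ### Relations with the torus -/

lemma coch_mul_x (α β : ι) (t : Rˣ) (a : R) :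
    V.coch α t * V.x β a = V.x β ((t ^ P.pairing β α : Rˣ) * a) * V.coch α t :=
  V.diag_mul_x _ _ _ (fun i j hij => by rw [V.ht_of_wt_eq α β i j hij, zpow_add, mul_comm]) a

lemma coch_commute (α β : ι) (t u : Rˣ) : Commute (V.coch α t) (V.coch β u) := by
  rw [Commute, SemiconjBy, coch, coch, diag_mul, diag_mul, mul_comm]

lemma coch_one (α : ι) : V.coch α (1 : Rˣ) = 1 := by
  rw [coch, ← diag_one]
  congr 1
  funext i
  simp

lemma coch_inv (α : ι) (t : Rˣ) : (V.coch α t)⁻¹ = V.coch α t⁻¹ := by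
  rw [inv_eq_iff_mul_eq_one, ← coch_mul, mul_inv_cancel, coch_one]

lemma coch_neg (α : ι) (t : Rˣ) : V.coch (P.reflectionPerm α α) t = V.coch α t⁻¹ := by
  simp only [coch, ht_neg, inv_zpow', zpow_neg]

variable [P.IsReduced]

lemma wR_mul_coch (α β : ι) (t : Rˣ) :
    V.wR R α * V.coch β t = V.coch (P.reflectionPerm α β) t * V.wR R α := by
  apply Units.ext
  ext i j
  rw [Units.val_mul, Units.val_mul, coch, coch, diag_coe, diag_coe, Matrix.mul_diagonal,
    Matrix.diagonal_mul]
  have h := congrFun (congrFun ((V.acts_w α).conj_cartan β) i) j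
  rw [cartan, cartan, Matrix.mul_diagonal, Matrix.diagonal_mul] at h
  by_cases h0 : (V.w α (1 : ℤˣ) : Matrix m m ℤ) i j = 0
  · have : (V.wR R α : Matrix m m R) i j = 0 := by
      change Int.castRingHom R ((V.w α (1 : ℤˣ) : Matrix m m ℤ) i j) = 0
      rw [h0, map_zero]
    rw [this, zero_mul, mul_zero]
  · rw [mul_comm] at h
    rw [mul_right_cancel₀ h0 h, mul_comm]

lemma w_mul_coch (α β : ι) (r t : Rˣ) :
    V.w α r * V.coch β t = V.coch (P.reflectionPerm α β) t * V.w α r := by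
  rw [w_eq, mul_assoc, wR_mul_coch, ← mul_assoc, (V.coch_commute _ _ _ _).eq, mul_assoc]

lemma w_mul_x (α β : ι) (r : Rˣ) : ∃ u : Rˣ, ∀ a : R,
    V.w α r * V.x β a = V.x (P.reflectionPerm α β) (u * a) * V.w α r := by
  obtain ⟨ε, hε, h⟩ := V.w_conj_e α β
  have hu : ∃ u : Rˣ, (u : R) = ε := by
    rcases hε with rfl | rfl
    · exact ⟨1, by simp⟩
    · exact ⟨-1, by simp⟩
  obtain ⟨u, hu⟩ := hu
  refine ⟨r ^ P.pairing (P.reflectionPerm α β) α * u, fun a => ?_⟩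
  have h1 := V.conj_x_of_conj_e (R := R) (V.w α 1) β _ ε h a
  rw [w_eq, mul_assoc, wR, h1, ← mul_assoc, coch_mul_x, Units.val_mul, hu, mul_assoc, mul_assoc]

lemma w_mul_self (α : ι) (r : Rˣ) : V.w α r * V.w α r = V.coch α (-1) := by
  have h : V.w α (-r) = V.coch α (-1) * V.w α r := by
    rw [w_eq, V.w_eq α r, ← mul_assoc, ← coch_mul, neg_one_mul]
  have h1 := V.w_inv α r
  rw [h, inv_eq_iff_mul_eq_one, ← mul_assoc, w_mul_coch, mul_assoc, coch_neg] at h1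
  rw [eq_inv_of_mul_eq_one_right h1, coch_inv, inv_inv]

/-- The rank one relation that gives the quadratic relation in the Hecke algebra. -/
lemma w_mul_x_mul_w (α : ι) (r a : Rˣ) : V.w α r * V.x α (a : R) * V.w α r =
    V.x α (-(r * r * a⁻¹ : Rˣ) : R) * V.coch α (-(r * a⁻¹)) * V.w α r *
      V.x α (-(r * r * a⁻¹ : Rˣ) : R) := by
  -- The definition of w_α(b) solved for its middle factor: the Bruhat decomposition of a lower
  -- unitriangular matrix in SL₂. It is used with b = r²/a.
  have hneg : ∀ b : Rˣ, V.x (P.reflectionPerm α α) (-(b⁻¹ : Rˣ) : R) =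
      V.x α (-b : R) * V.w α b * V.x α (-b : R) := by
    intro b
    rw [w, V.x_neg α (b : R)]
    group
  have h1 : V.w α r * V.x α (a : R) =
      V.x (P.reflectionPerm α α) (-((r * r * a⁻¹ : Rˣ)⁻¹ : Rˣ) : R) * V.w α r := by
    have h := V.w_mul_e α (1 : ℤˣ)
    rw [toR_int, toR_int] at h
    have h1 := V.conj_x_of_conj_e (R := R) (V.w α 1) α (P.reflectionPerm α α) (-1)
      (by simpa using h) a
    rw [w_eq, mul_assoc, wR, h1, ← mul_assoc, coch_mul_x, P.pairing_reflectionPerm_self_left,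
      P.pairing_same, mul_assoc]
    congr 2
    push_cast
    rw [neg_one_mul, mul_neg]
    congr 1
    rw [← Units.val_mul]
    congr 1
    simp only [mul_inv, inv_inv, zpow_neg]
    rw [zpow_two, mul_inv]
  have h2 : V.w α (r * r * a⁻¹) = V.coch α (r * a⁻¹) * V.w α r := by
    rw [w_eq, V.w_eq α r, ← mul_assoc, ← coch_mul]
    congr 2
    rw [mul_assoc, mul_comm]
  have h3 : ∀ b : R, V.coch α (-1) * V.x α b = V.x α b * V.coch α (-1) := by
    intro b
    rw [coch_mul_x, P.pairing_same]
    simp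
  have h4 : V.w α r * V.coch α (-1) = V.coch α (-1) * V.w α r := by
    rw [w_mul_coch, coch_neg]
    simp
  rw [h1, mul_assoc, w_mul_self, hneg, h2, mul_assoc _ (V.x α _) (V.coch α (-1)), ← h3,
    mul_assoc, ← mul_assoc _ (V.coch α (-1)), mul_assoc _ (V.w α r), h4, ← mul_assoc (V.coch α _),
    ← coch_mul, mul_neg_one]
  simp only [mul_assoc]

end AdmissibleLattice
end SplitGroup

namespace SplitGroup

/-! ### Positive roots -/

section PosCone

variable {ι X Y : Type*} [Finite ι] [AddCommGroup X] [AddCommGroup Y] {P : RootDatum ι X Y}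
  (b : P.Base)

/-- The submonoid generated by the simple roots. -/
def posCone : AddSubmonoid X := AddSubmonoid.closure (P.root '' b.support)

variable {b}

lemma exists_sum_of_mem_posCone {x : X} (hx : x ∈ posCone b) :
    ∃ f : ι → ℕ, x = ∑ j ∈ b.support, f j • P.root j := by
  classical
  induction hx using AddSubmonoid.closure_induction with
  | mem x hx =>
    obtain ⟨i, hi, rfl⟩ := hx
    exact ⟨Pi.single i 1, by simp [Pi.single_apply, ite_smul, Finset.mem_coe.mp hi]⟩
  | zero => exact ⟨0, by simp⟩
  | add x y _ _ hx hy =>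
    obtain ⟨f, rfl⟩ := hx
    obtain ⟨g, rfl⟩ := hy
    exact ⟨f + g, by simp [add_smul, Finset.sum_add_distrib]⟩

lemma eq_zero_of_mem_posCone {x y : X} (hx : x ∈ posCone b) (hy : y ∈ posCone b)
    (h : x + y = 0) : x = 0 := by
  obtain ⟨f, rfl⟩ := exists_sum_of_mem_posCone hx
  obtain ⟨g, rfl⟩ := exists_sum_of_mem_posCone hy
  have h1 : ∑ j ∈ b.support, ((f j + g j : ℕ) : ℤ) • P.root j = 0 := by
    rw [← h, ← Finset.sum_add_distrib]
    refine Finset.sum_congr rfl fun j _ => ?_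
    rw [natCast_zsmul, add_smul]
  have h2 := linearIndepOn_finset_iff.mp b.linearIndepOn_root _ h1
  refine Finset.sum_eq_zero fun j hj => ?_
  have h3 := h2 j hj
  have h4 : f j = 0 := by omega
  rw [h4, zero_smul]

lemma isPos_of_mem_posCone {α : ι} (h : P.root α ∈ posCone b) : b.IsPos α := by
  obtain ⟨f, hf⟩ := exists_sum_of_mem_posCone h
  have h1 : P.root α = ∑ j ∈ b.support, ((f j : ℕ) : ℤ) • P.root j := by
    rw [hf]
    exact Finset.sum_congr rfl fun j _ => (natCast_zsmul _ _).symm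
  rw [RootPairing.Base.isPos_iff', RootPairing.Base.height_eq_sum h1]
  positivity

lemma mem_posCone_iff {α : ι} : P.root α ∈ posCone b ↔ b.IsPos α := by
  refine ⟨isPos_of_mem_posCone, fun h => ?_⟩
  rcases b.root_mem_or_neg_mem α with h1 | h1
  · exact h1
  · rw [← AdmissibleLattice.root_neg_idx] at h1
    have := isPos_of_mem_posCone h1
    exact absurd h ((RootPairing.Base.IsPos.neg_iff_not b α).mp this)

lemma posCone_of_mem_support {α : ι} (h : α ∈ b.support) : P.root α ∈ posCone b :=
  AddSubmonoid.subset_closure ⟨α, h, rfl⟩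

lemma ne_neg_of_mem_posCone {α β : ι} (hα : P.root α ∈ posCone b) (hβ : P.root β ∈ posCone b) :
    β ≠ P.reflectionPerm α α := by
  rintro rfl
  rw [AdmissibleLattice.root_neg_idx] at hβ
  exact P.ne_zero α (eq_zero_of_mem_posCone hα hβ (add_neg_cancel _))

lemma reflectionPerm_mem_posCone [P.IsReduced] {α β : ι} (hα : α ∈ b.support)
    (hβ : P.root β ∈ posCone b) (hne : β ≠ α) :
    P.root (P.reflectionPerm α β) ∈ posCone b ∧ P.reflectionPerm α β ≠ α := by
  constructor
  · rw [mem_posCone_iff] at hβ ⊢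
    exact hβ.reflectionPerm hα hne
  · intro h
    refine ne_neg_of_mem_posCone (posCone_of_mem_support hα) hβ ?_
    rw [← P.reflectionPerm_self α β, h]

end PosCone

namespace AdmissibleLattice

variable {ι X Y : Type*} [Finite ι] [AddCommGroup X] [AddCommGroup Y]
  {P : RootDatum ι X Y} {m : Type*} [Fintype m] [DecidableEq m] (V : AdmissibleLattice P m)
  (b : P.Base) {K : Type*} [Field K] [IsAlgClosed K]

/-! ### The unipotent radical over an algebraically closed field -/

variable {b}

lemma x_mem_geomUnipotent {β : ι} (hβ : P.root β ∈ posCone b) (a : K) :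
    V.x β a ∈ V.geomUnipotent b K := Subgroup.subset_closure ⟨β, hβ, a, rfl⟩

lemma wt_of_mem_geomUnipotent {u : GL m K} (hu : u ∈ V.geomUnipotent b K) (i j : m)
    (h : (u : Matrix m m K) i j ≠ 0) : ∃ x ∈ posCone b, V.wt i = V.wt j + x := by
  have hx : ∀ β : ι, P.root β ∈ posCone b → ∀ (a : K) (i j : m),
      (V.x β a : Matrix m m K) i j ≠ 0 → ∃ x ∈ posCone b, V.wt i = V.wt j + x := by
    intro β hβ a i j h
    obtain ⟨k, hk⟩ := V.x_wt β a i j h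
    exact ⟨_, nsmul_mem hβ k, hk⟩
  induction hu using Subgroup.closure_induction'' generalizing i j with
  | mem _ hu =>
    obtain ⟨β, hβ, a, rfl⟩ := hu
    exact hx β hβ a i j h
  | inv_mem _ hu =>
    obtain ⟨β, hβ, a, rfl⟩ := hu
    rw [← x_neg] at h
    exact hx β hβ _ i j h
  | one =>
    have : i = j := by
      by_contra hij
      exact h (by simp [hij])
    exact ⟨0, zero_mem _, by rw [this, add_zero]⟩
  | mul u v _ _ hu hv =>
    rw [Units.val_mul, Matrix.mul_apply] at h
    obtain ⟨k, -, hk⟩ := Finset.exists_ne_zero_of_sum_ne_zero h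
    obtain ⟨x, hx, h1⟩ := hu i k (left_ne_zero_of_mul hk)
    obtain ⟨y, hy, h2⟩ := hv k j (right_ne_zero_of_mul hk)
    exact ⟨y + x, add_mem hy hx, by rw [h1, h2, add_assoc]⟩

lemma x_apply_of_wt (α : ι) (a : K) (i j : m) (n : ℕ)
    (h : V.wt i = V.wt j + n • P.root α) :
    (V.x α a : Matrix m m K) i j = a ^ n * (V.divPow α n i j : ℤ) := by
  rw [x_coe, expMat, Matrix.sum_apply]
  have h1 : ∀ k, V.divPow α k i j ≠ 0 → k = n := by
    intro k hk
    have h2 := V.divPow_wt α k i j hk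
    rw [h, add_right_inj, ← natCast_zsmul, ← natCast_zsmul] at h2
    exact_mod_cast (zsmul_root_injective P α h2).symm
  by_cases hn : n < Fintype.card m
  · rw [Finset.sum_eq_single n]
    · simp
    · intro k _ hk
      have : V.divPow α k i j = 0 := by
        by_contra h2
        exact hk (h1 k h2)
      simp [this]
    · intro h2
      exact absurd (Finset.mem_range.mpr hn) h2
  · rw [V.divPow_eq_zero α n (by omega)]
    simp only [Matrix.zero_apply, Int.cast_zero, mul_zero]
    refine Finset.sum_eq_zero fun k hk => ?_
    have : V.divPow α k i j = 0 := by
      by_contra h2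
      have := h1 k h2
      rw [Finset.mem_range] at hk
      omega
    simp [this]

/-- If x_α were trivial, so would be x_{-α}, then all w_α(r), then all α^∨(r). Then r^h = 1 for
every height h and every r ≠ 0, so that h = 0 because `K` is infinite, against the coroot being
nonzero. -/
lemma exists_x_ne_one [P.IsReduced] (α : ι) : ∃ a : K, V.x α a ≠ 1 := by
  by_contra! h
  have h1 : ∀ a : K, V.x (P.reflectionPerm α α) a = 1 := by
    intro a
    obtain ⟨u, hu⟩ := V.w_mul_x (R := K) α α 1
    have := hu (u⁻¹ * a)
    rw [h, mul_one, ← mul_assoc, Units.mul_inv, one_mul, right_eq_mul] at this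
    exact this
  have h2 : ∀ r : Kˣ, V.coch α r = 1 := by
    intro r
    have h3 : ∀ r : Kˣ, V.w α r = 1 := fun r => by simp [w, h, h1]
    have h4 := V.w_eq α r
    rw [wR_eq, h3, h3, mul_one] at h4
    exact h4.symm
  apply V.cartan_ne_zero α
  ext i j
  by_cases hij : i = j
  swap
  · simp [cartan, hij]
  subst hij
  simp only [cartan, Matrix.diagonal_apply_eq, Matrix.zero_apply]
  by_contra h3
  have h4 : ∀ r : K, r ^ (V.ht α i).natAbs * r = r := by
    intro r
    by_cases hr : r = 0
    · simp [hr]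
    have h5 := congrArg (fun g : GL m K => (g : Matrix m m K) i i) (h2 (Units.mk0 r hr))
    simp only [coch, diag_coe, Matrix.diagonal_apply_eq, Units.val_one, Matrix.one_apply_eq] at h5
    have h6 : (Units.mk0 r hr) ^ (V.ht α i).natAbs = 1 := by
      rcases Int.natAbs_eq (V.ht α i) with h7 | h7
      · rw [← zpow_natCast, ← h7]
        exact Units.ext h5
      · rw [← zpow_natCast, ← inv_inj, ← zpow_neg, ← h7, inv_one]
        exact Units.ext h5
    have h7 := congrArg Units.val h6
    push_cast at h7
    rw [Units.val_mk0] at h7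
    rw [h7, one_mul]
  have h5 : (Polynomial.X : Polynomial K) ^ ((V.ht α i).natAbs + 1) = Polynomial.X := by
    apply Polynomial.funext
    intro r
    simp [pow_succ, h4]
  have h6 := congrArg Polynomial.natDegree h5
  rw [Polynomial.natDegree_X_pow, Polynomial.natDegree_X] at h6
  omega

/-- Elements of U raise weights by sums of simple roots, while the terms of x_{-α}(a) of positive
degree lower them. So these terms vanish, and for a ≠ 0 this would make the whole root subgroup of
-α trivial. -/
lemma eq_zero_of_x_neg_mem [P.IsReduced] {α : ι} (hα : P.root α ∈ posCone b) (a : K)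
    (h : V.x (P.reflectionPerm α α) a ∈ V.geomUnipotent b K) : a = 0 := by
  by_contra ha
  obtain ⟨c, hc⟩ := V.exists_x_ne_one (K := K) (P.reflectionPerm α α)
  apply hc
  apply Units.ext
  rw [x_coe, expMat_eq_sum _ _ _ (Fintype.card m + 1) (by omega), Finset.sum_range_succ',
    Finset.sum_eq_zero]
  · simp [V.divPow_zero, toR]
  intro n _
  ext i j
  simp only [Matrix.smul_apply, Matrix.map_apply, Matrix.zero_apply, smul_eq_mul]
  by_cases h0 : V.divPow (P.reflectionPerm α α) (n + 1) i j = 0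
  · rw [h0, map_zero, mul_zero]
  have h1 := V.divPow_wt _ _ i j h0
  have h2 := V.x_apply_of_wt _ a i j _ h1
  suffices (V.x (P.reflectionPerm α α) a : Matrix m m K) i j = 0 by
    rw [this, eq_comm, mul_eq_zero] at h2
    rw [eq_intCast, h2.resolve_left (pow_ne_zero _ ha), mul_zero]
  by_contra h3
  obtain ⟨x, hx, h4⟩ := V.wt_of_mem_geomUnipotent h i j h3
  rw [h1, add_right_inj, root_neg_idx, smul_neg] at h4
  have h5 := eq_zero_of_mem_posCone (nsmul_mem hα (n + 1)) hx (by rw [← h4, add_neg_cancel])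
  rw [← natCast_zsmul] at h5
  have h6 := zsmul_root_injective P α (a₁ := ((n + 1 : ℕ) : ℤ)) (a₂ := 0) (by simpa using h5)
  omega

variable (b K) in
/-- The subgroup generated by the root subgroups of the positive roots other than `α`. -/
def geomUnipotentCompl (α : ι) : Subgroup (GL m K) :=
  Subgroup.closure {g | ∃ β : ι, P.root β ∈ posCone b ∧ β ≠ α ∧ ∃ a : K, g = V.x β a}

lemma x_mem_geomUnipotentCompl {α β : ι} (hβ : P.root β ∈ posCone b) (hne : β ≠ α) (a : K) :
    V.x β a ∈ V.geomUnipotentCompl b K α := Subgroup.subset_closure ⟨β, hβ, hne, a, rfl⟩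

lemma geomUnipotentCompl_le (α : ι) : V.geomUnipotentCompl b K α ≤ V.geomUnipotent b K := by
  rw [geomUnipotentCompl, Subgroup.closure_le]
  rintro _ ⟨β, hβ, -, a, rfl⟩
  exact V.x_mem_geomUnipotent hβ a

variable [P.IsReduced] {α : ι} (hα : α ∈ b.support)

include hα

/-- The commutator relations only bring in roots iα + jβ with i, j ≥ 1, which are positive and
different from α. Hence U is the product of U_α and this normalized complement. -/
lemma x_conj_mem_geomUnipotentCompl (a : K) {u : GL m K} (hu : u ∈ V.geomUnipotentCompl b K α) :
    V.x α a * u * (V.x α a)⁻¹ ∈ V.geomUnipotentCompl b K α := by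
  induction hu using Subgroup.closure_induction with
  | mem u hu =>
    obtain ⟨β, hβ, hne, c, rfl⟩ := hu
    have hli := linearIndependent_of_ne P α β hne
      (ne_neg_of_mem_posCone (posCone_of_mem_support hα) hβ)
    have h1 := V.commutator_mem α β hli a c
    have h2 : V.commSubgroup K α β ≤ V.geomUnipotentCompl b K α := by
      rw [commSubgroup, Subgroup.closure_le]
      rintro _ ⟨γ, i, j, d, hi, hj, hγ, rfl⟩
      refine V.x_mem_geomUnipotentCompl ?_ ?_ d
      · rw [hγ, comb]
        lift i to ℕ using by omega
        lift j to ℕ using by omega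
        rw [natCast_zsmul, natCast_zsmul]
        exact add_mem (nsmul_mem (posCone_of_mem_support hα) _) (nsmul_mem hβ _)
      · rintro rfl
        have := LinearIndependent.pair_iff.mp hli (i - 1) j (by
          rw [sub_smul, one_smul]
          nth_rw 2 [hγ]
          rw [comb]
          abel)
        omega
    have h3 := mul_mem (h2 h1) (V.x_mem_geomUnipotentCompl hβ hne c)
    rwa [inv_mul_cancel_right] at h3
  | one => simp
  | mul u v _ _ hu hv =>
    have : V.x α a * (u * v) * (V.x α a)⁻¹ =
      (V.x α a * u * (V.x α a)⁻¹) * (V.x α a * v * (V.x α a)⁻¹) := by group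
    rw [this]
    exact mul_mem hu hv
  | inv u _ hu =>
    have : V.x α a * u⁻¹ * (V.x α a)⁻¹ = (V.x α a * u * (V.x α a)⁻¹)⁻¹ := by group
    rw [this]
    exact inv_mem hu

lemma exists_eq_x_mul {u : GL m K} (hu : u ∈ V.geomUnipotent b K) :
    ∃ a : K, ∃ v ∈ V.geomUnipotentCompl b K α, u = V.x α a * v := by
  induction hu using Subgroup.closure_induction with
  | mem u hu =>
    obtain ⟨β, hβ, c, rfl⟩ := hu
    by_cases h : β = α
    · subst h
      exact ⟨c, 1, one_mem _, by simp⟩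
    · exact ⟨0, _, V.x_mem_geomUnipotentCompl hβ h c, by rw [x_zero, one_mul]⟩
  | one => exact ⟨0, 1, one_mem _, by rw [x_zero, one_mul]⟩
  | mul u v _ _ hu hv =>
    obtain ⟨a, u', hu', rfl⟩ := hu
    obtain ⟨c, v', hv', rfl⟩ := hv
    refine ⟨a + c, _, mul_mem (V.x_conj_mem_geomUnipotentCompl hα (-c) hu') hv', ?_⟩
    rw [x_add, x_neg]
    group
  | inv u _ hu =>
    obtain ⟨a, u', hu', rfl⟩ := hu
    refine ⟨-a, _, V.x_conj_mem_geomUnipotentCompl hα a (inv_mem hu'), ?_⟩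
    rw [x_neg]
    group

lemma w_conj_mem_geomUnipotentCompl (r : Kˣ) {u : GL m K}
    (hu : u ∈ V.geomUnipotentCompl b K α) :
    V.w α r * u * (V.w α r)⁻¹ ∈ V.geomUnipotentCompl b K α := by
  induction hu using Subgroup.closure_induction with
  | mem u hu =>
    obtain ⟨β, hβ, hne, c, rfl⟩ := hu
    obtain ⟨t, ht⟩ := V.w_mul_x (R := K) α β r
    rw [ht, mul_inv_cancel_right]
    have := reflectionPerm_mem_posCone hα hβ hne
    exact V.x_mem_geomUnipotentCompl this.1 this.2 _
  | one => simp
  | mul u v _ _ hu hv =>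
    have : V.w α r * (u * v) * (V.w α r)⁻¹ =
      (V.w α r * u * (V.w α r)⁻¹) * (V.w α r * v * (V.w α r)⁻¹) := by group
    rw [this]
    exact mul_mem hu hv
  | inv u _ hu =>
    have : V.w α r * u⁻¹ * (V.w α r)⁻¹ = (V.w α r * u * (V.w α r)⁻¹)⁻¹ := by group
    rw [this]
    exact inv_mem hu

lemma eq_zero_of_w_conj_x_mem (r : Kˣ) (a : K)
    (h : V.w α r * V.x α a * (V.w α r)⁻¹ ∈ V.geomUnipotent b K) : a = 0 := by
  obtain ⟨t, ht⟩ := V.w_mul_x (R := K) α α r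
  rw [ht, mul_inv_cancel_right] at h
  have := V.eq_zero_of_x_neg_mem (posCone_of_mem_support hα) _ h
  simpa using this

lemma eq_zero_of_x_mem_geomUnipotentCompl (a : K) (h : V.x α a ∈ V.geomUnipotentCompl b K α) :
    a = 0 :=
  V.eq_zero_of_w_conj_x_mem hα 1 a
    (V.geomUnipotentCompl_le α (V.w_conj_mem_geomUnipotentCompl hα 1 h))

end AdmissibleLattice
end SplitGroup

namespace SplitGroup
namespace AdmissibleLattice

variable {ι X Y : Type*} [Finite ι] [AddCommGroup X] [AddCommGroup Y]
  {P : RootDatum ι X Y} {m : Type*} [Fintype m] [DecidableEq m] (V : AdmissibleLattice P m)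
  {b : P.Base} {F : Type*} [Field F]

/-! ### Rational points -/

lemma map_coch {R S : Type*} [CommRing R] [CommRing S] (f : R →+* S) (α : ι) (t : Rˣ) :
    Matrix.GeneralLinearGroup.map f (V.coch α t) = V.coch α (Units.map f t) := by
  apply Units.ext
  ext i j
  change f ((V.coch α t : Matrix m m R) i j) = _
  rw [coch, coch, diag_coe, diag_coe, Matrix.diagonal_apply, Matrix.diagonal_apply]
  split_ifs
  · rw [← map_zpow]
    rfl
  · simp

lemma map_w_units {R S : Type*} [CommRing R] [CommRing S] (f : R →+* S) (α : ι) (t : Rˣ) :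
    Matrix.GeneralLinearGroup.map f (V.w α t) = V.w α (Units.map f t) := by
  rw [w, w, map_mul, map_mul, map_x, map_x, map_neg]
  rfl

lemma coch_mem_G (α : ι) (t : Fˣ) : V.coch α t ∈ V.G F := by
  rw [G, Subgroup.mem_comap, map_coch]
  set K := AlgebraicClosure F
  set t' : Kˣ := Units.map (algebraMap F K) t
  let χ : Multiplicative X →* Kˣ :=
    { toFun := fun x => t' ^ P.toLinearMap x.toAdd (P.coroot α)
      map_one' := by simp
      map_mul' := fun x y => by simp [zpow_add] }
  refine Subgroup.subset_closure (Or.inl ⟨χ, ?_⟩)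
  apply Units.ext
  rw [coch, diag_coe]
  ext i j
  simp [torusElt, χ, Matrix.diagonal_apply, ht]

/-- The value `γ^∨(t)` of a coroot, as an element of `G(F)`. -/
def cochG (γ : ι) (t : Fˣ) : V.G F := ⟨V.coch γ t, V.coch_mem_G γ t⟩

lemma coe_cochG (γ : ι) (t : Fˣ) : (V.cochG γ t : GL m F) = V.coch γ t := rfl

lemma coe_xG (γ : ι) (a : F) : (V.xG γ a : GL m F) = V.x γ a := rfl

lemma coe_rhoAnti (α : ι) (c r : Fˣ) : (V.rhoAnti α c r : GL m F) = V.w α (c * r) := by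
  rw [rhoAnti, w]
  simp only [Subgroup.coe_mul, coe_xG]
  rw [Units.val_mul, Units.val_inv_eq_inv_val, Units.val_mul]

lemma coe_n (α : ι) (c : Fˣ) : (V.n α c : GL m F) = V.w α c := by
  rw [n, coe_rhoAnti, mul_one]

lemma h_eq_cochG (α : ι) (c r : Fˣ) : V.h α c r = V.cochG α r := by
  apply Subtype.ext
  rw [h, Subgroup.coe_mul, Subgroup.coe_inv, coe_rhoAnti, coe_rhoAnti, mul_one, coe_cochG,
    w_eq, V.w_eq α c, mul_comm c r, coch_mul, mul_assoc (V.coch α r), mul_inv_cancel_right]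

lemma mem_U_iff (u : V.G F) : u ∈ V.U b F ↔
    Matrix.GeneralLinearGroup.map (algebraMap F (AlgebraicClosure F)) (u : GL m F) ∈
      V.geomUnipotent b (AlgebraicClosure F) := Iff.rfl

lemma xG_mem_U {β : ι} (hβ : P.root β ∈ posCone b) (a : F) : V.xG β a ∈ V.U b F := by
  rw [mem_U_iff, coe_xG, map_x]
  exact V.x_mem_geomUnipotent hβ _

lemma cochG_conj_mem_U (γ : ι) (t : Fˣ) {u : V.G F} (hu : u ∈ V.U b F) :
    (V.cochG γ t)⁻¹ * u * V.cochG γ t ∈ V.U b F := by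
  rw [mem_U_iff] at *
  simp only [Subgroup.coe_mul, Subgroup.coe_inv, coe_cochG, map_mul, map_inv, map_coch]
  generalize Matrix.GeneralLinearGroup.map (algebraMap F (AlgebraicClosure F)) (u : GL m F) = v
    at hu ⊢
  generalize Units.map (algebraMap F (AlgebraicClosure F) : F →* AlgebraicClosure F) t = s
  rw [coch_inv, ← inv_inv s, ← V.coch_inv γ s⁻¹, inv_inv]
  generalize s⁻¹ = s
  induction hu using Subgroup.closure_induction with
  | mem u hu =>
    obtain ⟨β, hβ, c, rfl⟩ := hu
    rw [coch_mul_x, mul_inv_cancel_right]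
    exact V.x_mem_geomUnipotent hβ _
  | one => simp
  | mul u v _ _ hu hv =>
    have : V.coch γ s * (u * v) * (V.coch γ s)⁻¹ =
      (V.coch γ s * u * (V.coch γ s)⁻¹) * (V.coch γ s * v * (V.coch γ s)⁻¹) := by group
    rw [this]
    exact mul_mem hu hv
  | inv u _ hu =>
    have : V.coch γ s * u⁻¹ * (V.coch γ s)⁻¹ = (V.coch γ s * u * (V.coch γ s)⁻¹)⁻¹ := by group
    rw [this]
    exact inv_mem hu

lemma map_mem_geomUnipotentCompl {K : Type*} [Field K] [IsAlgClosed K] (σ : K →+* K) (α : ι)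
    {u : GL m K} (hu : u ∈ V.geomUnipotentCompl b K α) :
    Matrix.GeneralLinearGroup.map σ u ∈ V.geomUnipotentCompl b K α := by
  have : V.geomUnipotentCompl b K α ≤
      (V.geomUnipotentCompl b K α).comap (Matrix.GeneralLinearGroup.map σ) := by
    conv_lhs => rw [geomUnipotentCompl]
    rw [Subgroup.closure_le]
    rintro _ ⟨β, hβ, hne, c, rfl⟩
    rw [SetLike.mem_coe, Subgroup.mem_comap, map_x]
    exact V.x_mem_geomUnipotentCompl hβ hne _
  exact this hu

lemma cochG_mul_xG (α β : ι) (t : Fˣ) (a : F) :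
    V.cochG α t * V.xG β a = V.xG β ((t ^ P.pairing β α : Fˣ) * a) * V.cochG α t :=
  Subtype.ext (by simp only [Subgroup.coe_mul, coe_xG, coe_cochG, coch_mul_x])

lemma cochG_mul (α : ι) (t s : Fˣ) : V.cochG α (t * s) = V.cochG α t * V.cochG α s :=
  Subtype.ext (V.coch_mul α t s)

lemma cochG_one (α : ι) : V.cochG α (1 : Fˣ) = 1 :=
  Subtype.ext (V.coch_one α)

lemma cochG_commute (α β : ι) (t s : Fˣ) : Commute (V.cochG α t) (V.cochG β s) :=
  Subtype.ext (V.coch_commute α β t s)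

lemma cochG_neg (α : ι) (t : Fˣ) : V.cochG (P.reflectionPerm α α) t = V.cochG α t⁻¹ :=
  Subtype.ext (V.coch_neg α t)

lemma xG_add (α : ι) (a c : F) : V.xG α (a + c) = V.xG α a * V.xG α c :=
  Subtype.ext (V.x_add α a c)

lemma xG_zero (α : ι) : V.xG α (0 : F) = 1 := Subtype.ext (V.x_zero α)

lemma xG_neg (α : ι) (a : F) : V.xG α (-a) = (V.xG α a)⁻¹ := Subtype.ext (V.x_neg α a)

variable [P.IsReduced] {α : ι} (hα : α ∈ b.support)

include hα

lemma exists_eq_xG_mul [Finite F] (c : Fˣ) {u : V.G F} (hu : u ∈ V.U b F) :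
    ∃ a : F, ∃ v ∈ V.U b F, u = V.xG α a * v ∧ (V.n α c)⁻¹ * v * V.n α c ∈ V.U b F := by
  rw [mem_U_iff] at hu
  set K := AlgebraicClosure F
  set f := Matrix.GeneralLinearGroup.map (n := m) (algebraMap F K)
  obtain ⟨a, v, hv, huv⟩ := V.exists_eq_x_mul hα hu
  have : IsGalois F K := ⟨⟩
  -- Galois descent: an automorphism σ fixes the rational point u and preserves the complement, so
  -- x_α(σ a - a) lies in the complement and σ a = a.
  have ha : a ∈ Set.range (algebraMap F K) := by
    rw [InfiniteGalois.mem_range_algebraMap_iff_fixed]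
    intro σ
    have h1 := congrArg (Matrix.GeneralLinearGroup.map (σ : K →+* K)) huv
    have h2 : Matrix.GeneralLinearGroup.map (σ : K →+* K) (f (u : GL m F)) = f (u : GL m F) := by
      apply Units.ext
      ext i j
      exact σ.commutes _
    rw [h2, map_mul, map_x] at h1
    have h3 := V.map_mem_geomUnipotentCompl (σ : K →+* K) α hv
    have h4 : V.x α (σ a - a) ∈ V.geomUnipotentCompl b K α := by
      rw [sub_eq_neg_add, x_add, x_neg]
      have h5 : (V.x α a)⁻¹ * V.x α (σ a) =
          v * (Matrix.GeneralLinearGroup.map (σ : K →+* K) v)⁻¹ := by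
        rw [inv_mul_eq_iff_eq_mul, ← mul_assoc, ← huv, h1, RingHom.coe_coe]
        simp
      rw [h5]
      exact mul_mem hv (inv_mem h3)
    exact sub_eq_zero.mp (V.eq_zero_of_x_mem_geomUnipotentCompl hα _ h4)
  obtain ⟨a, rfl⟩ := ha
  have hv' : f ((V.xG α a)⁻¹ * u : V.G F) = v := by
    rw [Subgroup.coe_mul, Subgroup.coe_inv, map_mul, map_inv, huv, coe_xG, map_x,
      inv_mul_cancel_left]
  refine ⟨a, (V.xG α a)⁻¹ * u, ?_, (mul_inv_cancel_left _ _).symm, ?_⟩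
  · rw [mem_U_iff, hv']
    exact V.geomUnipotentCompl_le α hv
  · rw [mem_U_iff, Subgroup.coe_mul, Subgroup.coe_mul, map_mul, map_mul, hv', Subgroup.coe_inv,
      map_inv, coe_n, map_w_units]
    have := V.w_conj_mem_geomUnipotentCompl hα
      (-(Units.map (algebraMap F K : F →* K) c)) hv
    rw [← w_inv, inv_inv] at this
    exact V.geomUnipotentCompl_le α this

lemma eq_zero_of_n_conj_xG_mem (c : Fˣ) (a : F)
    (h : (V.n α c)⁻¹ * V.xG α a * V.n α c ∈ V.U b F) : a = 0 := by
  rw [mem_U_iff] at h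
  simp only [Subgroup.coe_mul, Subgroup.coe_inv, coe_n, map_mul, map_inv, map_w_units, coe_xG,
    map_x] at h
  have := V.eq_zero_of_w_conj_x_mem hα
      (-(Units.map (algebraMap F (AlgebraicClosure F) : F →* AlgebraicClosure F) c)) _
      (by rw [← w_inv, inv_inv]; exact h)
  simpa using this

omit hα

lemma n_mul_xG (α β : ι) (c : Fˣ) : ∃ u : Fˣ, ∀ a : F,
    V.n α c * V.xG β a = V.xG (P.reflectionPerm α β) (u * a) * V.n α c := by
  obtain ⟨u, hu⟩ := V.w_mul_x (R := F) α β c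
  refine ⟨u, fun a => Subtype.ext ?_⟩
  simp only [Subgroup.coe_mul, coe_n, coe_xG, hu]

lemma n_mul_cochG (α β : ι) (c t : Fˣ) :
    V.n α c * V.cochG β t = V.cochG (P.reflectionPerm α β) t * V.n α c :=
  Subtype.ext (by simp only [Subgroup.coe_mul, coe_n, coe_cochG, w_mul_coch])

lemma n_mul_self (α : ι) (c : Fˣ) : V.n α c * V.n α c = V.cochG α (-1) :=
  Subtype.ext (by simp only [Subgroup.coe_mul, coe_n, coe_cochG, w_mul_self])

lemma n_mul_xG_mul_n (α : ι) (c a : Fˣ) : V.n α c * V.xG α (a : F) * V.n α c =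
    V.xG α (-(c * c * a⁻¹ : Fˣ) : F) * V.cochG α (-(c * a⁻¹)) * V.n α c *
      V.xG α (-(c * c * a⁻¹ : Fˣ) : F) :=
  Subtype.ext (by simp only [Subgroup.coe_mul, coe_n, coe_xG, coe_cochG, w_mul_x_mul_w])

open YokonumaHecke in
lemma altProd_n {α β : ι} {k : ℕ} (h : IsSimplePair (P := P) α β k) (c d : Fˣ) :
    altProd (V.n α c) (V.n β d) k = altProd (V.n β d) (V.n α c) k := by
  apply (V.G F).subtype_injective
  rw [map_altProd, map_altProd]
  simp only [Subgroup.subtype_apply, coe_n]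
  exact V.altProd_w h c d

end AdmissibleLattice
end SplitGroup

namespace SplitGroup

/-! ### Alternating products in the opposite monoid -/

section

open YokonumaHecke MulOpposite

lemma altLetter_eq {α : Type*} (a b : α) (n : ℕ) :
    altLetter a b n = if Even n then a else b := by
  induction n generalizing a b with
  | zero => simp [altLetter]
  | succ n ih =>
    rw [altLetter, ih]
    simp only [Nat.even_add_one]
    by_cases h : Even n <;> simp [h]

lemma altProd_op {M : Type*} [Monoid M] (a b : M) (n : ℕ) :
    altProd (op a) (op b) n = if Even n then op (altProd b a n) else op (altProd a b n) := by
  induction n generalizing a b with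
  | zero => simp [altProd]
  | succ n ih =>
    rw [altProd, ih]
    simp only [Nat.even_add_one]
    by_cases h : Even n
    · simp only [h, if_true, not_true_eq_false, if_false]
      rw [altProd_succ_right, ← op_mul, altLetter_eq, if_pos h]
    · simp only [h, if_false, not_false_eq_true, if_true]
      rw [altProd_succ_right, ← op_mul, altLetter_eq, if_neg h]

lemma altProd_op_comm {M : Type*} [Monoid M] {a b : M} {n : ℕ}
    (h : altProd a b n = altProd b a n) :
    altProd (op a) (op b) n = altProd (op b) (op a) n := by
  rw [altProd_op, altProd_op, h]

lemma altProd_inv_comm {G : Type*} [Group G] {a b : G} {n : ℕ}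
    (h : altProd a b n = altProd b a n) : altProd a⁻¹ b⁻¹ n = altProd b⁻¹ a⁻¹ n := by
  have h1 := congrArg (MulEquiv.inv' G) h
  have h2 : ∀ x y : G, MulEquiv.inv' G (altProd x y n) = altProd (op x⁻¹) (op y⁻¹) n :=
    fun x y => map_altProd (MulEquiv.inv' G).toMonoidHom x y n
  rw [h2, h2] at h1
  have h3 := altProd_op_comm h1
  have h4 := congrArg (fun z => unop (unop z)) h3
  have h5 : ∀ x y : G, unop (unop (altProd (op (op x)) (op (op y)) n)) = altProd x y n := by
    intro x y
    have := map_altProd ((MulEquiv.opOp G).toMonoidHom) x y n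
    change unop (unop (altProd ((MulEquiv.opOp G).toMonoidHom x)
      ((MulEquiv.opOp G).toMonoidHom y) n)) = _
    rw [← this]
    rfl
  rwa [h5, h5] at h4

end

namespace AdmissibleLattice

variable {ι X Y : Type*} [Finite ι] [AddCommGroup X] [AddCommGroup Y]
  {P : RootDatum ι X Y} {m : Type*} [Fintype m] [DecidableEq m] (V : AdmissibleLattice P m)
  {F : Type*} [Field F] [Fintype F] {A : Type*} [Ring A] (ρ : V.G F →* A)

/-! ### Sums over root subgroups -/

/-- The sum of the elements of the root subgroup of `γ`, in a ring on which `G(F)` is represented. -/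
def rootSum (γ : ι) : A := ∑ a : F, ρ (V.xG γ a)

lemma xG_mul_rootSum (γ : ι) (a : F) : ρ (V.xG γ a) * V.rootSum ρ γ = V.rootSum ρ γ := by
  rw [rootSum, Finset.mul_sum]
  simp only [← map_mul, ← xG_add]
  exact Fintype.sum_equiv (Equiv.addLeft a) _ _ fun _ => rfl

lemma rootSum_mul_xG (γ : ι) (a : F) : V.rootSum ρ γ * ρ (V.xG γ a) = V.rootSum ρ γ := by
  rw [rootSum, Finset.sum_mul]
  simp only [← map_mul, ← xG_add]
  exact Fintype.sum_equiv (Equiv.addRight a) _ _ fun _ => rfl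

lemma n_mul_rootSum [P.IsReduced] (α γ : ι) (c : Fˣ) : ρ (V.n α c) * V.rootSum ρ γ =
    V.rootSum ρ (P.reflectionPerm α γ) * ρ (V.n α c) := by
  obtain ⟨u, hu⟩ := V.n_mul_xG α γ c
  rw [rootSum, rootSum, Finset.mul_sum, Finset.sum_mul]
  simp only [← map_mul, hu]
  exact Fintype.sum_equiv (Units.mulLeft u) _ _ fun _ => rfl

lemma cochG_mul_rootSum [P.IsReduced] (α γ : ι) (t : Fˣ) : ρ (V.cochG α t) * V.rootSum ρ γ =
    V.rootSum ρ γ * ρ (V.cochG α t) := by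
  rw [rootSum, Finset.mul_sum, Finset.sum_mul]
  simp only [← map_mul, cochG_mul_xG]
  exact Fintype.sum_equiv (Units.mulLeft _) _ _ fun _ => rfl

/-- The subgroup generated by the root subgroups of a list of roots. -/
def listSubgroup (F : Type*) [Field F] (l : List ι) : Subgroup (V.G F) :=
  Subgroup.closure {g | ∃ γ ∈ l, ∃ a : F, g = V.xG γ a}

lemma xG_mem_listSubgroup {l : List ι} {γ : ι} (h : γ ∈ l) (a : F) :
    V.xG γ a ∈ V.listSubgroup F l := Subgroup.subset_closure ⟨γ, h, a, rfl⟩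

lemma commutator_mem_listSubgroup [P.IsReduced] (l : List ι) (γ γ' : ι)
    (hli : LinearIndependent ℤ ![P.root γ, P.root γ'])
    (hl : ∀ δ (i j : ℤ), 1 ≤ i → 1 ≤ j → P.root δ = comb P γ γ' i j → δ ∈ l)
    (a c : F) : V.xG γ a * V.xG γ' c * (V.xG γ a)⁻¹ * (V.xG γ' c)⁻¹ ∈ V.listSubgroup F l := by
  have h1 := V.commutator_mem γ γ' hli a c
  have h2 : V.commSubgroup F γ γ' ≤ (V.listSubgroup F l).map (V.G F).subtype := by
    rw [commSubgroup, Subgroup.closure_le]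
    rintro _ ⟨δ, i, j, d, hi, hj, hδ, rfl⟩
    exact ⟨V.xG δ d, V.xG_mem_listSubgroup (hl δ i j hi hj hδ) d, rfl⟩
  obtain ⟨g, hg, h3⟩ := h2 h1
  have h4 : g = V.xG γ a * V.xG γ' c * (V.xG γ a)⁻¹ * (V.xG γ' c)⁻¹ := Subtype.ext h3
  rwa [← h4]

variable [P.IsReduced] {α β : ι} {k : ℕ} (h : IsSimplePair (P := P) α β k)

include h

lemma conj_mem_listSubgroup {l₁ l₂ : List ι} {γ γ' : ι} (hl : altRoots P α β k = l₁ ++ γ :: l₂)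
    (hγ' : γ' ∈ l₂) (a c : F) :
    V.xG γ a * V.xG γ' c * (V.xG γ a)⁻¹ ∈ V.listSubgroup F l₂ := by
  have h1 := V.commutator_mem_listSubgroup l₂ γ γ' (h.linearIndependent_of_append hl hγ')
    (fun δ i j hi hj hδ => h.mem_of_append hl hγ' (by omega) hj hδ) a c
  have h2 := mul_mem h1 (V.xG_mem_listSubgroup hγ' c)
  rwa [inv_mul_cancel_right] at h2

/-- A root element for the first entry is absorbed by its own sum. One for a later entry is moved
past each term of that sum; its conjugate lies in the group of the tail, whose product absorbs it by
induction. -/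
lemma mul_prod_rootSum (l₁ l₂ : List ι) (hl : altRoots P α β k = l₁ ++ l₂) {g : V.G F}
    (hg : g ∈ V.listSubgroup F l₂) :
    ρ g * (l₂.map (V.rootSum ρ)).prod = (l₂.map (V.rootSum ρ)).prod := by
  induction l₂ generalizing l₁ g with
  | nil =>
    have : g = 1 := by simpa [listSubgroup] using hg
    simp [this]
  | cons γ l₂ ih =>
    have ih' := fun g => ih (g := g) (l₁ ++ [γ]) (by simpa using hl)
    rw [List.map_cons, List.prod_cons]
    induction hg using Subgroup.closure_induction with
    | mem g hg =>
      obtain ⟨γ', hγ', a, rfl⟩ := hg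
      rcases List.mem_cons.mp hγ' with rfl | hγ'
      · rw [← mul_assoc, xG_mul_rootSum]
      · rw [rootSum, Finset.sum_mul, Finset.mul_sum]
        refine Finset.sum_congr rfl fun c _ => ?_
        have h1 := ih' _ (V.conj_mem_listSubgroup h hl hγ' (-c) a)
        nth_rw 2 [← h1]
        rw [xG_neg, ← mul_assoc, ← mul_assoc, ← map_mul, ← map_mul]
        congr 2
        group
    | one => simp
    | mul g g' _ _ hg hg' => rw [map_mul, mul_assoc, hg', hg]
    | inv g _ hg =>
      nth_rw 1 [← hg]
      rw [← mul_assoc, ← map_mul, inv_mul_cancel, map_one, one_mul]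

lemma prod_reverse_rootSum_mul (l₁ l₂ : List ι) (hl : altRoots P α β k = l₁ ++ l₂) {g : V.G F}
    (hg : g ∈ V.listSubgroup F l₂) :
    (l₂.reverse.map (V.rootSum ρ)).prod * ρ g = (l₂.reverse.map (V.rootSum ρ)).prod := by
  induction l₂ generalizing l₁ g with
  | nil =>
    have : g = 1 := by simpa [listSubgroup] using hg
    simp [this]
  | cons γ l₂ ih =>
    have ih' := fun g => ih (g := g) (l₁ ++ [γ]) (by simpa using hl)
    rw [List.reverse_cons, List.map_append, List.prod_append, List.map_singleton,
      List.prod_singleton]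
    induction hg using Subgroup.closure_induction with
    | mem g hg =>
      obtain ⟨γ', hγ', a, rfl⟩ := hg
      rcases List.mem_cons.mp hγ' with rfl | hγ'
      · rw [mul_assoc, rootSum_mul_xG]
      · rw [rootSum, Finset.mul_sum, Finset.sum_mul]
        refine Finset.sum_congr rfl fun c _ => ?_
        have h1 := ih' _ (V.conj_mem_listSubgroup h hl hγ' c a)
        nth_rw 2 [← h1]
        rw [mul_assoc, mul_assoc, ← map_mul, ← map_mul]
        congr 2
        group
    | one => simp
    | mul g g' _ _ hg hg' => rw [map_mul, ← mul_assoc, hg, hg']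
    | inv g _ hg =>
      nth_rw 1 [← hg]
      rw [mul_assoc, ← map_mul, mul_inv_cancel, map_one, mul_one]

/-- The product of the sums over the root subgroups of a system of rank two can be taken in the
opposite order. -/
lemma prod_rootSum_reverse [IsAddTorsionFree A] :
    ((altRoots P α β k).map (V.rootSum ρ)).prod =
      ((altRoots P α β k).reverse.map (V.rootSum ρ)).prod := by
  set l := altRoots P α β k with hl
  set E := (l.map (V.rootSum ρ)).prod with hE
  set E' := (l.reverse.map (V.rootSum ρ)).prod with hE'
  have h1 : ∀ g ∈ V.listSubgroup F l, ρ g * E = E := fun g hg =>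
    V.mul_prod_rootSum ρ h [] l (by simp [hl]) hg
  have h2 : ∀ g ∈ V.listSubgroup F l, E' * ρ g = E' := fun g hg =>
    V.prod_reverse_rootSum_mul ρ h [] l (by simp [hl]) hg
  have h3 : ∀ l' : List ι, (∀ γ ∈ l', γ ∈ l) → (l'.map (V.rootSum ρ)).prod * E =
      (Fintype.card F ^ l'.length : ℕ) • E := by
    intro l' hl'
    induction l' with
    | nil => simp
    | cons γ l' ih =>
      rw [List.map_cons, List.prod_cons, mul_assoc,
        ih fun γ' hγ' => hl' γ' (List.mem_cons_of_mem _ hγ'), mul_smul_comm, rootSum,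
        Finset.sum_mul, Finset.sum_congr rfl fun a _ =>
          h1 _ (V.xG_mem_listSubgroup (hl' γ List.mem_cons_self) a)]
      rw [Finset.sum_const, Finset.card_univ, smul_smul, List.length_cons, pow_succ]
  have h4 : ∀ l' : List ι, (∀ γ ∈ l', γ ∈ l) → E' * (l'.map (V.rootSum ρ)).prod =
      (Fintype.card F ^ l'.length : ℕ) • E' := by
    intro l' hl'
    induction l' with
    | nil => simp
    | cons γ l' ih =>
      have h5 : E' * V.rootSum ρ γ = Fintype.card F • E' := by
        rw [rootSum, Finset.mul_sum, Finset.sum_congr rfl fun a _ =>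
          h2 _ (V.xG_mem_listSubgroup (hl' γ List.mem_cons_self) a),
          Finset.sum_const, Finset.card_univ]
      rw [List.map_cons, List.prod_cons, ← mul_assoc, h5, smul_mul_assoc,
        ih fun γ' hγ' => hl' γ' (List.mem_cons_of_mem _ hγ'), smul_smul, List.length_cons, pow_succ']
  -- The product `E' * E` is evaluated twice: each factor of `E'` acts on `E` as |F|, and each
  -- factor of `E` acts on `E'` as |F|.
  have h5 := h3 l.reverse fun γ hγ => List.mem_reverse.mp hγ
  have h6 := h4 l fun γ hγ => hγ
  rw [h6, List.length_reverse] at h5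
  exact (nsmul_right_injective (pow_ne_zero _ Fintype.card_ne_zero) h5).symm

open YokonumaHecke

omit h in
lemma altProd_rootSum_mul_n (α β : ι) (c d : Fˣ) (j : ℕ) :
    altProd (V.rootSum ρ α * ρ (V.n α c)) (V.rootSum ρ β * ρ (V.n β d)) j =
      ((altRoots P α β j).map (V.rootSum ρ)).prod * ρ (altProd (V.n α c) (V.n β d) j) := by
  have hlist : ∀ (α : ι) (c : Fˣ) (l : List ι), ρ (V.n α c) * (l.map (V.rootSum ρ)).prod =
      ((l.map (P.reflectionPerm α)).map (V.rootSum ρ)).prod * ρ (V.n α c) := by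
    intro α c l
    induction l with
    | nil => simp
    | cons γ l ih =>
      simp only [List.map_cons, List.prod_cons]
      rw [← mul_assoc, n_mul_rootSum, mul_assoc, ih, mul_assoc]
  induction j generalizing α β c d with
  | zero => simp [altProd, altRoots]
  | succ j ih =>
    rw [altProd, ih, altRoots, altProd, map_mul, List.map_cons, List.prod_cons, mul_assoc,
      ← mul_assoc (ρ (V.n α c)), hlist]
    simp only [mul_assoc]

lemma altProd_rootSum_mul_n_comm [IsAddTorsionFree A] (c d : Fˣ) :
    altProd (V.rootSum ρ α * ρ (V.n α c)) (V.rootSum ρ β * ρ (V.n β d)) k =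
      altProd (V.rootSum ρ β * ρ (V.n β d)) (V.rootSum ρ α * ρ (V.n α c)) k := by
  rw [altProd_rootSum_mul_n, altProd_rootSum_mul_n, h.altRoots_reverse, V.prod_rootSum_reverse ρ h,
    V.altProd_n h]

end AdmissibleLattice
end SplitGroup

namespace YokonumaHecke

/-! ### Operators represented by elements of the group algebra -/

section

variable {Γ : Type*} [Group Γ] (U : Subgroup Γ)

/-- `translation` as a representation. -/
def translationHom : Γ →* Module.End ℂ (Γ ⧸ U → ℂ) where
  toFun := translation U
  map_one' := by
    ext1 f
    funext x
    simp [translation, LinearMap.funLeft_apply]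
  map_mul' g h := by
    ext1 f
    funext x
    simp only [translation, Module.End.mul_apply, LinearMap.funLeft_apply, mul_inv_rev, mul_smul]

/-- The action of the group algebra on functions on `Γ ⧸ U`. -/
def act : MonoidAlgebra ℂ Γ →ₐ[ℂ] Module.End ℂ (Γ ⧸ U → ℂ) :=
  MonoidAlgebra.lift ℂ _ Γ (translationHom U)

lemma act_of (g : Γ) : act U (MonoidAlgebra.of ℂ Γ g) = translation U g :=
  MonoidAlgebra.lift_of _ _

open scoped Classical in
/-- The indicator function of the coset of the identity. -/
def basePoint : Γ ⧸ U → ℂ := Pi.single ((1 : Γ) : Γ ⧸ U) 1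

open scoped Classical in
lemma act_of_basePoint (g : Γ) :
    act U (MonoidAlgebra.of ℂ Γ g) (basePoint U) = Pi.single (g : Γ ⧸ U) 1 := by
  rw [act_of]
  funext x
  simp only [translation, LinearMap.funLeft_apply, basePoint, Pi.single_apply]
  have : g⁻¹ • x = ((1 : Γ) : Γ ⧸ U) ↔ x = (g : Γ ⧸ U) := by
    rw [inv_smul_eq_iff]
    simp
  simp only [this]

lemma act_mul_of_mem (y : MonoidAlgebra ℂ Γ) {u : Γ} (hu : u ∈ U) :
    act U (y * MonoidAlgebra.of ℂ Γ u) (basePoint U) = act U y (basePoint U) := by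
  classical
  rw [map_mul, Module.End.mul_apply, act_of_basePoint, QuotientGroup.eq.mpr
    (show u⁻¹ * 1 ∈ U by simpa using hu)]
  rfl

lemma commute_act (T : Y U) (y : MonoidAlgebra ℂ Γ) :
    (T : Module.End ℂ (Γ ⧸ U → ℂ)) * act U y = act U y * T := by
  induction y using MonoidAlgebra.induction_on with
  | of g =>
    rw [act_of]
    exact (Subalgebra.mem_centralizer_iff ℂ |>.mp T.2 _ ⟨g, rfl⟩).symm
  | add x y hx hy => rw [map_add, mul_add, add_mul, hx, hy]
  | smul c x hx => rw [map_smul, mul_smul_comm, smul_mul_assoc, hx]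

/-- The operator `T` maps the indicator function of `gU` to `g • y • δ`, where `δ` is the indicator
function of `U`. -/
def Represents (T : Y U) (y : MonoidAlgebra ℂ Γ) : Prop :=
  (T : Module.End ℂ (Γ ⧸ U → ℂ)) (basePoint U) = act U y (basePoint U)

variable {U}

namespace Represents

/-- The translates of the base point span the functions on Γ/U, and both operators commute with
translations. -/
lemma ext [Finite Γ] {T T' : Y U} {y y' : MonoidAlgebra ℂ Γ} (h : Represents U T y)
    (h' : Represents U T' y') (hy : act U y (basePoint U) = act U y' (basePoint U)) : T = T' := by
  classical
  apply Subtype.ext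
  apply LinearMap.pi_ext
  intro x c
  obtain ⟨g, rfl⟩ := QuotientGroup.mk_surjective x
  have h1 : (Pi.single (g : Γ ⧸ U) c : Γ ⧸ U → ℂ) =
      c • act U (MonoidAlgebra.of ℂ Γ g) (basePoint U) := by
    rw [act_of_basePoint, ← Pi.single_smul, smul_eq_mul, mul_one]
  rw [h1, map_smul, map_smul, ← Module.End.mul_apply, ← Module.End.mul_apply, commute_act,
    commute_act, Module.End.mul_apply, Module.End.mul_apply, h, h', hy]

lemma one : Represents U 1 1 := by simp [Represents]

/-- The order is reversed because T (y' δ) = y' (T δ). Alternating words therefore pass through the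
opposite monoid. -/
lemma mul {T T' : Y U} {y y' : MonoidAlgebra ℂ Γ} (h : Represents U T y)
    (h' : Represents U T' y') : Represents U (T * T') (y' * y) := by
  rw [Represents, map_mul, Module.End.mul_apply, ← h, ← Module.End.mul_apply, ← commute_act,
    Module.End.mul_apply, ← h']
  rfl

lemma add {T T' : Y U} {y y' : MonoidAlgebra ℂ Γ} (h : Represents U T y)
    (h' : Represents U T' y') : Represents U (T + T') (y + y') := by
  rw [Represents, map_add, LinearMap.add_apply, ← h, ← h']
  rfl

lemma smul {T : Y U} {y : MonoidAlgebra ℂ Γ} (c : ℂ) (h : Represents U T y) :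
    Represents U (c • T) (c • y) := by
  rw [Represents, map_smul, LinearMap.smul_apply, ← h]
  rfl

lemma sum {κ : Type*} (s : Finset κ) {T : κ → Y U} {y : κ → MonoidAlgebra ℂ Γ}
    (h : ∀ i ∈ s, Represents U (T i) (y i)) : Represents U (∑ i ∈ s, T i) (∑ i ∈ s, y i) := by
  classical
  induction s using Finset.induction_on with
  | empty => simp [Represents]
  | insert i s hi ih =>
    rw [Finset.sum_insert hi, Finset.sum_insert hi]
    exact (h i (Finset.mem_insert_self _ _)).add
      (ih fun j hj => h j (Finset.mem_insert_of_mem hj))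

open MulOpposite in
lemma altProd {T T' : Y U} {y y' : MonoidAlgebra ℂ Γ} (h : Represents U T y)
    (h' : Represents U T' y') (n : ℕ) :
    Represents U (altProd T T' n) (unop (altProd (op y) (op y') n)) := by
  induction n generalizing T T' y y' with
  | zero => exact one
  | succ n ih => exact h.mul (ih h' h)

/-- `hinj` and `hsurj` say that the cosets x_i n U enumerate the cosets in U n U without repetition.
-/
lemma standard [Finite Γ] {κ : Type*} [Fintype κ] (n : Γ) (x : κ → Γ) (hx : ∀ i, x i ∈ U)
    (hinj : ∀ i j, (x i * n)⁻¹ * (x j * n) ∈ U → i = j)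
    (hsurj : ∀ u ∈ U, ∃ i, ∃ v ∈ U, u * n = x i * n * v) :
    Represents U (standard U n) ((∑ i, MonoidAlgebra.of ℂ Γ (x i)) * MonoidAlgebra.of ℂ Γ n) := by
  classical
  rw [Represents, Finset.sum_mul, map_sum, LinearMap.sum_apply]
  simp only [← map_mul (MonoidAlgebra.of ℂ Γ), act_of_basePoint]
  funext z
  rw [Finset.sum_apply]
  have h1 : ((YokonumaHecke.standard U n : Y U) : Module.End ℂ (Γ ⧸ U → ℂ)) (basePoint U) z =
      if InPosition U n ((1 : Γ) : Γ ⧸ U) z then 1 else 0 := by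
    let := Fintype.ofFinite (Γ ⧸ U)
    change (∑ y : Γ ⧸ U, if InPosition U n y z then basePoint U y else 0) = _
    rw [Finset.sum_eq_single ((1 : Γ) : Γ ⧸ U)]
    · simp [basePoint]
    · intro y _ hy
      simp [basePoint, hy]
    · simp
  rw [h1]
  have h2 : InPosition U n ((1 : Γ) : Γ ⧸ U) z ↔ ∃ i, z = ((x i * n : Γ) : Γ ⧸ U) := by
    constructor
    · rintro ⟨g, g', hg, rfl, hgg'⟩
      obtain ⟨u, hu, v, hv, h3⟩ := DoubleCoset.mem_doubleCoset.mp hgg'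
      have hg1 : g ∈ U := by
        have := QuotientGroup.eq.mp hg
        simpa using this
      obtain ⟨i, v', hv', h4⟩ := hsurj (g * u) (mul_mem hg1 hu)
      refine ⟨i, ?_⟩
      have h5 : g' = x i * n * (v' * v) := by
        rw [← mul_assoc, ← h4, mul_assoc g, mul_assoc g, ← h3, mul_inv_cancel_left]
      rw [h5]
      exact QuotientGroup.mk_mul_of_mem _ (mul_mem hv' hv)
    · rintro ⟨i, rfl⟩
      refine ⟨1, x i * n, rfl, rfl, DoubleCoset.mem_doubleCoset.mpr ⟨x i, hx i, 1, one_mem _, ?_⟩⟩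
      simp
  by_cases h3 : ∃ i, z = ((x i * n : Γ) : Γ ⧸ U)
  · rw [if_pos (h2.mpr h3)]
    obtain ⟨i, rfl⟩ := h3
    rw [Finset.sum_eq_single i]
    · simp
    · intro j _ hj
      rw [Pi.single_apply, if_neg]
      intro h4
      exact hj (hinj i j (QuotientGroup.eq.mp h4)).symm
    · simp
  · rw [if_neg fun h => h3 (h2.mp h)]
    rw [Finset.sum_eq_zero]
    intro i _
    rw [Pi.single_apply, if_neg]
    intro h4
    exact h3 ⟨i, h4⟩

lemma standard_of_normalizes [Finite Γ] (t : Γ) (ht : ∀ u ∈ U, t⁻¹ * u * t ∈ U) :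
    Represents U (YokonumaHecke.standard U t) (MonoidAlgebra.of ℂ Γ t) := by
  have h := standard (U := U) (κ := Unit) t (fun _ => 1) (fun _ => one_mem _) (fun _ _ _ => rfl)
    (fun u hu => ⟨(), _, ht u hu, by group⟩)
  simpa using h

end Represents

end

end YokonumaHecke

namespace YokonumaHecke

open SplitGroup

/-! ### The character sum and formal consequences of a quadratic relation -/

section

lemma sum_eq_zero_add_sum_units {F M : Type*} [Field F] [Fintype F] [Fintype Fˣ]
    [AddCommMonoid M] (f : F → M) : ∑ a, f a = f 0 + ∑ u : Fˣ, f u := by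
  classical
  have h : ∑ u : Fˣ, f u = ∑ a ∈ Finset.univ.erase (0 : F), f a := by
    refine Finset.sum_bij (fun u _ => (u : F)) (fun u _ => ?_) (fun u _ v _ h => Units.ext h)
      (fun a ha => ?_) (fun _ _ => rfl)
    · simp
    · exact ⟨Units.mk0 a (Finset.ne_of_mem_erase ha), Finset.mem_univ _, rfl⟩
  rw [h, Finset.add_sum_erase _ _ (Finset.mem_univ _)]

lemma sum_inducedChar {p : ℕ} [Fact p.Prime] (F : Type*) [Field F] [Fintype F] [Fintype Fˣ]
    [Algebra (ZMod p) F] (ψ : AddChar (ZMod p) ℂ) (hψ : ψ ≠ 1) :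
    ∑ r : Fˣ, inducedChar F ψ r = -1 := by
  let χ : AddChar F ℂ := ψ.compAddMonoidHom (Algebra.trace (ZMod p) F).toAddMonoidHom
  have hχ : χ ≠ 1 := by
    intro h
    apply hψ
    ext a
    obtain ⟨r, rfl⟩ := Algebra.trace_surjective (ZMod p) F a
    exact DFunLike.congr_fun h r
  have h1 := AddChar.sum_eq_zero_of_ne_one hχ
  rw [sum_eq_zero_add_sum_units] at h1
  rw [AddChar.map_zero_eq_one] at h1
  exact eq_neg_of_add_eq_zero_right h1

/-- Juyumaya's element multiplied by a generator that satisfies a quadratic relation. -/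
lemma juyumaya_mul {A C : Type*} [Ring A] [Algebra ℂ A] [CommGroup C] [Fintype C] (R : A)
    (H : C →* A) (z : C) (Q : ℂ) (hQ : Q ≠ 0) (ψ : C → ℂ) (hψ : ∑ r, ψ r = -1)
    (hRH : ∀ t, R * H t = H t⁻¹ * R) (hR : R * R = Q • H z + R * ∑ r, H r) :
    (Q⁻¹ • (∑ r, H r + R * ∑ r, ψ r • H r)) * R = ∑ r, ψ r • H (z * r⁻¹) := by
  have h1 : (∑ r, H r) * R = R * ∑ r, H r := by
    rw [Finset.sum_mul, Finset.mul_sum]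
    refine Fintype.sum_equiv (Equiv.inv C) _ _ fun r => ?_
    rw [Equiv.inv_apply, hRH, inv_inv]
  have h2 : (∑ r, ψ r • H r) * R = R * ∑ r, ψ r • H r⁻¹ := by
    rw [Finset.sum_mul, Finset.mul_sum]
    refine Finset.sum_congr rfl fun r _ => ?_
    rw [smul_mul_assoc, mul_smul_comm, hRH, inv_inv]
  -- The sum over the group absorbs every H(t), so only ∑ ψ = -1 remains; this produces the
  -- cancellation.
  have h3 : (∑ r, H r) * ∑ r, ψ r • H r⁻¹ = - ∑ r, H r := by
    have h4 : ∀ t, (∑ r, H r) * H t = ∑ r, H r := by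
      intro t
      rw [Finset.sum_mul]
      exact Fintype.sum_equiv (Equiv.mulRight t) _ _ fun r => (map_mul H r t).symm
    rw [Finset.mul_sum]
    simp only [mul_smul_comm, h4]
    rw [← Finset.sum_smul, hψ, neg_one_smul]
  rw [smul_mul_assoc, add_mul, h1, mul_assoc, h2, ← mul_assoc, hR, add_mul, mul_assoc, h3,
    smul_mul_assoc, mul_neg, add_comm, neg_add_cancel_right, smul_smul, inv_mul_cancel₀ hQ, one_smul,
    Finset.mul_sum]
  refine Finset.sum_congr rfl fun r _ => ?_
  rw [mul_smul_comm, map_mul]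

/-- With E = ∑ H(r), which commutes with R, the relation reads R (R - E) = (R - E) R = Q H(z), a
unit. -/
lemma isUnit_of_quadratic {A C : Type*} [Ring A] [Algebra ℂ A] [CommGroup C] [Fintype C] (R : A)
    (H : C →* A) (z : C) (Q : ℂ) (hQ : Q ≠ 0) (hRH : ∀ t, R * H t = H t⁻¹ * R)
    (hR : R * R = Q • H z + R * ∑ r, H r) : IsUnit R := by
  have h1 : (∑ r, H r) * R = R * ∑ r, H r := by
    rw [Finset.sum_mul, Finset.mul_sum]
    refine Fintype.sum_equiv (Equiv.inv C) _ _ fun r => ?_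
    rw [Equiv.inv_apply, hRH, inv_inv]
  have h2 : IsUnit (Q • H z) := by
    have h3 : IsUnit (H z) := (Group.isUnit z).map H
    exact h3.smul (Units.mk0 Q hQ)
  have h3 : R * (R - ∑ r, H r) = Q • H z := by rw [mul_sub, hR, add_sub_cancel_right]
  have h4 : (R - ∑ r, H r) * R = Q • H z := by rw [sub_mul, h1, hR, add_sub_cancel_right]
  obtain ⟨u, hu⟩ := h2
  rw [← hu] at h3 h4
  refine ⟨⟨R, (R - ∑ r, H r) * ↑u⁻¹, ?_, ?_⟩, rfl⟩
  · rw [← mul_assoc, h3, Units.mul_inv]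
  · have h5 : ↑u⁻¹ * (R - ∑ r, H r) = (R - ∑ r, H r) * ↑u⁻¹ :=
      left_inv_eq_right_inv (a := R) (by rw [mul_assoc, h4, Units.inv_mul])
        (by rw [← mul_assoc, h3, Units.mul_inv])
    rw [← h5, mul_assoc, h4, Units.inv_mul]

end

/-! ### The braid criterion, and the relations among standard operators -/

section

variable {ι X Y' : Type*} [Finite ι] [AddCommGroup X] [AddCommGroup Y'] {P : RootDatum ι X Y'}
  {m : Type*} [Fintype m] [DecidableEq m] (V : AdmissibleLattice P m) (b : P.Base)
  {F : Type*} [Field F] [Fintype F]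

/-- Moving the inverses to the right reflects the index of each Θ they pass, which reproduces the
recursion of `altRoots`. -/
lemma altProd_mul_inv {A : Type*} [Monoid A] (r r' : Aˣ) (α β : ι) (Θ : ι → A)
    (h : ∀ γ, r * Θ γ = Θ (P.reflectionPerm α γ) * r)
    (h' : ∀ γ, r' * Θ γ = Θ (P.reflectionPerm β γ) * r') (n : ℕ) :
    altProd (Θ α * ↑r⁻¹) (Θ β * ↑r'⁻¹) n =
      ((altRoots P α β n).map Θ).prod * ↑(altProd r⁻¹ r'⁻¹ n) := by
  have hlist : ∀ (r : Aˣ) (α : ι) (_ : ∀ γ, r * Θ γ = Θ (P.reflectionPerm α γ) * r) (l : List ι),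
      ↑r⁻¹ * (l.map Θ).prod = ((l.map (P.reflectionPerm α)).map Θ).prod * ↑r⁻¹ := by
    intro r α h l
    induction l with
    | nil => simp
    | cons γ l ih =>
      simp only [List.map_cons, List.prod_cons]
      have h1 : ↑r⁻¹ * Θ γ = Θ (P.reflectionPerm α γ) * ↑r⁻¹ := by
        rw [Units.inv_mul_eq_iff_eq_mul, ← mul_assoc, h, P.reflectionPerm_self, Units.mul_inv_cancel_right]
      rw [← mul_assoc, h1, mul_assoc, ih, mul_assoc]
  induction n generalizing r r' α β with
  | zero => simp [altProd, altRoots]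
  | succ n ih =>
    rw [altProd, ih r' r β α h' h, altRoots, altProd, Units.val_mul, List.map_cons, List.prod_cons,
      mul_assoc, ← mul_assoc _ (List.prod _), hlist r α h]
    simp only [mul_assoc]

/-- The braid relation for elements `L`, `L'` that agree with generators `R`, `R'` that satisfy the
braid relation up to commuting factors indexed by the roots. -/
lemma altProd_comm_of_mul_eq [P.IsReduced] {A : Type*} [Monoid A] {α β : ι} {n : ℕ}
    (hs : IsSimplePair (P := P) α β n) (Θ : ι → A) {R R' L L' : A} (hR : IsUnit R)
    (hR' : IsUnit R') (hL : L * R = Θ α) (hL' : L' * R' = Θ β)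
    (h : ∀ γ, R * Θ γ = Θ (P.reflectionPerm α γ) * R)
    (h' : ∀ γ, R' * Θ γ = Θ (P.reflectionPerm β γ) * R')
    (hc : ∀ γ δ, Commute (Θ γ) (Θ δ)) (hb : altProd R R' n = altProd R' R n) :
    altProd L L' n = altProd L' L n := by
  obtain ⟨r, rfl⟩ := hR
  obtain ⟨r', rfl⟩ := hR'
  have h5 : altProd r r' n = altProd r' r n := by
    apply Units.val_injective
    rw [← Units.coeHom_apply, ← Units.coeHom_apply, map_altProd, map_altProd]
    exact hb
  rw [(Units.eq_mul_inv_iff_mul_eq r).mpr hL, (Units.eq_mul_inv_iff_mul_eq r').mpr hL',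
    altProd_mul_inv r r' α β Θ h h', altProd_mul_inv r' r β α Θ h' h,
    altProd_inv_comm h5, hs.altRoots_reverse]
  congr 1
  refine ((List.reverse_perm _).map _).symm.prod_eq' ?_
  exact List.pairwise_map.mpr (List.pairwise_of_forall fun γ δ => hc γ δ)

/-- The standard operator of the value `γ^∨(t)` of a coroot. -/
def HC (γ : ι) (t : Fˣ) : Y (V.U b F) := standard (V.U b F) (V.cochG γ t)

lemma represents_HC (γ : ι) (t : Fˣ) :
    Represents (V.U b F) (HC V b γ t) (MonoidAlgebra.of ℂ _ (V.cochG γ t)) :=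
  Represents.standard_of_normalizes _ fun _ hu => V.cochG_conj_mem_U γ t hu

lemma HC_mul (γ : ι) (t s : Fˣ) : HC V b γ (t * s) = HC V b γ t * HC V b γ s := by
  refine (represents_HC V b γ (t * s)).ext ((represents_HC V b γ t).mul (represents_HC V b γ s)) ?_
  rw [← map_mul, ← V.cochG_mul, mul_comm]

lemma HC_commute (γ δ : ι) (t s : Fˣ) : Commute (HC V b γ t) (HC V b δ s) := by
  refine ((represents_HC V b γ t).mul (represents_HC V b δ s)).ext
    ((represents_HC V b δ s).mul (represents_HC V b γ t)) ?_
  rw [← map_mul, ← map_mul, (V.cochG_commute γ δ t s).eq]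

lemma HC_one (γ : ι) : HC V b γ (1 : Fˣ) = 1 := by
  refine (represents_HC V b γ 1).ext Represents.one ?_
  rw [V.cochG_one, map_one]

variable [P.IsReduced] {b} {α : ι} (hα : α ∈ b.support)

include hα

/-- The x_α(a) n_α represent the cosets in U n_α U: the complement of U_α in U is carried into U by
n_α, while no nontrivial element of U_α is. -/
lemma represents_R (c : Fˣ) : Represents (V.U b F) (R V b α c)
    (V.rootSum (MonoidAlgebra.of ℂ _) α * MonoidAlgebra.of ℂ _ (V.n α c)) := by
  refine Represents.standard (V.n α c) (fun a : F => V.xG α a)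
    (fun a => V.xG_mem_U (posCone_of_mem_support hα) a) (fun a d had => ?_) (fun u hu => ?_)
  · have h1 : (V.n α c)⁻¹ * V.xG α (d - a) * V.n α c ∈ V.U b F := by
      rw [sub_eq_neg_add, V.xG_add, V.xG_neg]
      simpa [mul_assoc] using had
    exact (sub_eq_zero.mp (V.eq_zero_of_n_conj_xG_mem hα c _ h1)).symm
  · obtain ⟨a, v, hv, rfl, h1⟩ := V.exists_eq_xG_mul hα c hu
    exact ⟨a, _, h1, by group⟩

lemma R_mul_HC (c t : Fˣ) (γ : ι) :
    R V b α c * HC V b γ t = HC V b (P.reflectionPerm α γ) t * R V b α c := by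
  refine ((represents_R V hα c).mul (represents_HC V b γ t)).ext
    ((represents_HC V b _ t).mul (represents_R V hα c)) ?_
  rw [mul_assoc, ← map_mul (MonoidAlgebra.of ℂ _), V.n_mul_cochG, P.reflectionPerm_self,
    map_mul (MonoidAlgebra.of ℂ _), ← mul_assoc, ← mul_assoc, V.cochG_mul_rootSum]

/-- The square expands into terms X n x_α(a) n, with X the sum over the root subgroup. For a = 0, n²
= α^∨(-1) and the sum X acts on the base point as |F|. For a ≠ 0 the rank one relation applies, and
X and U absorb the outer unipotent factors. -/
lemma R_mul_self [Fintype Fˣ] (c : Fˣ) : R V b α c * R V b α c =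
    (Fintype.card F : ℂ) • HC V b α (-1) + R V b α c * ∑ r : Fˣ, HC V b α r := by
  have hR := represents_R V hα c
  have hH := Represents.sum Finset.univ fun (r : Fˣ) _ => represents_HC V b α r
  refine (hR.mul hR).ext (((represents_HC V b α (-1)).smul _).add (hR.mul hH)) ?_
  set ρ := MonoidAlgebra.of ℂ (V.G F)
  set X₀ := V.rootSum ρ α
  have hX : ∀ y : MonoidAlgebra ℂ (V.G F), act (V.U b F) (y * X₀) (basePoint _) =
      (Fintype.card F : ℂ) • act (V.U b F) y (basePoint _) := by
    intro y
    simp only [X₀, AdmissibleLattice.rootSum]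
    rw [Finset.mul_sum, map_sum, LinearMap.sum_apply,
      Finset.sum_congr rfl fun a _ =>
        act_mul_of_mem (V.U b F) y (V.xG_mem_U (posCone_of_mem_support hα) a),
      Finset.sum_const, Finset.card_univ, Nat.cast_smul_eq_nsmul]
  have h1 : X₀ * ρ (V.n α c) * (X₀ * ρ (V.n α c)) = ∑ a : F, X₀ * ρ (V.n α c * V.xG α a * V.n α c) := by
    simp only [map_mul]
    rw [← Finset.mul_sum, ← Finset.sum_mul, ← Finset.mul_sum]
    simp only [mul_assoc]
    rfl
  have h2 : ∀ a : Fˣ, act (V.U b F) (X₀ * ρ (V.n α c * V.xG α (a : F) * V.n α c)) (basePoint _) =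
      act (V.U b F) (ρ (V.cochG α (-(c * a⁻¹))) * (X₀ * ρ (V.n α c))) (basePoint _) := by
    intro a
    rw [V.n_mul_xG_mul_n, map_mul ρ, ← mul_assoc,
      act_mul_of_mem (V.U b F) _ (V.xG_mem_U (posCone_of_mem_support hα) _), map_mul ρ, map_mul ρ,
      ← mul_assoc, ← mul_assoc, V.rootSum_mul_xG, ← V.cochG_mul_rootSum, mul_assoc]
  rw [h1, map_sum, LinearMap.sum_apply, sum_eq_zero_add_sum_units, V.xG_zero, mul_one, V.n_mul_self,
    ← V.cochG_mul_rootSum, hX, map_add, LinearMap.add_apply, map_smul, LinearMap.smul_apply]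
  congr 1
  rw [Finset.sum_mul, map_sum, LinearMap.sum_apply]
  -- The substitution r = -c/a removes the dependence on the chosen parametrization `c` of the root
  -- subgroup.
  refine Fintype.sum_equiv (((Equiv.inv Fˣ).trans (Equiv.mulLeft c)).trans (Equiv.neg Fˣ)) _ _
    fun a => ?_
  rw [h2]
  rfl

omit hα

lemma altProd_R {α β : ι} (hα : α ∈ b.support) (hβ : β ∈ b.support) {n : ℕ}
    (h : IsSimplePair (P := P) α β n) (c d : Fˣ) :
    altProd (R V b α c) (R V b β d) n = altProd (R V b β d) (R V b α c) n := by
  refine ((represents_R V hα c).altProd (represents_R V hβ d) n).ext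
    ((represents_R V hβ d).altProd (represents_R V hα c) n) ?_
  have : IsAddTorsionFree (MonoidAlgebra ℂ (V.G F)) := .of_isTorsionFree ℂ _
  rw [altProd_op_comm]
  exact V.altProd_rootSum_mul_n_comm _ h c d

end

end YokonumaHecke

namespace YokonumaHecke

open SplitGroup

/-! ### Juyumaya's elements -/

section

variable {ι X Y' : Type*} [Finite ι] [AddCommGroup X] [AddCommGroup Y'] {P : RootDatum ι X Y'}
  {m : Type*} [Fintype m] [DecidableEq m] (V : AdmissibleLattice P m) (b : P.Base)
  {F : Type*} [Field F] [Fintype F] [Fintype Fˣ]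

/-- `HC` as a homomorphism. -/
def HCHom (γ : ι) : Fˣ →* Y (V.U b F) where
  toFun := HC V b γ
  map_one' := HC_one V b γ
  map_mul' := HC_mul V b γ

lemma L_eq (Q : ℂ) (ψ : F → ℂ) (α : ι) (c : Fˣ) : L V b Q ψ α c =
    Q⁻¹ • (∑ r : Fˣ, HCHom V b α r + R V b α c * ∑ r : Fˣ, ψ r • HCHom V b α r) := by
  have h : ∀ r : Fˣ, H V b α c r = HCHom V b α r := fun r => by
    rw [H, V.h_eq_cochG]
    rfl
  rw [L, E, Psi]
  simp only [h]
  congr!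

/-- The element `L_α R_α`, which depends only on the coroot of `α`. -/
def theta (ψ : F → ℂ) (γ : ι) : Y (V.U b F) := ∑ r : Fˣ, ψ r • HCHom V b γ (-1 * r⁻¹)

lemma theta_commute (ψ : F → ℂ) (γ δ : ι) : Commute (theta V b ψ γ) (theta V b ψ δ) :=
  Commute.sum_left _ _ _ fun _ _ => Commute.sum_right _ _ _ fun _ _ =>
    ((HC_commute V b γ δ _ _).smul_left _).smul_right _

variable [P.IsReduced] {b} {α β : ι} (hα : α ∈ b.support) (hβ : β ∈ b.support)

include hα

lemma R_mul_theta (ψ : F → ℂ) (c : Fˣ) (γ : ι) :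
    R V b α c * theta V b ψ γ = theta V b ψ (P.reflectionPerm α γ) * R V b α c := by
  rw [theta, theta, Finset.mul_sum, Finset.sum_mul]
  refine Finset.sum_congr rfl fun r _ => ?_
  rw [mul_smul_comm, smul_mul_assoc]
  congr 1
  exact R_mul_HC V hα c _ γ

lemma R_mul_HCHom (c t : Fˣ) :
    R V b α c * HCHom V b α t = HCHom V b α t⁻¹ * R V b α c := by
  have h := R_mul_HC V hα c t α
  have h1 : HC V b (P.reflectionPerm α α) t = HC V b α t⁻¹ := by
    rw [HC, V.cochG_neg]
    rfl
  rwa [h1] at h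

lemma R_mul_self' (c : Fˣ) : R V b α c * R V b α c =
    (Fintype.card F : ℂ) • HCHom V b α (-1) + R V b α c * ∑ r : Fˣ, HCHom V b α r :=
  R_mul_self V hα c

lemma isUnit_R (c : Fˣ) : IsUnit (R V b α c) := by
  have hQ : (Fintype.card F : ℂ) ≠ 0 := Nat.cast_ne_zero.mpr Fintype.card_ne_zero
  have key := isUnit_of_quadratic (A := Y (V.U b F)) (C := Fˣ) (R V b α c) (HCHom V b α) (-1 : Fˣ)
    (Fintype.card F : ℂ) hQ
  have h1 := key fun t => R_mul_HCHom V hα c t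
  have h2 := R_mul_self' V hα c
  exact h1 h2

lemma L_mul_R (ψ : F → ℂ) (hψ : ∑ r : Fˣ, ψ r = -1) (c : Fˣ) :
    L V b (Fintype.card F) ψ α c * R V b α c = theta V b ψ α := by
  have hQ : (Fintype.card F : ℂ) ≠ 0 := Nat.cast_ne_zero.mpr Fintype.card_ne_zero
  have key := juyumaya_mul (A := Y (V.U b F)) (C := Fˣ) (R V b α c) (HCHom V b α) (-1 : Fˣ)
    (Fintype.card F : ℂ) hQ (fun r : Fˣ => ψ r) hψ
  have h1 := key fun t => R_mul_HCHom V hα c t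
  have h2 := R_mul_self' V hα c
  have h3 := h1 h2
  rw [L_eq]
  exact h3

include hβ

/-- The braid relations for Juyumaya's elements. -/
theorem altProd_L {n : ℕ} (h : IsSimplePair (P := P) α β n) (ψ : F → ℂ)
    (hψ : ∑ r : Fˣ, ψ r = -1) (c d : Fˣ) :
    altProd (L V b (Fintype.card F) ψ α c) (L V b (Fintype.card F) ψ β d) n =
      altProd (L V b (Fintype.card F) ψ β d) (L V b (Fintype.card F) ψ α c) n := by
  have key := altProd_comm_of_mul_eq (A := Y (V.U b F)) h (theta V b ψ) (isUnit_R V hα c)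
    (isUnit_R V hβ d) (L_mul_R V hα ψ hψ c) (L_mul_R V hβ ψ hψ d)
  have h1 := key (fun γ => R_mul_theta V hα ψ c γ)
  have h2 := h1 (fun γ => R_mul_theta V hβ ψ d γ)
  exact h2 (fun γ δ => theta_commute V b ψ γ δ) (altProd_R V hα hβ h c d)

end

end YokonumaHecke

end

theorem mainTheorem2
    {ι X Y : Type*} [Finite ι] [AddCommGroup X] [AddCommGroup Y]
    (P : RootDatum ι X Y) [P.IsReduced] (hP : SplitGroup.IsSemisimple P) (b : P.Base)
    {m : Type*} [Fintype m] [DecidableEq m] (V : SplitGroup.AdmissibleLattice P m)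
    (p : ℕ) [Fact p.Prime]
    (k₀ : Type*) [Field k₀] [Finite k₀]
    (F : Type*) [Field F] [Finite F] [Algebra k₀ F] [Algebra (ZMod p) F]
    (q k : ℕ) (hq : Nat.card k₀ = q) (hk : Module.finrank k₀ F = k)
    (c : b.support → k₀ˣ)
    (ψ : AddChar (ZMod p) ℂ) (hψ : ψ ≠ 1)
    (L : b.support → YokonumaHecke.Y (V.U b F))
    (hL : ∀ s, L s = YokonumaHecke.L V b ((q : ℂ) ^ k) (YokonumaHecke.inducedChar F ψ) s
      (Units.map (algebraMap k₀ F) (c s)))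
    (s s' : b.support) :
    YokonumaHecke.altProd (L s) (L s')
        (orderOf (RootPairing.weylGroup.ofIdx P s * RootPairing.weylGroup.ofIdx P s')) =
      YokonumaHecke.altProd (L s') (L s)
        (orderOf (RootPairing.weylGroup.ofIdx P s * RootPairing.weylGroup.ofIdx P s')) := by
  by_cases hne : s = s'
  · rw [hne]
  have : Fintype F := Fintype.ofFinite F
  have : Fintype Fˣ := Fintype.ofFinite Fˣ
  have hQ : (q : ℂ) ^ k = (Fintype.card F : ℂ) := by
    rw [← hq, ← hk, ← Nat.cast_pow, ← Module.natCard_eq_pow_finrank, Nat.card_eq_fintype_card]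
  rw [hL, hL, hQ]
  exact YokonumaHecke.altProd_L V s.2 s'.2 (SplitGroup.isSimplePair_of_mem_support b s.2 s'.2
    fun h => hne (Subtype.ext h)) _ (YokonumaHecke.sum_inducedChar F ψ hψ) _ _
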